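/- Work in one of three categories: smooth ($C^\infty$, $\mathbb K=\mathbb R$), real-analytic ($\mathbb K=\mathbb R$) or complex-analytic ($\mathbb K=\mathbb C$); all germs are taken at $0$. A singular symplectic form-germ on $\mathbb K^{2n}$ is the germ of a closed $2$-form $\omega$ whose Martinet hypersurface $\Sigma_2(\omega)=\{x:\omega^n|_x=0\}$ is nowhere dense. Write $\omega^n=f\,dx_1\wedge\cdots\wedge dx_{2n}$; $\Sigma_2(\omega)$ is called structurally smooth at $0$ if $f(0)=0$ and $df_0\neq 0$. For $\mathbb K=\mathbb R$ the canonical orientation of a structurally smooth $\Sigma_2=\Sigma_2(\omega)$ is the one given by the volume form $\Omega_{\Sigma_2}$ on $\Sigma_2$ determined by $dh\wedge\Omega_{\Sigma_2}=\omega^n/h$, where $h$ is any function-germ with $\Sigma_2=\{h=0\}$ and $dh_0\ne 0$ (the orientation does not depend on $h$). For a $2$-form-germ $\sigma$ on a $(2n-1)$-dimensional manifold with local coordinates $q=(q_1,\dots,q_{2n-1})$ centred at the base point, write $\sigma^{n-1}=\sum_{i} g_i\,dq_1\wedge\cdots\wedge\widehat{dq_i}\wedge\cdots\wedge dq_{2n-1}$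 and let $\operatorname{span} j^1_0\sigma^{n-1}$ be the $\mathbb K$-linear span of the $1$-jets $j^1_0g_1,\dots,j^1_0g_{2n-1}$ at $0$. **Theorem.** Let $\omega_0,\omega_1$ be singular symplectic form-germs at $0$ on $\mathbb K^{2n}$ with a common Martinet hypersurface-germ $\Sigma_2$ that is structurally smooth at $0$ (for $\omega_0$ and for $\omega_1$), and let $\iota:\Sigma_2\hookrightarrow\mathbb K^{2n}$ be the inclusion. Suppose that $\iota^*\omega_0=\iota^*\omega_1=\sigma$ as germs at $0$, that $\operatorname{rank}(\sigma|_0)=2n-4$, and that $\dim_{\mathbb K}\operatorname{span} j^1_0\sigma^{n-1}=2$. Then: 1. $\ker(\omega_0^{n-1}|_0)=\ker(\omega_1^{n-1}|_0)$, where $\ker(\omega_i^{n-1}|_0)=\{v\in T_0\mathbb K^{2n}: v\rfloor(\omega_i^{n-1}|_0)=0\}$. 2. If $\mathbb K=\mathbb R$, assume in addition that $\omega_0$ and $\omega_1$ define the same canonical orientation of $\Sigma_2$. Then there is a diffeomorphism-germ $\Psi:(\mathbb K^{2n},0)\to(\mathbb K^{2n},0)$ of the category (smooth, real-analytic or complex-analytic,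 respectively) with $\Psi^*\omega_1=\omega_0$. -/

import Mathlib

open Filter Topology

noncomputable section

namespace SingularSymplectic

/-- `𝕜^m` with its standard coordinates. -/
abbrev Space (𝕜 : Type) (m : ℕ) : Type := Fin m → 𝕜

/-- Differential `p`-forms on `𝕜^m`, in the representation of `extDeriv`. Germs at `0` are
handled through representatives: everything below depends only on the germ at `0`. -/
abbrev Form (𝕜 : Type) [RCLike 𝕜] (m p : ℕ) : Type :=
  Space 𝕜 m → Space 𝕜 m [⋀^Fin p]→L[𝕜] 𝕜

section Algebra

variable {𝕜 V : Type} [RCLike 𝕜] [AddCommGroup V] [Module 𝕜 V]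

/-- The wedge product of alternating forms, normalised by
`(a ∧ b) (v) = ∑ sign s * a (v ∘ s ∘ inl) * b (v ∘ s ∘ inr)` over the `(p, q)`-shuffles `s`. -/
def wedge {p q : ℕ} (a : V [⋀^Fin p]→ₗ[𝕜] 𝕜) (b : V [⋀^Fin q]→ₗ[𝕜] 𝕜) :
    V [⋀^Fin (p + q)]→ₗ[𝕜] 𝕜 :=
  ((LinearMap.mul' 𝕜 𝕜).compAlternatingMap (a.domCoprod b)).domDomCongr finSumFinEquiv

/-- The power `η ∧ ⋯ ∧ η` (`k` factors) of a `2`-form. -/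
def wedgePow (η : V [⋀^Fin 2]→ₗ[𝕜] 𝕜) : (k : ℕ) → V [⋀^Fin (2 * k)]→ₗ[𝕜] 𝕜
  | 0 => AlternatingMap.constOfIsEmpty 𝕜 V (Fin 0) 1
  | k + 1 => wedge (wedgePow η k) η

/-- The kernel `{v | v ⌟ η = 0}` of an alternating form: `η` vanishes as soon as one of its
arguments is `v`. -/
def formKernel {p : ℕ} (η : V [⋀^Fin p]→ₗ[𝕜] 𝕜) : Submodule 𝕜 V where
  carrier := {v | ∀ (w : Fin p → V) (i : Fin p), η (Function.update w i v) = 0}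
  zero_mem' := fun w i => η.map_update_zero w i
  add_mem' := fun {a b} ha hb w i => by rw [η.map_update_add, ha w i, hb w i, add_zero]
  smul_mem' := fun c a ha w i => by rw [η.map_update_smul, ha w i, smul_zero]

end Algebra

section Germs

variable {𝕜 : Type} [RCLike 𝕜]

/-- `g` is of class `C^r` on a neighbourhood of `0`. For `r = ∞` this is a smooth germ, for
`r = ω` an analytic one. -/
def IsGermOfClass {E F : Type} [NormedAddCommGroup E] [NormedSpace 𝕜 E]
    [NormedAddCommGroup F] [NormedSpace 𝕜 F] (r : WithTop ℕ∞) (g : E → F) : Prop :=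
  ∀ᶠ x in 𝓝 (0 : E), ContDiffAt 𝕜 r g x

/-- The pullback `φ^* η` of a differential form. -/
def pullback {m k p : ℕ} (φ : Space 𝕜 m → Space 𝕜 k) (η : Form 𝕜 k p) : Form 𝕜 m p :=
  fun x => (η (φ x)).compContinuousLinearMap (fderiv 𝕜 φ x)

/-- The rank of a `2`-form at a point: the rank of `v ↦ v ⌟ η`. -/
def formRank {m : ℕ} (η : Space 𝕜 m [⋀^Fin 2]→L[𝕜] 𝕜) : ℕ :=
  Module.finrank 𝕜 (LinearMap.range η.curryLeft.toLinearMap)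

/-- The power `η^k` of a differential `2`-form, at the point `x`. -/
def formPow {m : ℕ} (η : Form 𝕜 m 2) (k : ℕ) (x : Space 𝕜 m) :
    Space 𝕜 m [⋀^Fin (2 * k)]→ₗ[𝕜] 𝕜 :=
  wedgePow (η x).toAlternatingMap k

/-- The Martinet set `Σ₂(ω) = {x | ω^n|_x = 0}` of a `2`-form on `𝕜^{2n}`. -/
def martinetSet {n : ℕ} (ω : Form 𝕜 (2 * n) 2) : Set (Space 𝕜 (2 * n)) :=
  {x | formPow ω n x = 0}

/-- The function `f` with `ω^n = f dx_1 ∧ ⋯ ∧ dx_{2n}`. -/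
def martinetFun {n : ℕ} (ω : Form 𝕜 (2 * n) 2) (x : Space 𝕜 (2 * n)) : 𝕜 :=
  formPow ω n x (fun i => Pi.single i 1)

/-- Germs at `0` of singular symplectic forms of class `C^r` on `𝕜^{2n}`: closed `2`-forms whose
Martinet set is nowhere dense. -/
structure IsSingularSymplectic {n : ℕ} (r : WithTop ℕ∞) (ω : Form 𝕜 (2 * n) 2) : Prop where
  regular : IsGermOfClass (𝕜 := 𝕜) r ω
  closed : ∀ᶠ x in 𝓝 0, extDeriv ω x = 0
  nowhereDense : ∃ U ∈ 𝓝 (0 : Space 𝕜 (2 * n)), IsNowhereDense (martinetSet ω ∩ U)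

/-- The Martinet hypersurface is structurally smooth at `0`: `f(0) = 0` and `df_0 ≠ 0`, where
`ω^n = f dx_1 ∧ ⋯ ∧ dx_{2n}`. -/
def IsStructurallySmooth {n : ℕ} (ω : Form 𝕜 (2 * n) 2) : Prop :=
  martinetFun ω 0 = 0 ∧ fderiv 𝕜 (martinetFun ω) 0 ≠ 0

/-- `ι : (𝕜^m, 0) → (𝕜^k, 0)` is the inclusion of the submanifold germ `S` at `0`, written in a
local chart of `S` of class `C^r` centred at `0`: an immersion germ which maps the neighbourhoods
of `0` onto the neighbourhoods of `0` in `S`. -/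
structure IsInclusion {m k : ℕ} (r : WithTop ℕ∞) (ι : Space 𝕜 m → Space 𝕜 k)
    (S : Set (Space 𝕜 k)) : Prop where
  regular : IsGermOfClass (𝕜 := 𝕜) r ι
  map_zero : ι 0 = 0
  immersion : Function.Injective (fderiv 𝕜 ι 0)
  image : Filter.map ι (𝓝 0) = 𝓝[S] 0

/-- The `1`-jet at `0` of a function germ, as an element of `J^1_0(𝕜^m, 𝕜) = 𝕜 × (𝕜^m)^*`. -/
def jetOne {m : ℕ} (g : Space 𝕜 m → 𝕜) : 𝕜 × (Space 𝕜 m →L[𝕜] 𝕜) :=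
  (g 0, fderiv 𝕜 g 0)

/-- The coefficient of `dq_{s 1} ∧ dq_{s 2} ∧ ⋯` (`s` increasing) in `σ^{n-1}`, for a `2`-form
`σ` on `𝕜^{2n-1}`. Such an `s` omits exactly one index. -/
def powCoeff {n : ℕ} (σ : Form 𝕜 (2 * n - 1) 2) (s : Fin (2 * (n - 1)) ↪o Fin (2 * n - 1))
    (q : Space 𝕜 (2 * n - 1)) : 𝕜 :=
  formPow σ (n - 1) q (fun j => Pi.single (s j) 1)

/-- `span j^1_0 σ^{n-1}`: the span of the `1`-jets at `0` of the coefficients of `σ^{n-1}`. -/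
def jetSpan {n : ℕ} (σ : Form 𝕜 (2 * n - 1) 2) :
    Submodule 𝕜 (𝕜 × (Space 𝕜 (2 * n - 1) →L[𝕜] 𝕜)) :=
  Submodule.span 𝕜 (Set.range fun s => jetOne (powCoeff σ s))

/-- `Ψ` restricts to a diffeomorphism germ `(𝕜^m, 0) → (𝕜^m, 0)` of class `C^r`. -/
structure IsDiffeoGerm {m : ℕ} (r : WithTop ℕ∞)
    (Ψ : OpenPartialHomeomorph (Space 𝕜 m) (Space 𝕜 m)) : Prop where
  zero_mem : (0 : Space 𝕜 m) ∈ Ψ.source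
  map_zero : Ψ 0 = 0
  contDiffOn : ContDiffOn 𝕜 r Ψ Ψ.source
  contDiffOn_symm : ContDiffOn 𝕜 r Ψ.symm Ψ.target

/-- There is a diffeomorphism germ `Ψ` of class `C^r` with `Ψ^* ω₁ = ω₀` as germs at `0`. -/
def AreEquivalent {m : ℕ} (r : WithTop ℕ∞) (ω₀ ω₁ : Form 𝕜 m 2) : Prop :=
  ∃ Ψ : OpenPartialHomeomorph (Space 𝕜 m) (Space 𝕜 m),
    IsDiffeoGerm r Ψ ∧ pullback Ψ ω₁ =ᶠ[𝓝 0] ω₀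

end Germs

/-- `o` is the canonical orientation of the Martinet hypersurface `Σ₂` of `ω`, read in the chart
given by `ι`: for a function germ `f` with `Σ₂ = {f = 0}` and `df_0 ≠ 0`, and a form germ `Ω` with
`df ∧ Ω = ω^n / f`, the volume form `ι^* Ω` on `Σ₂` induces `o` at all points near `0`.
The equation is written as `ω^n = f (df ∧ Ω)`, which also makes sense on `Σ₂`. -/
def IsCanonicalOrientation {n : ℕ} (r : WithTop ℕ∞) (ω : Form ℝ (2 * n) 2)
    (ι : Space ℝ (2 * n - 1) → Space ℝ (2 * n))
    (o : Orientation ℝ (Space ℝ (2 * n - 1)) (Fin (2 * n - 1))) : Prop :=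
  ∃ (hn : 1 + (2 * n - 1) = 2 * n) (f : Space ℝ (2 * n) → ℝ) (Ω : Form ℝ (2 * n) (2 * n - 1)),
    IsGermOfClass (𝕜 := ℝ) r f ∧ f 0 = 0 ∧ fderiv ℝ f 0 ≠ 0 ∧
    (∀ᶠ x in 𝓝 0, x ∈ martinetSet ω ↔ f x = 0) ∧
    IsGermOfClass (𝕜 := ℝ) r Ω ∧
    (∀ᶠ x in 𝓝 0, formPow ω n x =
      f x • (wedge (AlternatingMap.ofSubsingleton ℝ (Space ℝ (2 * n)) ℝ (0 : Fin 1)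
          (fderiv ℝ f x : Space ℝ (2 * n) →ₗ[ℝ] ℝ))
        (Ω x).toAlternatingMap).domDomCongr (finCongr hn)) ∧
    ∀ᶠ q in 𝓝 0, ∃ h : (pullback ι Ω q).toAlternatingMap ≠ 0, rayOfNeZero ℝ _ h = o

end SingularSymplectic

end

open SingularSymplectic
open scoped ContDiff

/-! Choose a chart `(t, q)` in which Σ₂ is `{t = 0}`. Because ω^n vanishes only to first order, ω₀
and ω₁ have corank at most two at the origin. The kernel W of σ at the origin has dimension three,
so the kernel of each form at 0 is a plane inside W, contraction with ∂_t is nonzero on W, and the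
normal derivative of the form is nonzero on the plane. This is the notion `IsFold`, reached in
`exists_isFold`.

Kernels. Differentiating kernel fields along Σ₂ shows that this plane is isotropic for every
tangential derivative D_xσ restricted to W. The 2-forms on a 3-space that vanish on two distinct
planes form a line, whereas the jet condition says that x ↦ D_xσ|_W has rank at least two. Hence the
two planes coincide (`normal_eq_zero`). A linear shear that is the identity on T_0Σ₂ then carries
one form at 0 to the other (`exists_shear`). It fixes the kernel plane pointwise, and the statement
on kernels of powers follows by `formKernel_wedgePow_eq`.

Moser's method. After the shear the forms agree at 0 and differ by d(tγ) with γ(0) = 0. Along the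
linear path η_s one has to solve V⌟η_s = -tγ although η_s degenerates on `{t = 0}`. On the
complement of a nondegenerate block η_s is a single function, a Pfaffian factor, and the equation is
solvable if that factor is t times a unit. It vanishes on `{t = 0}` because the two forms have a
common kernel vector there (`kernel_combination`, `exists_common_kernel`). It vanishes only to first
order because the normal derivatives of both forms agree on the kernel plane (`fderiv_normal_eq`),
which again rests on the rank-two condition. The resulting field vanishes at the origin, so nearby
members of the path are equivalent, and connectedness of the scalar field joins s = 0 to s = 1.

The smooth and the analytic categories are treated together: flows and parameter integrals come from
superposition operators on `C([0,1], E)` and the inverse function theorem, both available in class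
`C^r` over ℝ and ℂ. -/

noncomputable section

namespace SingularSymplectic

open Filter Topology Set

/-! ### Regularity of superposition operators on spaces of continuous curves. -/

section Superposition

variable {𝕜 : Type} [RCLike 𝕜]
variable {E F G : Type} [NormedAddCommGroup E] [NormedSpace 𝕜 E]
  [NormedAddCommGroup F] [NormedSpace 𝕜 F] [NormedAddCommGroup G] [NormedSpace 𝕜 G]
variable {K : Type} [TopologicalSpace K] [CompactSpace K]

/-- `g` is of class `C^r` on a neighbourhood of `p`. -/
def GermAt (𝕜 : Type) [RCLike 𝕜] {E F : Type} [NormedAddCommGroup E] [NormedSpace 𝕜 E]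
    [NormedAddCommGroup F] [NormedSpace 𝕜 F] (r : WithTop ℕ∞) (g : E → F) (p : E) : Prop :=
  ∀ᶠ x in 𝓝 p, ContDiffAt 𝕜 r g x

/-- The superposition operator `u ↦ g ∘ u` on spaces of continuous maps. -/
def superpose (K : Type) [TopologicalSpace K] (g : E → F) (u : C(K, E)) : C(K, F) :=
  open Classical in if h : Continuous (g ∘ u) then ⟨g ∘ u, h⟩ else 0

lemma superpose_apply {K : Type} [TopologicalSpace K] {g : E → F}
    {s : Set E} (hg : ContinuousOn g s) {u : C(K, E)}
    (hu : ∀ τ, u τ ∈ s) (τ : K) : superpose K g u τ = g (u τ) := by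
  have h : Continuous (g ∘ u) := hg.comp_continuous u.continuous hu
  simp [superpose, h]

lemma isOpen_mapsInto {s : Set E} (hs : IsOpen s) : IsOpen {u : C(K, E) | ∀ τ, u τ ∈ s} := by
  have := ContinuousMap.isOpen_setOfPred_mapsTo (X := K) (Y := E) isCompact_univ hs
  simpa [MapsTo] using this

/-- Pointwise application of operator-valued functions. -/
def pointwiseApply (K : Type) [TopologicalSpace K] [CompactSpace K] :
    C(K, E →L[𝕜] F) →L[𝕜] C(K, E) →L[𝕜] C(K, F) :=
  LinearMap.mkContinuous₂
    (LinearMap.mk₂ 𝕜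
      (fun (A : C(K, E →L[𝕜] F)) (u : C(K, E)) =>
        (⟨fun τ => A τ (u τ), A.continuous.clm_apply u.continuous⟩ : C(K, F)))
      (fun A B u => by ext; simp) (fun c A u => by ext; simp)
      (fun A u v => by ext; simp) (fun c A u => by ext; simp)) 1
    (fun A u => by
      rw [ContinuousMap.norm_le _ (by positivity)]
      intro τ
      have h1 := A.norm_coe_le_norm τ
      have h2 := u.norm_coe_le_norm τ
      calc ‖A τ (u τ)‖ ≤ ‖A τ‖ * ‖u τ‖ := (A τ).le_opNorm _
        _ ≤ 1 * ‖A‖ * ‖u‖ := by rw [one_mul]; gcongr)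

@[simp] lemma pointwiseApply_apply (A : C(K, E →L[𝕜] F)) (u : C(K, E)) (τ : K) :
    pointwiseApply K A u τ = A τ (u τ) := rfl

lemma continuousOn_superpose {g : E → F} {s : Set E} (hs : IsOpen s) (hg : ContinuousOn g s) :
    ContinuousOn (superpose K g) {u : C(K, E) | ∀ τ, u τ ∈ s} := by
  intro u hu
  apply ContinuousAt.continuousWithinAt
  have key : ∀ ε > 0, ∀ᶠ v in 𝓝 u, ∀ τ ∈ (univ : Set K), dist (g (v τ)) (g (u τ)) < ε := by
    intro ε hε
    refine isCompact_univ.eventually_forall_of_forall_eventually fun τ _ => ?_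
    have c1 : ContinuousAt (fun z : C(K, E) × K => g (z.1 z.2)) (u, τ) := by
      have := hg.continuousAt (hs.mem_nhds (hu τ))
      exact ContinuousAt.comp (g := g) (f := fun z : C(K, E) × K => z.1 z.2) this (by fun_prop)
    have c2 : ContinuousAt (fun z : C(K, E) × K => g (u z.2)) (u, τ) := by
      have := hg.continuousAt (hs.mem_nhds (hu τ))
      exact ContinuousAt.comp (g := g) (f := fun z : C(K, E) × K => u z.2) this (by fun_prop)
    have := (c1.dist c2).eventually (gt_mem_nhds (by simpa using hε))
    exact this
  rw [ContinuousAt, Metric.tendsto_nhds]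
  intro ε hε
  filter_upwards [key (ε / 2) (by positivity), (isOpen_mapsInto hs).mem_nhds hu] with v hv hvs
  refine lt_of_le_of_lt ((ContinuousMap.dist_le (by positivity)).2 fun τ => ?_) (half_lt_self hε)
  rw [superpose_apply hg hvs, superpose_apply hg hu]
  exact (hv τ trivial).le

/-- Compactness of `K` makes the first-order remainder of `g` along `u` uniform in `τ`; strict
differentiability at each `u τ` provides the local estimate that is patched together. -/
lemma hasFDerivAt_superpose {g : E → F} {s : Set E} (hs : IsOpen s) (hg : ContDiffOn 𝕜 1 g s)
    {u : C(K, E)} (hu : ∀ τ, u τ ∈ s) :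
    HasFDerivAt (superpose K g) (pointwiseApply K (superpose K (fderiv 𝕜 g) u)) u := by
  have hg' : ContinuousOn (fderiv 𝕜 g) s := hg.continuousOn_fderiv_of_isOpen hs (by simp)
  have key : ∀ ε > 0, ∀ᶠ h in 𝓝 (0 : C(K, E)), ∀ τ ∈ (univ : Set K),
      ‖g (u τ + h τ) - g (u τ) - fderiv 𝕜 g (u τ) (h τ)‖ ≤ ε * ‖h τ‖ := by
    intro ε hε
    refine isCompact_univ.eventually_forall_of_forall_eventually fun τ _ => ?_
    have hst : HasStrictFDerivAt g (fderiv 𝕜 g (u τ)) (u τ) :=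
      (hg.contDiffAt (hs.mem_nhds (hu τ))).hasStrictFDerivAt (by simp)
    have h1 := (hst.isLittleO.def (half_pos hε))
    have t1 : Tendsto (fun z : C(K, E) × K => (u z.2 + z.1 z.2, u z.2)) (𝓝 (0, τ))
        (𝓝 (u τ, u τ)) := by
      have : Continuous (fun z : C(K, E) × K => (u z.2 + z.1 z.2, u z.2)) := by fun_prop
      simpa using this.tendsto (0, τ)
    have c2 : ContinuousAt (fun z : C(K, E) × K => fderiv 𝕜 g (u z.2)) (0, τ) := by
      have := hg'.continuousAt (hs.mem_nhds (hu τ))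
      exact ContinuousAt.comp (g := fderiv 𝕜 g) (f := fun z : C(K, E) × K => u z.2) this
        (by fun_prop)
    have h2 := Metric.tendsto_nhds.1 c2 (ε / 2) (half_pos hε)
    filter_upwards [t1.eventually h1, h2] with z hz1 hz2
    rw [dist_eq_norm] at hz2
    simp only [add_sub_cancel_left] at hz1
    have e : g (u z.2 + z.1 z.2) - g (u z.2) - fderiv 𝕜 g (u z.2) (z.1 z.2)
        = (g (u z.2 + z.1 z.2) - g (u z.2) - fderiv 𝕜 g (u τ) (z.1 z.2))
          - (fderiv 𝕜 g (u z.2) - fderiv 𝕜 g (u τ)) (z.1 z.2) := by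
      simp
    rw [e]
    calc _ ≤ ε / 2 * ‖z.1 z.2‖ + ε / 2 * ‖z.1 z.2‖ := by
          refine (norm_sub_le _ _).trans (add_le_add hz1 ?_)
          exact ((fderiv 𝕜 g (u z.2) - fderiv 𝕜 g (u τ)).le_opNorm _).trans (by gcongr)
      _ = ε * ‖z.1 z.2‖ := by ring
  rw [hasFDerivAt_iff_isLittleO_nhds_zero, Asymptotics.isLittleO_iff]
  intro ε hε
  have hopen : ∀ᶠ h in 𝓝 (0 : C(K, E)), ∀ τ, (u + h) τ ∈ s := by
    have : Tendsto (fun h : C(K, E) => u + h) (𝓝 0) (𝓝 u) := by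
      have : Continuous (fun h : C(K, E) => u + h) := by fun_prop
      simpa using this.tendsto 0
    exact this.eventually ((isOpen_mapsInto hs).mem_nhds hu)
  filter_upwards [key ε hε, hopen] with h hh hs'
  rw [ContinuousMap.norm_le _ (by positivity)]
  intro τ
  simp only [ContinuousMap.sub_apply, pointwiseApply_apply]
  rw [superpose_apply hg.continuousOn hs', superpose_apply hg.continuousOn hu,
    superpose_apply hg' hu]
  exact (hh τ trivial).trans (by gcongr; exact h.norm_coe_le_norm τ)

/-- The derivative of superposition by `g` is superposition by `fderiv 𝕜 g` followed by a continuous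
linear map, so one can induct. The target `F` varies because it becomes an operator space at each
step. -/
lemma contDiffOn_superpose_nat (n : ℕ) : ∀ {F : Type} [NormedAddCommGroup F] [NormedSpace 𝕜 F]
    {g : E → F} {s : Set E}, IsOpen s → ContDiffOn 𝕜 n g s →
    ContDiffOn 𝕜 n (superpose K g) {u : C(K, E) | ∀ τ, u τ ∈ s} := by
  induction n with
  | zero =>
    intro F _ _ g s hs hg
    simp only [Nat.cast_zero, contDiffOn_zero] at hg ⊢
    exact continuousOn_superpose hs hg
  | succ n ih =>
    intro F _ _ g s hs hg
    have h1 : ContDiffOn 𝕜 1 g s := hg.of_le (by simp)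
    push_cast at hg ⊢
    rw [contDiffOn_succ_iff_fderiv_of_isOpen (isOpen_mapsInto hs)]
    refine ⟨fun u hu => ((hasFDerivAt_superpose hs h1 hu).differentiableAt).differentiableWithinAt,
      by simp, ?_⟩
    have hd : ContDiffOn 𝕜 n (fderiv 𝕜 g) s :=
      ((contDiffOn_succ_iff_fderiv_of_isOpen hs).1 hg).2.2
    refine ContDiffOn.congr ?_ fun u hu => (hasFDerivAt_superpose hs h1 hu).fderiv
    exact (pointwiseApply K).contDiff.comp_contDiffOn (ih hs hd)

/-- The multilinear map induced on continuous functions by acting pointwise. -/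
def pointwiseMultilinear (K : Type) [TopologicalSpace K] [CompactSpace K] {k : ℕ}
    (p : E [×k]→L[𝕜] F) : C(K, E) [×k]→L[𝕜] C(K, F) :=
  MultilinearMap.mkContinuous
    { toFun := fun m => ⟨fun τ => p fun i => m i τ, by fun_prop⟩
      map_update_add' := by
        intro _ m i x y
        ext τ
        have h : ∀ z : C(K, E), (fun j => Function.update m i z j τ)
            = Function.update (fun j => m j τ) i (z τ) := by
          intro z; ext j; by_cases hj : j = i
          · subst hj; simp
          · simp [hj]
        simp [h]
      map_update_smul' := by
        intro _ m i c x
        ext τ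
        have h : ∀ z : C(K, E), (fun j => Function.update m i z j τ)
            = Function.update (fun j => m j τ) i (z τ) := by
          intro z; ext j; by_cases hj : j = i
          · subst hj; simp
          · simp [hj]
        simp [h] } ‖p‖
    (fun m => by
      rw [ContinuousMap.norm_le _ (by positivity)]
      intro τ
      refine (p.le_opNorm _).trans ?_
      gcongr with i
      exact (m i).norm_coe_le_norm τ)

lemma norm_pointwiseMultilinear_le {k : ℕ} (p : E [×k]→L[𝕜] F) :
    ‖pointwiseMultilinear K p‖ ≤ ‖p‖ :=
  MultilinearMap.mkContinuous_norm_le _ (norm_nonneg _) _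

/-- Apply each term of the power series of `g` pointwise: norms do not grow, so the radius does not
shrink. The centre is a constant curve so that one power series serves all `τ`. -/
lemma analyticAt_superpose [CompleteSpace F] {g : E → F} {p : E} (hg : AnalyticAt 𝕜 g p) :
    AnalyticAt 𝕜 (superpose K g) (ContinuousMap.const K p) := by
  obtain ⟨q, R, hq⟩ := hg
  obtain ⟨s, hs0, hsR⟩ := ENNReal.lt_iff_exists_nnreal_btwn.1 hq.r_pos
  have hs0' : (0 : ENNReal) < s := hs0
  have hq' := hq.mono hs0' hsR.le
  have hcont : ContinuousOn g (Metric.eball p s) := hq'.continuousOn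
  refine ⟨fun k => pointwiseMultilinear K (q k), s, ?_, hs0', ?_⟩
  · have : (s : ENNReal) ≤ q.radius := hsR.le.trans hq.r_le
    refine this.trans (FormalMultilinearSeries.radius_le_of_le fun {k} => ?_)
    exact norm_pointwiseMultilinear_le _
  · intro y hy
    have hyn : ‖y‖ < s := by simpa [enorm_lt_coe, ← NNReal.coe_lt_coe] using hy
    have hsum : Summable fun k => ‖pointwiseMultilinear K (q k) fun _ => y‖ := by
      have hlt : ((‖y‖₊ : NNReal) : ENNReal) < q.radius := by
        refine lt_of_lt_of_le ?_ (hsR.le.trans hq.r_le)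
        exact_mod_cast hyn
      refine Summable.of_nonneg_of_le (fun _ => norm_nonneg _) (fun k => ?_)
        (q.summable_norm_mul_pow hlt)
      refine ((pointwiseMultilinear K (q k)).le_opNorm _).trans ?_
      simp only [Finset.prod_const, Finset.card_univ, Fintype.card_fin, coe_nnnorm]
      gcongr
      exact norm_pointwiseMultilinear_le _
    have hs := hsum.of_norm.hasSum
    have hmem : ∀ τ, (ContinuousMap.const K p + y) τ ∈ Metric.eball p s := by
      intro τ
      have : ‖y τ‖ < s := (y.norm_coe_le_norm τ).trans_lt hyn
      rw [Metric.mem_eball, edist_eq_enorm_sub]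
      simpa [enorm_lt_coe, ← NNReal.coe_lt_coe] using this
    convert hs using 1
    ext τ
    rw [superpose_apply hcont hmem]
    have h1 := hs.mapL (ContinuousMap.evalCLM 𝕜 τ)
    have h2 := hq'.hasSum (y := y τ) (by simpa using hmem τ)
    exact h2.unique h1

/-- Superposition with a `C^r` germ is `C^r` near a constant map. -/
theorem germAt_superpose [CompleteSpace F] {r : WithTop ℕ∞} (hr : r = ∞ ∨ r = ω) {g : E → F}
    {p : E} (hg : GermAt 𝕜 r g p) :
    GermAt 𝕜 r (superpose K g) (ContinuousMap.const K p) := by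
  rcases hr with rfl | rfl
  · obtain ⟨s, hs, hso, hps⟩ := eventually_nhds_iff.1 hg
    have hon : ContDiffOn 𝕜 ∞ g s := fun x hx => (hs x hx).contDiffWithinAt
    filter_upwards [(isOpen_mapsInto (K := K) hso).mem_nhds (fun _ => hps)] with u hu
    rw [contDiffAt_infty]
    intro n
    exact (contDiffOn_superpose_nat n hso (contDiffOn_infty.1 hon n)).contDiffAt
      ((isOpen_mapsInto hso).mem_nhds hu)
  · have := analyticAt_superpose (K := K) (𝕜 := 𝕜) (hg.self_of_nhds).analyticAt
    filter_upwards [this.eventually_analyticAt] with u hu using hu.contDiffAt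

end Superposition

/-! ### Composition, derivatives and local inverses of germs. -/

section GermCalculus

variable {𝕜 : Type} [RCLike 𝕜]
variable {E F G : Type} [NormedAddCommGroup E] [NormedSpace 𝕜 E]
  [NormedAddCommGroup F] [NormedSpace 𝕜 F] [NormedAddCommGroup G] [NormedSpace 𝕜 G]
variable {r : WithTop ℕ∞}

lemma GermAt.comp {g : F → G} {f : E → F} {p : E} (hg : GermAt 𝕜 r g (f p))
    (hf : GermAt 𝕜 r f p) : GermAt 𝕜 r (fun x => g (f x)) p := by
  filter_upwards [hf, hf.self_of_nhds.continuousAt.eventually hg] with x h1 h2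
  exact h2.comp x h1

lemma GermAt.fderiv_right (hr : r = ∞ ∨ r = ω) {g : E → F} {p : E} (hg : GermAt 𝕜 r g p) :
    GermAt 𝕜 r (fderiv 𝕜 g) p := by
  filter_upwards [hg] with x hx
  refine hx.fderiv_right ?_
  rcases hr with rfl | rfl <;> simp

lemma GermAt.differentiableAt (hr : r = ∞ ∨ r = ω) {g : E → F} {p : E} (hg : GermAt 𝕜 r g p) :
    ∀ᶠ x in 𝓝 p, DifferentiableAt 𝕜 g x := by
  filter_upwards [hg] with x hx
  exact hx.differentiableAt (by rcases hr with rfl | rfl <;> simp)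

/-- The inverse function theorem for germs of class `C^r`. -/
lemma GermAt.exists_openPartialHomeomorph [CompleteSpace E] (hr : r = ∞ ∨ r = ω) {g : E → F}
    {p : E} (hg : GermAt 𝕜 r g p) (e : E ≃L[𝕜] F) (he : HasFDerivAt g (e : E →L[𝕜] F) p) :
    ∃ Φ : OpenPartialHomeomorph E F, p ∈ Φ.source ∧ (Φ : E → F) = g ∧
      ContDiffOn 𝕜 r Φ Φ.source ∧ ContDiffOn 𝕜 r Φ.symm Φ.target := by
  have hr0 : r ≠ 0 := by rcases hr with rfl | rfl <;> simp
  have hr1 : 1 ≤ r := by rcases hr with rfl | rfl <;> simp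
  have hp := hg.self_of_nhds
  set Φ₀ := hp.toOpenPartialHomeomorph g he hr0 with hΦ₀
  -- The inverse must be of class `C^r` on its whole domain, so the source is cut down to points
  -- where the derivative is invertible.
  have hinv : ∀ᶠ x in 𝓝 p, fderiv 𝕜 g x ∈ range ((↑) : (E ≃L[𝕜] F) → E →L[𝕜] F) := by
    have hc : ContinuousAt (fderiv 𝕜 g) p :=
      (GermAt.fderiv_right hr hg).self_of_nhds.continuousAt
    refine hc.eventually ?_
    rw [he.fderiv]
    exact ContinuousLinearEquiv.nhds e
  obtain ⟨s, hs, hso, hps⟩ := eventually_nhds_iff.1 (hg.and hinv)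
  refine ⟨Φ₀.restrOpen s hso, ⟨hp.mem_toOpenPartialHomeomorph_source he hr0, hps⟩, rfl, ?_, ?_⟩
  · intro x hx
    exact (hs x hx.2).1.contDiffWithinAt
  · intro y hy
    have hy1 : (Φ₀.restrOpen s hso).symm y ∈ (Φ₀.restrOpen s hso).source :=
      (Φ₀.restrOpen s hso).map_target hy
    obtain ⟨h1, ⟨e', he'⟩⟩ := hs _ hy1.2
    refine ((Φ₀.restrOpen s hso).contDiffAt_symm (f₀' := e') hy ?_ h1).contDiffWithinAt
    rw [he']
    exact (h1.differentiableAt hr0).hasFDerivAt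

end GermCalculus

/-! ### Parameter integrals and Hadamard division. -/

section Integrals

variable {𝕜 : Type} [RCLike 𝕜]
variable {E F P : Type} [NormedAddCommGroup E] [NormedSpace 𝕜 E]
  [NormedAddCommGroup F] [NormedSpace 𝕜 F] [NormedSpace ℝ F] [IsScalarTower ℝ 𝕜 F]
  [NormedAddCommGroup P] [NormedSpace 𝕜 P]
variable {r : WithTop ℕ∞}

/-- The extension of a continuous function on the unit interval to the real line. -/
def extendLine (u : C(unitInterval, E)) (s : ℝ) : E := u (projIcc 0 1 zero_le_one s)

lemma continuous_extendLine (u : C(unitInterval, E)) : Continuous (extendLine u) :=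
  u.continuous.comp continuous_projIcc

lemma extendLine_coe (u : C(unitInterval, E)) (τ : unitInterval) : extendLine u τ = u τ := by
  simp [extendLine]

lemma norm_extendLine_le (u : C(unitInterval, E)) (s : ℝ) : ‖extendLine u s‖ ≤ ‖u‖ :=
  u.norm_coe_le_norm _

/-- The primitive `τ ↦ ∫₀^τ u`. -/
def primitive (𝕜 : Type) [RCLike 𝕜] (F : Type) [NormedAddCommGroup F] [NormedSpace 𝕜 F]
    [NormedSpace ℝ F] [IsScalarTower ℝ 𝕜 F] : C(unitInterval, F) →L[𝕜] C(unitInterval, F) :=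
  LinearMap.mkContinuous
    { toFun := fun u => ⟨fun τ => ∫ s in (0 : ℝ)..τ, extendLine u s,
        (intervalIntegral.continuous_primitive
          (fun a b => (continuous_extendLine u).intervalIntegrable a b) 0).comp
          continuous_subtype_val⟩
      map_add' := fun u v => by
        ext τ
        exact intervalIntegral.integral_add ((continuous_extendLine u).intervalIntegrable _ _)
          ((continuous_extendLine v).intervalIntegrable _ _)
      map_smul' := fun c u => by
        ext τ
        exact intervalIntegral.integral_smul c (extendLine u) } 1
    (fun u => by
      rw [ContinuousMap.norm_le _ (by positivity)]
      intro τ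
      have h := intervalIntegral.norm_integral_le_of_norm_le_const (a := 0) (b := (τ : ℝ))
        (fun s _ => norm_extendLine_le u s)
      refine h.trans ?_
      rw [mul_comm, sub_zero]
      gcongr
      rw [abs_of_nonneg τ.2.1]
      exact τ.2.2)

lemma primitive_apply (u : C(unitInterval, F)) (τ : unitInterval) :
    primitive 𝕜 F u τ = ∫ s in (0 : ℝ)..τ, extendLine u s := rfl

lemma hasDerivAt_primitive [CompleteSpace F] (u : C(unitInterval, F)) (t : ℝ) :
    HasDerivAt (fun t => ∫ s in (0 : ℝ)..t, extendLine u s) (extendLine u t) t :=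
  intervalIntegral.integral_hasDerivAt_right ((continuous_extendLine u).intervalIntegrable _ _)
    ((continuous_extendLine u).stronglyMeasurableAtFilter _ _) (continuous_extendLine u).continuousAt

/-- The contraction `x ↦ (l ↦ (l t, p))`, for `x = (t, p)`. -/
def contraction (𝕜 : Type) [RCLike 𝕜] (P : Type) [NormedAddCommGroup P] [NormedSpace 𝕜 P] :
    𝕜 × P →L[𝕜] C(unitInterval, 𝕜 × P) :=
  LinearMap.mkContinuous
    { toFun := fun x => ⟨fun l => (((l : ℝ) : 𝕜) * x.1, x.2), by fun_prop⟩
      map_add' := fun x y => by ext l <;> simp [mul_add]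
      map_smul' := fun c x => by ext l <;> simp [mul_left_comm] } 1
    (fun x => by
      rw [ContinuousMap.norm_le _ (by positivity)]
      intro l
      rw [one_mul]
      simp only [LinearMap.coe_mk, AddHom.coe_mk, ContinuousMap.coe_mk, Prod.norm_def, norm_mul]
      gcongr
      have : ‖((l : ℝ) : 𝕜)‖ ≤ 1 := by
        rw [RCLike.norm_ofReal, abs_of_nonneg l.2.1]
        exact l.2.2
      calc _ ≤ 1 * ‖x.1‖ := by gcongr
        _ = _ := one_mul _)

@[simp] lemma contraction_apply (x : 𝕜 × P) (l : unitInterval) :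
    contraction 𝕜 P x l = (((l : ℝ) : 𝕜) * x.1, x.2) := rfl

lemma contraction_zero (p : P) :
    contraction 𝕜 P (0, p) = ContinuousMap.const unitInterval (0, p) := by
  ext l <;> simp

/-- The average `∫₀¹ g (l t, p) dl`, at `x = (t, p)`. -/
def segmentAverage (𝕜 : Type) [RCLike 𝕜] {F P : Type} [NormedAddCommGroup F] [NormedSpace 𝕜 F]
    [NormedSpace ℝ F] [IsScalarTower ℝ 𝕜 F] [NormedAddCommGroup P] [NormedSpace 𝕜 P]
    (g : 𝕜 × P → F) (x : 𝕜 × P) : F :=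
  primitive 𝕜 F (superpose unitInterval g (contraction 𝕜 P x)) 1

/-- The average is a superposition operator between continuous linear maps, so no separate
differentiation under the integral is needed in either category. -/
lemma germAt_segmentAverage [CompleteSpace F] (hr : r = ∞ ∨ r = ω) {g : 𝕜 × P → F} {p : P}
    (hg : GermAt 𝕜 r g (0, p)) : GermAt 𝕜 r (segmentAverage 𝕜 g) (0, p) := by
  have h1 := germAt_superpose (K := unitInterval) hr hg
  rw [← contraction_zero] at h1
  have h2 : GermAt 𝕜 r (fun x => superpose unitInterval g (contraction 𝕜 P x)) (0, p) :=
    GermAt.comp (f := contraction 𝕜 P) h1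
      (Eventually.of_forall fun x => (contraction 𝕜 P).contDiff.contDiffAt)
  filter_upwards [h2] with x hx
  exact ((ContinuousMap.evalCLM 𝕜 (1 : unitInterval)).comp (primitive 𝕜 F)).contDiff.contDiffAt.comp
    x hx

/-- Near `(0, p)`, whole segments `{(l t, p)}` stay in a given neighbourhood of `(0, p)`. -/
lemma eventually_contraction {q : 𝕜 × P → Prop} {p : P} (h : ∀ᶠ x in 𝓝 ((0 : 𝕜), p), q x) :
    ∀ᶠ x in 𝓝 ((0 : 𝕜), p), ∀ l : ℝ, l ∈ Icc (0 : ℝ) 1 → q ((l : 𝕜) * x.1, x.2) := by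
  obtain ⟨s, hs, hso, hps⟩ := eventually_nhds_iff.1 h
  have h1 := (isOpen_mapsInto (K := unitInterval) hso).preimage (contraction 𝕜 P).continuous
  filter_upwards [h1.mem_nhds (by intro l; simpa using hps)] with x hx l hl
  exact hs _ (hx ⟨l, hl⟩)

lemma hasFDerivAt_segmentAverage (hr : r = ∞ ∨ r = ω) {g : 𝕜 × P → F} {p : P}
    (hg : GermAt 𝕜 r g (0, p)) :
    ∀ᶠ x in 𝓝 ((0 : 𝕜), p), HasFDerivAt (segmentAverage 𝕜 g)
      (((ContinuousMap.evalCLM 𝕜 (1 : unitInterval)).comp (primitive 𝕜 F)).comp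
        ((pointwiseApply unitInterval (superpose unitInterval (fderiv 𝕜 g)
          (contraction 𝕜 P x))).comp (contraction 𝕜 P))) x := by
  have hr1 : 1 ≤ r := by rcases hr with rfl | rfl <;> simp
  obtain ⟨s, hs, hso, hps⟩ := eventually_nhds_iff.1 hg
  have h1 := (isOpen_mapsInto (K := unitInterval) hso).preimage (contraction 𝕜 P).continuous
  filter_upwards [h1.mem_nhds (by intro l; simpa using hps)] with x hx
  have h2 := hasFDerivAt_superpose hso
    (fun x hx => ((hs x hx).of_le hr1).contDiffWithinAt) hx
  exact (((ContinuousMap.evalCLM 𝕜 (1 : unitInterval)).comp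
    (primitive 𝕜 F)).hasFDerivAt).comp x (h2.comp x (contraction 𝕜 P).hasFDerivAt)

lemma superpose_contraction_apply {F : Type} [NormedAddCommGroup F] {g : 𝕜 × P → F} {x : 𝕜 × P}
    (h : ∀ l : ℝ, l ∈ Icc (0 : ℝ) 1 → ContinuousAt g ((l : 𝕜) * x.1, x.2)) (l : unitInterval) :
    superpose unitInterval g (contraction 𝕜 P x) l = g (((l : ℝ) : 𝕜) * x.1, x.2) := by
  refine superpose_apply (s := {y | ContinuousAt g y}) (fun y hy => ?_) (fun τ => ?_) l
  · exact ContinuousAt.continuousWithinAt hy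
  · exact h τ τ.2

/-- Fundamental theorem of calculus along `l ↦ (l t, p)`. -/
lemma primitive_superpose_eq [CompleteSpace F] {u : C(unitInterval, F)} {f : ℝ → F}
    (h : ∀ l : unitInterval, HasDerivAt f (u l) l) : primitive 𝕜 F u 1 = f 1 - f 0 := by
  rw [primitive_apply]
  refine intervalIntegral.integral_eq_sub_of_hasDerivAt (fun l hl => ?_)
    ((continuous_extendLine u).intervalIntegrable _ _)
  have hl' : l ∈ Icc (0 : ℝ) 1 := by simpa using hl
  have := h ⟨l, hl'⟩
  rwa [← extendLine_coe] at this

lemma hasDerivAt_comp_contraction [NormedSpace ℝ P] [IsScalarTower ℝ 𝕜 P] {g : 𝕜 × P → F}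
    {x : 𝕜 × P} {l : ℝ} (h : DifferentiableAt 𝕜 g ((l : 𝕜) * x.1, x.2)) :
    HasDerivAt (fun l : ℝ => g ((l : 𝕜) * x.1, x.2))
      (fderiv 𝕜 g ((l : 𝕜) * x.1, x.2) (x.1, 0)) l := by
  have h1 : HasDerivAt (fun l : ℝ => ((l : 𝕜) * x.1, x.2)) (x.1, (0 : P)) l := by
    refine HasDerivAt.prodMk ?_ (hasDerivAt_const _ _)
    simpa using (RCLike.ofRealCLM (K := 𝕜)).hasDerivAt.mul_const x.1 (x := l)
  exact (h.hasFDerivAt.restrictScalars ℝ).comp_hasDerivAt l h1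

/-- The derivative of `l ↦ g (l t, p)` is `t` times the partial derivative in the first variable.
This is used to divide a function vanishing on `{t = 0}` by `t`. -/
lemma hadamard_division [CompleteSpace F] [NormedSpace ℝ P] [IsScalarTower ℝ 𝕜 P]
    (hr : r = ∞ ∨ r = ω) {g : 𝕜 × P → F} {p : P} (hg : GermAt 𝕜 r g (0, p)) :
    ∀ᶠ x in 𝓝 ((0 : 𝕜), p), g x - g (0, x.2) =
      x.1 • segmentAverage 𝕜 (fun y => fderiv 𝕜 g y (1, 0)) x := by
  have hd := hg.differentiableAt hr
  have hc : ∀ᶠ x in 𝓝 ((0 : 𝕜), p), ContinuousAt (fun y => fderiv 𝕜 g y (1, 0)) x := by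
    filter_upwards [hg.fderiv_right hr] with x hx
    exact hx.continuousAt.clm_apply continuousAt_const
  filter_upwards [eventually_contraction hd, eventually_contraction hc] with x hx hcx
  have := primitive_superpose_eq (𝕜 := 𝕜) (f := fun l : ℝ => g ((l : 𝕜) * x.1, x.2))
    (u := x.1 • superpose unitInterval (fun y => fderiv 𝕜 g y (1, 0)) (contraction 𝕜 P x))
    (fun l => by
      convert hasDerivAt_comp_contraction (hx l l.2) using 1
      rw [ContinuousMap.smul_apply, superpose_contraction_apply hcx, ← map_smul]
      simp)
  rw [map_smul] at this
  simp only [RCLike.ofReal_one, one_mul, RCLike.ofReal_zero, zero_mul] at this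
  exact this.symm

end Integrals

/-! ### Local flows from the inverse function theorem on curve spaces. -/

section Flow

variable {𝕜 : Type} [RCLike 𝕜]
variable {E : Type} [NormedAddCommGroup E] [NormedSpace 𝕜 E] [NormedSpace ℝ E]
  [IsScalarTower ℝ 𝕜 E]
variable {r : WithTop ℕ∞}

/-- Constant curves, as a continuous linear map. -/
abbrev constCurve (𝕜 : Type) [RCLike 𝕜] (E : Type) [NormedAddCommGroup E] [NormedSpace 𝕜 E] :
    E →L[𝕜] C(unitInterval, E) :=
  ContinuousLinearMap.const (R := 𝕜) (M := E) unitInterval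

/-- The local flow `U (ε, x)` of a vector field `V` of class `C^r`: the curves with
`u τ = x + ε ∫₀^τ V (u s) ds`. -/
theorem exists_flow [CompleteSpace E] (hr : r = ∞ ∨ r = ω) {V : E → E} {p : E}
    (hV : GermAt 𝕜 r V p) :
    ∃ U : 𝕜 × E → C(unitInterval, E), GermAt 𝕜 r U (0, p) ∧
      U (0, p) = ContinuousMap.const unitInterval p ∧
      (∀ᶠ z in 𝓝 ((0 : 𝕜), p), U z = ContinuousMap.const unitInterval z.2 +
        z.1 • primitive 𝕜 E (superpose unitInterval V (U z))) ∧
      ∀ᶠ y in 𝓝 (((0 : 𝕜), p), ContinuousMap.const unitInterval p),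
        y.2 = ContinuousMap.const unitInterval y.1.2 +
          y.1.1 • primitive 𝕜 E (superpose unitInterval V y.2) → U y.1 = y.2 := by
  have hr0 : r ≠ 0 := by rcases hr with rfl | rfl <;> simp
  set c₀ : C(unitInterval, E) := ContinuousMap.const unitInterval p with hc₀
  have hS := germAt_superpose (K := unitInterval) hr hV
  set S : C(unitInterval, E) → C(unitInterval, E) :=
    fun u => primitive 𝕜 E (superpose unitInterval V u) with hSdef
  have hS' : GermAt 𝕜 r S c₀ := by
    filter_upwards [hS] with u hu using (primitive 𝕜 E).contDiff.contDiffAt.comp u hu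
  -- The integral equation says that the last component of `Φ` vanishes. The integral carries the
  -- factor `ε`, so at `ε = 0` the derivative in the curve variable is the identity.
  set Φ : (𝕜 × E) × C(unitInterval, E) → (𝕜 × E) × C(unitInterval, E) :=
    fun y => (y.1, y.2 - constCurve 𝕜 E y.1.2 - y.1.1 • S y.2) with hΦ
  have hΦg : GermAt 𝕜 r Φ ((0, p), c₀) := by
    have : ∀ᶠ y in 𝓝 (((0 : 𝕜), p), c₀), ContDiffAt 𝕜 r S y.2 :=
      (continuous_snd.tendsto _).eventually hS'
    filter_upwards [this] with y hy
    have h2 : ContDiffAt 𝕜 r (fun y : (𝕜 × E) × C(unitInterval, E) => S y.2) y :=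
      hy.comp y contDiffAt_snd
    have h3 : ContDiffAt 𝕜 r (fun y : (𝕜 × E) × C(unitInterval, E) => constCurve 𝕜 E y.1.2) y :=
      (constCurve 𝕜 E).contDiff.contDiffAt.comp y contDiffAt_fst.snd
    refine contDiffAt_fst.prodMk ?_
    exact (contDiffAt_snd.sub h3).sub (ContDiffAt.smul contDiffAt_fst.fst h2)
  -- `T` depends only on `(ε, x)`, hence the maps with `+T` and `-T` in the last component are
  -- mutually inverse.
  let T : (𝕜 × E) × C(unitInterval, E) →L[𝕜] C(unitInterval, E) :=
    (constCurve 𝕜 E).comp ((ContinuousLinearMap.snd 𝕜 𝕜 E).comp (ContinuousLinearMap.fst 𝕜 _ _))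
      + ((ContinuousLinearMap.fst 𝕜 𝕜 E).comp (ContinuousLinearMap.fst 𝕜 _ _)).smulRight (S c₀)
  let e : ((𝕜 × E) × C(unitInterval, E)) ≃L[𝕜] ((𝕜 × E) × C(unitInterval, E)) :=
    ContinuousLinearEquiv.equivOfInverse
      ((ContinuousLinearMap.fst 𝕜 _ _).prod (ContinuousLinearMap.snd 𝕜 _ _ - T))
      ((ContinuousLinearMap.fst 𝕜 _ _).prod (ContinuousLinearMap.snd 𝕜 _ _ + T))
      (fun y => by simp [T]) (fun y => by simp [T])
  have he : HasFDerivAt Φ (e : _ →L[𝕜] _) ((0, p), c₀) := by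
    have hSd : HasFDerivAt (fun y : (𝕜 × E) × C(unitInterval, E) => S y.2)
        ((fderiv 𝕜 S c₀).comp (ContinuousLinearMap.snd 𝕜 _ _)) ((0, p), c₀) := by
      have := (hS'.self_of_nhds.differentiableAt hr0).hasFDerivAt
      exact HasFDerivAt.comp ((0, p), c₀) (f := fun y : (𝕜 × E) × C(unitInterval, E) => y.2)
        this hasFDerivAt_snd
    have h1 : HasFDerivAt (fun y : (𝕜 × E) × C(unitInterval, E) => y.1.1)
      ((ContinuousLinearMap.fst 𝕜 𝕜 E).comp (ContinuousLinearMap.fst 𝕜 _ _)) ((0, p), c₀) :=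
      hasFDerivAt_fst.comp _ hasFDerivAt_fst
    have h2 : HasFDerivAt (fun y : (𝕜 × E) × C(unitInterval, E) => constCurve 𝕜 E y.1.2)
      ((constCurve 𝕜 E).comp ((ContinuousLinearMap.snd 𝕜 𝕜 E).comp
        (ContinuousLinearMap.fst 𝕜 _ _))) ((0, p), c₀) :=
      (constCurve 𝕜 E).hasFDerivAt.comp _ (hasFDerivAt_snd.comp _ hasFDerivAt_fst)
    have h3 := (hasFDerivAt_fst (𝕜 := 𝕜) (p := (((0 : 𝕜), p), c₀))).prodMk
      ((hasFDerivAt_snd.sub h2).sub (h1.smul hSd))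
    refine h3.congr_fderiv ?_
    ext y <;> simp [e, T]
  obtain ⟨Ψ, hsrc, hcoe, hd, hdi⟩ := hΦg.exists_openPartialHomeomorph hr e he
  have hΨ : ∀ y, Ψ y = Φ y := fun y => congrFun hcoe y
  have hΦ0 : Φ ((0, p), c₀) = ((0, p), 0) := by
    ext <;> simp [hΦ, hc₀]
  have htgt : (((0 : 𝕜), p), (0 : C(unitInterval, E))) ∈ Ψ.target := by
    rw [← hΦ0, ← hΨ]; exact Ψ.map_source hsrc
  have hcont : Continuous (fun z : 𝕜 × E => (z, (0 : C(unitInterval, E)))) := by fun_prop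
  have hnear : ∀ᶠ z in 𝓝 ((0 : 𝕜), p), (z, (0 : C(unitInterval, E))) ∈ Ψ.target :=
    hcont.continuousAt.eventually (Ψ.open_target.mem_nhds htgt)
  have hfst : ∀ z, (z, (0 : C(unitInterval, E))) ∈ Ψ.target →
      (Ψ.symm (z, 0)).1 = z ∧ (Φ (Ψ.symm (z, 0))).2 = 0 := by
    intro z hz
    have h := Ψ.right_inv hz
    rw [hΨ] at h
    exact ⟨congrArg Prod.fst h, congrArg Prod.snd h⟩
  refine ⟨fun z => (Ψ.symm (z, 0)).2, ?_, ?_, ?_, ?_⟩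
  · filter_upwards [hnear] with z hz
    have h1 := hdi.contDiffAt (Ψ.open_target.mem_nhds hz)
    exact contDiffAt_snd.comp z (h1.comp z (by fun_prop))
  · show (Ψ.symm ((0, p), 0)).2 = c₀
    rw [← hΦ0, ← hΨ, Ψ.left_inv hsrc]
  · filter_upwards [hnear] with z hz
    obtain ⟨h1, h2⟩ := hfst z hz
    simp only [hΦ, h1, sub_sub, sub_eq_zero] at h2
    exact h2
  -- Uniqueness of the solution is the injectivity of the local diffeomorphism.
  · filter_upwards [Ψ.open_source.mem_nhds hsrc] with y hy hyeq
    have h1 : Φ y = (y.1, 0) := by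
      refine Prod.ext rfl ?_
      simp only [hΦ, sub_sub, sub_eq_zero]
      exact hyeq
    show (Ψ.symm (y.1, 0)).2 = y.2
    rw [← h1, ← hΨ, Ψ.left_inv hy]

/-- The linearised flow equation. -/
lemma fderiv_flow (hr : r = ∞ ∨ r = ω) {V : E → E} {p : E} (hV : GermAt 𝕜 r V p)
    {U : 𝕜 × E → C(unitInterval, E)} (hU : GermAt 𝕜 r U (0, p))
    (hU0 : U (0, p) = ContinuousMap.const unitInterval p)
    (hUe : ∀ᶠ z in 𝓝 ((0 : 𝕜), p), U z = ContinuousMap.const unitInterval z.2 +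
      z.1 • primitive 𝕜 E (superpose unitInterval V (U z))) :
    ∀ᶠ z in 𝓝 ((0 : 𝕜), p), ∀ h : E, fderiv 𝕜 U z (0, h) =
      ContinuousMap.const unitInterval h + z.1 • primitive 𝕜 E (pointwiseApply unitInterval
        (superpose unitInterval (fderiv 𝕜 V) (U z)) (fderiv 𝕜 U z (0, h))) := by
  have hr1 : 1 ≤ r := by rcases hr with rfl | rfl <;> simp
  obtain ⟨s, hs, hso, hps⟩ := eventually_nhds_iff.1 hV
  have hmem : ∀ᶠ z in 𝓝 ((0 : 𝕜), p), ∀ τ, U z τ ∈ s := by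
    refine hU.self_of_nhds.continuousAt.eventually ((isOpen_mapsInto hso).mem_nhds ?_)
    intro τ
    simpa [hU0] using hps
  filter_upwards [hmem, hU.differentiableAt hr, hUe.eventually_nhds] with z hz hd he h
  have hsup := hasFDerivAt_superpose (K := unitInterval) hso
    (fun x hx => ((hs x hx).of_le hr1).contDiffWithinAt) hz
  have h1 := (primitive 𝕜 E).hasFDerivAt.comp z (hsup.comp z hd.hasFDerivAt)
  have h2 := ((constCurve 𝕜 E).comp (ContinuousLinearMap.snd 𝕜 𝕜 E)).hasFDerivAt (x := z)
  have h3 := h2.add ((hasFDerivAt_fst (𝕜 := 𝕜) (p := z)).smul h1)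
  have h4 := (h3.congr_of_eventuallyEq (f₁ := U) he).fderiv
  conv_lhs => rw [h4]
  simp
  rfl

end Flow

/-! ### Transport of bilinear forms along flows. -/

section Transport

variable {𝕜 : Type} [RCLike 𝕜]
variable {E E' E'' : Type} [NormedAddCommGroup E] [NormedSpace 𝕜 E]
  [NormedAddCommGroup E'] [NormedSpace 𝕜 E'] [NormedAddCommGroup E''] [NormedSpace 𝕜 E'']
variable {r : WithTop ℕ∞}

/-- Equivalence of germs at `0` of fields of bilinear forms under diffeomorphism germs of
class `C^r`. -/
def BilinEquivalent (r : WithTop ℕ∞) (b : E → E →L[𝕜] E →L[𝕜] 𝕜)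
    (b' : E' → E' →L[𝕜] E' →L[𝕜] 𝕜) : Prop :=
  ∃ Ψ : OpenPartialHomeomorph E E', (0 : E) ∈ Ψ.source ∧ Ψ 0 = 0 ∧
    ContDiffOn 𝕜 r Ψ Ψ.source ∧ ContDiffOn 𝕜 r Ψ.symm Ψ.target ∧
    ∀ᶠ x in 𝓝 (0 : E), ∀ v w : E, b' (Ψ x) (fderiv 𝕜 Ψ x v) (fderiv 𝕜 Ψ x w) = b x v w

lemma BilinEquivalent.trans (hr : r = ∞ ∨ r = ω) {b : E → E →L[𝕜] E →L[𝕜] 𝕜}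
    {b' : E' → E' →L[𝕜] E' →L[𝕜] 𝕜} {b'' : E'' → E'' →L[𝕜] E'' →L[𝕜] 𝕜}
    (h : BilinEquivalent r b b') (h' : BilinEquivalent r b' b'') : BilinEquivalent r b b'' := by
  have hr0 : r ≠ 0 := by rcases hr with rfl | rfl <;> simp
  obtain ⟨Φ, hs, h0, hd, hdi, he⟩ := h
  obtain ⟨Ψ, hs', h0', hd', hdi', he'⟩ := h'
  have hsrc : (0 : E) ∈ (Φ.trans Ψ).source := by
    rw [OpenPartialHomeomorph.trans_source]; exact ⟨hs, by simpa [h0] using hs'⟩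
  refine ⟨Φ.trans Ψ, hsrc, by simp [h0, h0'], ?_, ?_, ?_⟩
  · rw [OpenPartialHomeomorph.coe_trans, OpenPartialHomeomorph.trans_source]
    exact hd'.comp (hd.mono inter_subset_left) fun x hx => hx.2
  · rw [OpenPartialHomeomorph.coe_trans_symm, OpenPartialHomeomorph.trans_target]
    exact hdi.comp (hdi'.mono inter_subset_left) fun x hx => hx.2
  · have hc : Tendsto Φ (𝓝 0) (𝓝 0) := by simpa [h0] using (Φ.continuousAt hs).tendsto
    filter_upwards [he, hc.eventually he', (Φ.trans Ψ).open_source.mem_nhds hsrc] with x h1 h2 hx v w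
    rw [OpenPartialHomeomorph.trans_source] at hx
    have d1 := ((hd.contDiffAt (Φ.open_source.mem_nhds hx.1)).differentiableAt hr0)
    have d2 := ((hd'.contDiffAt (Ψ.open_source.mem_nhds hx.2)).differentiableAt hr0)
    rw [OpenPartialHomeomorph.coe_trans, fderiv_comp x d2 d1]
    simp only [Function.comp_apply, ContinuousLinearMap.comp_apply]
    rw [h2, h1]

lemma BilinEquivalent.symm (hr : r = ∞ ∨ r = ω) {b : E → E →L[𝕜] E →L[𝕜] 𝕜}
    {b' : E' → E' →L[𝕜] E' →L[𝕜] 𝕜}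
    (h : BilinEquivalent r b b') : BilinEquivalent r b' b := by
  have hr0 : r ≠ 0 := by rcases hr with rfl | rfl <;> simp
  obtain ⟨Φ, hs, h0, hd, hdi, he⟩ := h
  have ht : (0 : E') ∈ Φ.target := by rw [← h0]; exact Φ.map_source hs
  have hs0 : Φ.symm 0 = 0 := by conv_lhs => rw [← h0]; exact Φ.left_inv hs
  refine ⟨Φ.symm, ht, hs0, hdi, by simpa using hd, ?_⟩
  have hc : Tendsto Φ.symm (𝓝 0) (𝓝 0) := by
    simpa [hs0] using (Φ.symm.continuousAt ht).tendsto
  filter_upwards [hc.eventually he, Φ.open_target.mem_nhds ht] with x h1 hx v w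
  have d1 := ((hdi.contDiffAt (Φ.open_target.mem_nhds hx)).differentiableAt hr0)
  have d2 := ((hd.contDiffAt (Φ.open_source.mem_nhds (Φ.map_target hx))).differentiableAt hr0)
  have h2 : ∀ v, fderiv 𝕜 Φ (Φ.symm x) (fderiv 𝕜 Φ.symm x v) = v := by
    intro v
    have h3 := d2.hasFDerivAt.comp x d1.hasFDerivAt
    have h4 : (Φ ∘ Φ.symm) =ᶠ[𝓝 x] id := by
      filter_upwards [Φ.open_target.mem_nhds hx] with y hy using Φ.right_inv hy
    have := h3.unique ((hasFDerivAt_id x).congr_of_eventuallyEq h4)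
    exact congrArg (fun A : E' →L[𝕜] E' => A v) this
  rw [← h1, Φ.right_inv hx, h2, h2]

lemma BilinEquivalent.refl (b : E → E →L[𝕜] E →L[𝕜] 𝕜) : BilinEquivalent r b b :=
  ⟨OpenPartialHomeomorph.refl E, by simp, by simp, by simpa using contDiffOn_id,
    by simpa using contDiffOn_id, Eventually.of_forall fun x v w => by simp⟩

/-- The vector field `(1, V)` on the extended phase space. -/
lemma fderiv_extended {V : 𝕜 × E → E} {y : 𝕜 × E} (h : DifferentiableAt 𝕜 V y) (v : 𝕜 × E) :
    fderiv 𝕜 (fun y => ((1 : 𝕜), V y)) y v = (0, fderiv 𝕜 V y v) := by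
  rw [((hasFDerivAt_const (1 : 𝕜) y).prodMk h.hasFDerivAt).fderiv]
  simp

lemma hasFDerivAt_bilin_apply {Y : Type} [NormedAddCommGroup Y] [NormedSpace 𝕜 Y]
    {b : Y → E →L[𝕜] E →L[𝕜] 𝕜} {y : Y} (hb : DifferentiableAt 𝕜 b y) (v w : E) :
    ∃ L : Y × E × E →L[𝕜] 𝕜, HasFDerivAt (fun z : Y × E × E => b z.1 z.2.1 z.2.2) L (y, v, w) ∧
      ∀ y' v' w', L (y', v', w') = fderiv 𝕜 b y y' v w + b y v' w + b y v w' := by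
  have h0 : HasFDerivAt (fun z : Y × E × E => b z.1)
      ((fderiv 𝕜 b y).comp (ContinuousLinearMap.fst 𝕜 Y (E × E))) (y, v, w) := by
    have hf : HasFDerivAt (Prod.fst : Y × E × E → Y) (ContinuousLinearMap.fst 𝕜 Y (E × E))
      (y, v, w) := hasFDerivAt_fst
    have hb' : HasFDerivAt b (fderiv 𝕜 b y) (Prod.fst (y, v, w)) := hb.hasFDerivAt
    exact HasFDerivAt.comp (F := Y) (G := E →L[𝕜] E →L[𝕜] 𝕜) (g := b) (y, v, w) hb' hf
  have h1 := (h0.clm_apply (hasFDerivAt_fst.comp _ hasFDerivAt_snd)).clm_apply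
    (hasFDerivAt_snd.comp _ hasFDerivAt_snd)
  refine ⟨_, h1, fun y' v' w' => ?_⟩
  simp
  ring

variable [NormedSpace ℝ E] [IsScalarTower ℝ 𝕜 E]

/-- Solutions of the integral equation extended to differentiable functions on the line. -/
lemma extension_of_integral_eq {F : Type} [NormedAddCommGroup F] [NormedSpace 𝕜 F]
    [NormedSpace ℝ F] [IsScalarTower ℝ 𝕜 F] [CompleteSpace F] {u f : C(unitInterval, F)} {x : F}
    {ε : 𝕜} (h : u = ContinuousMap.const unitInterval x + ε • primitive 𝕜 F f) :
    ∃ u' : ℝ → F, (∀ τ : unitInterval, u' τ = u τ ∧ HasDerivAt u' (ε • f τ) τ) ∧ u' 0 = x := by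
  refine ⟨fun t => x + ε • ∫ s in (0 : ℝ)..t, extendLine f s, fun τ => ⟨?_, ?_⟩, by simp⟩
  · rw [h]; simp [primitive_apply]
  · have := ((hasDerivAt_primitive f τ).const_smul ε).const_add x
    rwa [extendLine_coe] at this

lemma flow_time_component {u : C(unitInterval, 𝕜 × E)} {s₀ ε : 𝕜} {x : E}
    [CompleteSpace E] {f : C(unitInterval, 𝕜 × E)} (hf : ∀ τ, (f τ).1 = 1)
    (h : u = ContinuousMap.const unitInterval (s₀, x) + ε • primitive 𝕜 (𝕜 × E) f) :
    (u 1).1 = s₀ + ε := by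
  obtain ⟨u', hu', h0⟩ := extension_of_integral_eq h
  have := primitive_superpose_eq (𝕜 := 𝕜) (F := 𝕜) (f := fun t => (u' t).1 - (t : 𝕜) * ε)
    (u := 0) (fun τ => by
      have h1 := (ContinuousLinearMap.fst ℝ 𝕜 E).hasFDerivAt.comp_hasDerivAt (τ : ℝ) (hu' τ).2
      have h2 := ((RCLike.ofRealCLM (K := 𝕜)).hasDerivAt (x := (τ : ℝ))).mul_const ε
      refine (h1.sub h2).congr_deriv ?_
      simp [hf])
  rw [map_zero] at this
  have h1 := (hu' 1).1
  simp only [Icc.coe_one] at h1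
  simp only [ContinuousMap.zero_apply, h1, h0, RCLike.ofReal_one, one_mul, RCLike.ofReal_zero,
    zero_mul, sub_zero] at this
  linear_combination -this

lemma first_component_eq_zero {w f : C(unitInterval, 𝕜 × E)} {ε : 𝕜} {v : E}
    [CompleteSpace E] (hf : ∀ τ, (f τ).1 = 0)
    (h : w = ContinuousMap.const unitInterval (0, v) + ε • primitive 𝕜 (𝕜 × E) f)
    (τ : unitInterval) : (w τ).1 = 0 := by
  have h1 := (ContinuousLinearMap.fst ℝ 𝕜 E).intervalIntegral_comp_comm (μ := MeasureTheory.volume)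
    ((continuous_extendLine f).intervalIntegrable (0 : ℝ) τ)
  rw [h]
  simp only [ContinuousMap.add_apply, ContinuousMap.const_apply, ContinuousMap.smul_apply,
    Prod.fst_add, Prod.smul_fst, zero_add, primitive_apply]
  have h2 : ∀ s, (extendLine f s).1 = 0 := fun s => hf _
  simp only [ContinuousLinearMap.coe_fst', h2, intervalIntegral.integral_zero] at h1
  rw [← h1, smul_zero]

/-- A field of bilinear forms with vanishing Lie derivative along `(1, V)` is constant along
the flow. -/
lemma bilin_constant_along_flow [CompleteSpace E] {V : 𝕜 × E → E}
    {b : 𝕜 × E → E →L[𝕜] E →L[𝕜] 𝕜} {u : C(unitInterval, 𝕜 × E)} {s₀ ε : 𝕜} {x : E} {s : Set (𝕜 × E)}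
    (hus : ∀ τ, u τ ∈ s) (hs : IsOpen s) (hV : ContDiffOn 𝕜 1 V s)
    (hb : ∀ y ∈ s, DifferentiableAt 𝕜 b y)
    (hLie : ∀ y ∈ s, ∀ v w, fderiv 𝕜 b y (1, V y) v w + b y (fderiv 𝕜 V y (0, v)) w
      + b y v (fderiv 𝕜 V y (0, w)) = 0)
    (hu : u = ContinuousMap.const unitInterval (s₀, x) + ε • primitive 𝕜 (𝕜 × E)
      (superpose unitInterval (fun y => ((1 : 𝕜), V y)) u))
    {W : E → C(unitInterval, 𝕜 × E)}
    (hW : ∀ v, W v = ContinuousMap.const unitInterval (0, v) + ε • primitive 𝕜 (𝕜 × E)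
      (pointwiseApply unitInterval (superpose unitInterval
        (fderiv 𝕜 (fun y => ((1 : 𝕜), V y))) u) (W v))) (v w : E) :
    b (u 1) (W v 1).2 (W w 1).2 = b (s₀, x) v w ∧ (u 1).1 = s₀ + ε := by
  have hV' : ContDiffOn 𝕜 1 (fun y => ((1 : 𝕜), V y)) s := contDiffOn_const.prodMk hV
  have hVd : ∀ y ∈ s, DifferentiableAt 𝕜 V y := fun y hy =>
    (hV.contDiffAt (hs.mem_nhds hy)).differentiableAt (by simp)
  have hf : ∀ τ, superpose unitInterval (fun y => ((1 : 𝕜), V y)) u τ = (1, V (u τ)) :=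
    superpose_apply hV'.continuousOn hus
  have hg : ∀ v τ, pointwiseApply unitInterval (superpose unitInterval
      (fderiv 𝕜 (fun y => ((1 : 𝕜), V y))) u) (W v) τ = (0, fderiv 𝕜 V (u τ) (W v τ)) := by
    intro v τ
    rw [pointwiseApply_apply, superpose_apply (hV'.continuousOn_fderiv_of_isOpen hs (by simp)) hus,
      fderiv_extended (hVd _ (hus τ))]
  refine ⟨?_, flow_time_component (fun τ => by rw [hf]) hu⟩
  have hW1 : ∀ v τ, (W v τ) = (0, (W v τ).2) := fun v τ =>
    Prod.ext (first_component_eq_zero (fun τ => by rw [hg]) (hW v) τ) rfl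
  obtain ⟨u', hu', hu0⟩ := extension_of_integral_eq hu
  obtain ⟨v', hv', hv0⟩ := extension_of_integral_eq (hW v)
  obtain ⟨w', hw', hw0⟩ := extension_of_integral_eq (hW w)
  have key := primitive_superpose_eq (𝕜 := 𝕜) (F := 𝕜) (u := 0)
    (f := fun t => b (u' t) (v' t).2 (w' t).2) (fun τ => by
      obtain ⟨L, hL, hLv⟩ := hasFDerivAt_bilin_apply (y := u' τ) (v := (v' τ).2) (w := (w' τ).2)
        (hb _ (by rw [(hu' τ).1]; exact hus τ))
      have d2 := (ContinuousLinearMap.snd ℝ 𝕜 E).hasFDerivAt.comp_hasDerivAt (τ : ℝ) (hv' τ).2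
      have d3 := (ContinuousLinearMap.snd ℝ 𝕜 E).hasFDerivAt.comp_hasDerivAt (τ : ℝ) (hw' τ).2
      have d5 := (hL.restrictScalars ℝ).comp_hasDerivAt (τ : ℝ)
        ((hu' τ).2.prodMk (d2.prodMk d3))
      refine d5.congr_deriv ?_
      simp only [ContinuousLinearMap.coe_restrictScalars', hLv, hf, hg, (hu' τ).1, (hv' τ).1,
        (hw' τ).1, ContinuousLinearMap.coe_snd', Prod.smul_snd]
      rw [hW1 v, hW1 w]
      have := hLie _ (hus τ) (W v τ).2 (W w τ).2
      simp only [map_smul, smul_apply,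
        smul_eq_mul, ContinuousMap.zero_apply]
      linear_combination ε * this)
  rw [map_zero] at key
  have e1 := (hu' 1).1
  have e2 := (hv' 1).1
  have e3 := (hw' 1).1
  simp only [Icc.coe_one] at e1 e2 e3
  simp only [ContinuousMap.zero_apply, e1, e2, e3, hu0, hv0, hw0] at key
  exact (sub_eq_zero.1 key.symm)

/-- Moser's method, locally in time: if the Lie derivative of the family `b (s, ·)` along the
time-dependent vector field `V` vanishes and `V` is zero at the origin, then `b (s, ·)` and
`b (s₀, ·)` are equivalent for `s` near `s₀`. -/
theorem bilinEquivalent_of_lie_eq_zero [CompleteSpace E] (hr : r = ∞ ∨ r = ω) {V : 𝕜 × E → E}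
    {b : 𝕜 × E → E →L[𝕜] E →L[𝕜] 𝕜} {s₀ : 𝕜} (hV : GermAt 𝕜 r V (s₀, 0))
    (hb : GermAt 𝕜 r b (s₀, 0)) (hV0 : ∀ᶠ s in 𝓝 s₀, V (s, 0) = 0)
    (hLie : ∀ᶠ y in 𝓝 (s₀, (0 : E)), ∀ v w, fderiv 𝕜 b y (1, V y) v w
      + b y (fderiv 𝕜 V y (0, v)) w + b y v (fderiv 𝕜 V y (0, w)) = 0) :
    ∀ᶠ ε in 𝓝 (0 : 𝕜), BilinEquivalent r (fun x => b (s₀, x)) (fun x => b (s₀ + ε, x)) := by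
  have hr0 : r ≠ 0 := by rcases hr with rfl | rfl <;> simp
  have hr1 : 1 ≤ r := by rcases hr with rfl | rfl <;> simp
  -- The time-dependent field becomes autonomous on the extended space by adding a unit time
  -- component.
  set X : 𝕜 × E → 𝕜 × E := fun y => (1, V y) with hX
  have hXg : GermAt 𝕜 r X (s₀, 0) := by
    filter_upwards [hV] with y hy using contDiffAt_const.prodMk hy
  obtain ⟨U, hU, hU0, hUe, hUu⟩ := exists_flow hr hXg
  have hUd := fderiv_flow hr hXg hU hU0 hUe
  obtain ⟨s, hs, hso, hps⟩ := eventually_nhds_iff.1 ((hV.and (hb.differentiableAt hr)).and hLie)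
  have hmem : ∀ᶠ z in 𝓝 ((0 : 𝕜), (s₀, (0 : E))), ∀ τ, U z τ ∈ s := by
    refine hU.self_of_nhds.continuousAt.eventually ((isOpen_mapsInto hso).mem_nhds ?_)
    intro τ
    simpa [hU0] using hps
  have hemb : Tendsto (fun z : 𝕜 × E => (z.1, (s₀, z.2))) (𝓝 (0, 0)) (𝓝 (0, (s₀, 0))) := by
    have : Continuous (fun z : 𝕜 × E => (z.1, (s₀, z.2))) := by fun_prop
    exact this.tendsto _
  let ev : C(unitInterval, 𝕜 × E) →L[𝕜] E :=
    (ContinuousLinearMap.snd 𝕜 𝕜 E).comp (ContinuousMap.evalCLM 𝕜 1)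
  let ψ : 𝕜 × E → E := fun z => ev (U (z.1, (s₀, z.2)))
  have hψ : GermAt 𝕜 r ψ (0, 0) := by
    filter_upwards [hemb.eventually hU] with z hz
    have h1 : ContDiffAt 𝕜 r (fun z : 𝕜 × E => (z.1, (s₀, z.2))) z := by fun_prop
    exact ev.contDiff.contDiffAt.comp z (hz.comp z h1)
  have hψ0 : ∀ᶠ x in 𝓝 (0 : E), ψ (0, x) = x := by
    have h1 : Tendsto (fun x : E => ((0 : 𝕜), x)) (𝓝 0) (𝓝 (0, 0)) := by
      have : Continuous (fun x : E => ((0 : 𝕜), x)) := by fun_prop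
      exact this.tendsto _
    filter_upwards [(hemb.comp h1).eventually hUe] with x hx
    simp only [Function.comp_apply, zero_smul, add_zero] at hx
    simp [ψ, hx, ev]
  -- Since `V (s, 0) = 0`, the curve `τ ↦ (s₀ + ε τ, 0)` solves the integral equation; by uniqueness
  -- it is the flow curve, so the origin stays fixed.
  have hψz : ∀ᶠ ε in 𝓝 (0 : 𝕜), ψ (ε, 0) = 0 := by
    let c : 𝕜 → C(unitInterval, 𝕜 × E) := fun ε =>
      ContinuousMap.const unitInterval (s₀, 0) +
        ε • primitive 𝕜 (𝕜 × E) (ContinuousMap.const unitInterval (1, 0))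
    have hc : Continuous c := by fun_prop
    have hcv : ∀ ε τ, c ε τ = (s₀ + ε * ((τ : ℝ) : 𝕜), 0) := by
      intro ε τ
      have h2 : primitive 𝕜 (𝕜 × E) (ContinuousMap.const unitInterval (1, 0)) τ
          = (((τ : ℝ) : 𝕜), 0) := by
        rw [primitive_apply]
        have h1 : ∀ s, extendLine (ContinuousMap.const unitInterval ((1 : 𝕜), (0 : E))) s
          = (1, 0) := fun s => rfl
        simp only [h1, intervalIntegral.integral_const, sub_zero]
        simp [RCLike.real_smul_eq_coe_mul]
      simp [c, h2]
    have hc0 : c 0 = ContinuousMap.const unitInterval (s₀, 0) := by simp [c]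
    have h1 : Tendsto (fun ε : 𝕜 => ((ε, (s₀, (0 : E))), c ε)) (𝓝 0)
        (𝓝 (((0 : 𝕜), (s₀, 0)), ContinuousMap.const unitInterval (s₀, 0))) := by
      have : Continuous (fun ε : 𝕜 => ((ε, (s₀, (0 : E))), c ε)) := by fun_prop
      simpa [hc0] using this.tendsto 0
    have h2 : ∀ᶠ ε in 𝓝 (0 : 𝕜), ∀ τ, c ε τ ∈ s ∩ {y | V (y.1, 0) = 0} := by
      obtain ⟨t, ht, hto, hpt⟩ := eventually_nhds_iff.1 hV0
      have h3 := (isOpen_mapsInto (K := unitInterval)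
        (hso.inter (hto.preimage continuous_fst))).preimage hc
      filter_upwards [h3.mem_nhds (by intro τ; rw [hc0]; exact ⟨hps, hpt⟩)] with ε hε τ
      exact ⟨(hε τ).1, ht _ (hε τ).2⟩
    filter_upwards [h1.eventually hUu, h2] with ε he hε
    have h4 : superpose unitInterval X (c ε) = ContinuousMap.const unitInterval (1, 0) := by
      ext1 τ
      have hXc : ContinuousOn X s := fun y hy =>
        (continuousAt_const.prodMk (hs y hy).1.1.continuousAt).continuousWithinAt
      rw [superpose_apply hXc (fun τ => (hε τ).1)]
      have := (hε τ).2
      rw [mem_ofPred_eq, hcv] at this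
      rw [hcv]
      simp [hX, this]
    have h5 := he (by simp only [h4, c])
    simp only [ψ, ev, h5]
    simp [hcv]
  -- At `ε = 0` the time-one map is the identity, and invertibility of the derivative is an open
  -- condition.
  have hψd : ∀ᶠ z in 𝓝 ((0 : 𝕜), (0 : E)), ∃ e : E ≃L[𝕜] E,
      (e : E →L[𝕜] E) = (fderiv 𝕜 ψ z).comp (ContinuousLinearMap.inr 𝕜 𝕜 E) := by
    have hc : ContinuousAt (fun z => (fderiv 𝕜 ψ z).comp (ContinuousLinearMap.inr 𝕜 𝕜 E))
        ((0 : 𝕜), (0 : E)) :=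
      (hψ.fderiv_right hr).self_of_nhds.continuousAt.clm_comp continuousAt_const
    have h0 : (fderiv 𝕜 ψ (0, 0)).comp (ContinuousLinearMap.inr 𝕜 𝕜 E)
        = ((ContinuousLinearEquiv.refl 𝕜 E : E ≃L[𝕜] E) : E →L[𝕜] E) := by
      have h1 := (hψ.self_of_nhds.differentiableAt hr0).hasFDerivAt
      have h2 : HasFDerivAt (fun x : E => ((0 : 𝕜), x)) (ContinuousLinearMap.inr 𝕜 𝕜 E) 0 :=
        (ContinuousLinearMap.inr 𝕜 𝕜 E).hasFDerivAt
      have h3 := HasFDerivAt.comp (0 : E) (g := ψ) (f := fun x : E => ((0 : 𝕜), x)) h1 h2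
      exact h3.unique ((hasFDerivAt_id (0 : E)).congr_of_eventuallyEq hψ0)
    have hn := ContinuousLinearEquiv.nhds (ContinuousLinearEquiv.refl 𝕜 E)
    rw [← h0] at hn
    have h4 := hc.eventually hn
    filter_upwards [h4] with z hz
    obtain ⟨e, he⟩ := hz
    exact ⟨e, he⟩
  have hall := (hψ.and (hemb.eventually ((hU.differentiableAt hr).and
    (hUe.and (hUd.and hmem))))).and hψd
  -- Currying converts a neighbourhood of `(0, 0)` into: for `ε` near 0, for `x` near 0, with the
  -- second neighbourhood depending on `ε`.
  rw [nhds_prod_eq] at hall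
  filter_upwards [hψz, hall.curry] with ε h0 hε
  have hgerm : GermAt 𝕜 r (fun x => ψ (ε, x)) 0 := by
    filter_upwards [hε] with x hx
    exact hx.1.1.comp x (by fun_prop)
  have hderiv : ∀ x, DifferentiableAt 𝕜 ψ (ε, x) → HasFDerivAt (fun x => ψ (ε, x))
      ((fderiv 𝕜 ψ (ε, x)).comp (ContinuousLinearMap.inr 𝕜 𝕜 E)) x := by
    intro x hx
    have h2 : HasFDerivAt (fun x : E => (ε, x)) (ContinuousLinearMap.inr 𝕜 𝕜 E) x := by
      have := (hasFDerivAt_const ε x).prodMk (hasFDerivAt_id (𝕜 := 𝕜) x)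
      exact this
    exact HasFDerivAt.comp x (g := ψ) (f := fun x : E => (ε, x)) hx.hasFDerivAt h2
  obtain ⟨e, he⟩ := hε.self_of_nhds.2
  obtain ⟨Ψ, hsrc, hcoe, hd, hdi⟩ := hgerm.exists_openPartialHomeomorph hr e
    (he ▸ hderiv 0 (hε.self_of_nhds.1.1.differentiableAt hr0))
  refine ⟨Ψ, hsrc, by rw [hcoe]; exact h0, hd, hdi, ?_⟩
  filter_upwards [hε] with x hx v w
  obtain ⟨⟨hx1, hx2, hx3, hx4, hx5⟩, -⟩ := hx
  obtain ⟨k1, k2⟩ := bilin_constant_along_flow (V := V) (b := b) hx5 hso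
    (fun y hy => ((hs y hy).1.1.of_le hr1).contDiffWithinAt) (fun y hy => (hs y hy).1.2)
    (fun y hy => (hs y hy).2) hx3
    (W := fun v => fderiv 𝕜 U (ε, (s₀, x)) (0, (0, v))) (fun v => hx4 (0, v)) v w
  have hW : ∀ v, fderiv 𝕜 Ψ x v = ((fderiv 𝕜 U (ε, (s₀, x)) (0, (0, v))) 1).2 := by
    intro v
    have h2 : HasFDerivAt (fun x : E => (ε, (s₀, x)))
        ((ContinuousLinearMap.inr 𝕜 𝕜 (𝕜 × E)).comp (ContinuousLinearMap.inr 𝕜 𝕜 E)) x :=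
      by
      have := (hasFDerivAt_const ε x).prodMk
        ((hasFDerivAt_const s₀ x).prodMk (hasFDerivAt_id (𝕜 := 𝕜) x))
      exact this
    have h3 := ev.hasFDerivAt.comp x
      (HasFDerivAt.comp x (g := U) (f := fun x : E => (ε, (s₀, x))) hx2.hasFDerivAt h2)
    rw [hcoe]
    exact congrArg (fun A : E →L[𝕜] E => A v) h3.fderiv
  rw [hW, hW, hcoe, ← k1]
  have : (s₀ + ε, ψ (ε, x)) = U (ε, (s₀, x)) 1 := Prod.ext k2.symm rfl
  rw [this]

end Transport

/-! ### Schur complements near a form with two-dimensional kernel. -/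

section Schur

variable {𝕜 : Type} [RCLike 𝕜]
variable {E : Type} [NormedAddCommGroup E] [NormedSpace 𝕜 E]

lemma bilin_swap {η : E →L[𝕜] E →L[𝕜] 𝕜} (h : ∀ v, η v v = 0) (v w : E) : η v w = -η w v := by
  have := h (v + w)
  simp only [map_add, add_apply, h] at this
  linear_combination this

/-- Restriction of a bilinear form to a subspace. -/
def restrictBilin (S : Submodule 𝕜 E) : (E →L[𝕜] E →L[𝕜] 𝕜) →L[𝕜] (S →L[𝕜] S →L[𝕜] 𝕜) :=
  ((ContinuousLinearMap.compL 𝕜 S (E →L[𝕜] 𝕜) (S →L[𝕜] 𝕜))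
    ((ContinuousLinearMap.compL 𝕜 S E 𝕜).flip S.subtypeL)).comp
    ((ContinuousLinearMap.compL 𝕜 S E (E →L[𝕜] 𝕜)).flip S.subtypeL)

lemma germAt_inverse {X F G : Type} [NormedAddCommGroup X] [NormedSpace 𝕜 X]
    [NormedAddCommGroup F] [NormedSpace 𝕜 F] [NormedAddCommGroup G] [NormedSpace 𝕜 G]
    [CompleteSpace F] (B : X →L[𝕜] F →L[𝕜] G) (x₀ : X) (e₀ : F ≃L[𝕜] G)
    (he₀ : (e₀ : F →L[𝕜] G) = B x₀) (r : WithTop ℕ∞) :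
    GermAt 𝕜 r (fun x => (B x).inverse) x₀ ∧ ∀ᶠ x in 𝓝 x₀, ∀ g, B x ((B x).inverse g) = g := by
  have hev : ∀ᶠ x in 𝓝 x₀, ∃ e : F ≃L[𝕜] G, (e : F →L[𝕜] G) = B x := by
    have h1 := ContinuousLinearEquiv.nhds e₀
    rw [he₀] at h1
    exact B.continuous.continuousAt.eventually h1
  constructor
  · filter_upwards [hev] with x ⟨e, he⟩
    have h1 : ContDiffAt 𝕜 r ContinuousLinearMap.inverse (B x) := by
      rw [← he]; exact contDiffAt_map_inverse e
    exact h1.comp x B.contDiff.contDiffAt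
  · filter_upwards [hev] with x ⟨e, he⟩ g
    rw [← he, ContinuousLinearMap.inverse_equiv]
    exact e.apply_symm_apply g

/-- A complement of the kernel of an alternating form, and the inverse of the restriction of
nearby forms to it. -/
lemma exists_block_inverse [FiniteDimensional 𝕜 E] {η₀ : E →L[𝕜] E →L[𝕜] 𝕜}
    (halt : ∀ v, η₀ v v = 0) {k₁ k₂ : E} (hk : ∀ v, η₀ v = 0 ↔ v ∈ Submodule.span 𝕜 {k₁, k₂})
    (r : WithTop ℕ∞) :
    ∃ S : Submodule 𝕜 E, IsCompl (Submodule.span 𝕜 {k₁, k₂}) S ∧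
      (∀ v : E, ∃ a c : 𝕜, ∃ s : S, v = a • k₁ + c • k₂ + s) ∧
      ∃ I : (E →L[𝕜] E →L[𝕜] 𝕜) → (S →L[𝕜] 𝕜) →L[𝕜] S, GermAt 𝕜 r I η₀ ∧
        ∀ᶠ η in 𝓝 η₀, ∀ ξ : S →L[𝕜] 𝕜, ∀ s : S, η (I η ξ) s = ξ s := by
  have : CompleteSpace E := FiniteDimensional.complete 𝕜 E
  obtain ⟨S, hS⟩ := (Submodule.span 𝕜 {k₁, k₂}).exists_isCompl
  have : CompleteSpace S := FiniteDimensional.complete 𝕜 S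
  have hk1 : η₀ k₁ = 0 := (hk _).2 (Submodule.subset_span (by simp))
  have hk2 : η₀ k₂ = 0 := (hk _).2 (Submodule.subset_span (by simp))
  have hdec : ∀ v : E, ∃ a c : 𝕜, ∃ s : S, v = a • k₁ + c • k₂ + s := by
    intro v
    have hv : v ∈ Submodule.span 𝕜 {k₁, k₂} ⊔ S := by rw [hS.sup_eq_top]; trivial
    obtain ⟨y, hy, s, hs, rfl⟩ := Submodule.mem_sup.1 hv
    obtain ⟨a, c, rfl⟩ := Submodule.mem_span_pair.1 hy
    exact ⟨a, c, ⟨s, hs⟩, rfl⟩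
  have hinj : Function.Injective (restrictBilin S η₀) := by
    rw [injective_iff_map_eq_zero]
    intro s hs
    have : η₀ s = 0 := by
      ext v
      obtain ⟨a, c, s', rfl⟩ := hdec v
      have h1 : η₀ s s' = 0 := congrArg (fun A : S →L[𝕜] 𝕜 => A s') hs
      have h2 : ∀ w, η₀ w = 0 → η₀ s w = 0 := fun w hw => by
        rw [bilin_swap halt, hw]; simp
      simp [h1, h2 _ hk1, h2 _ hk2]
    have hmem : (s : E) ∈ Submodule.span 𝕜 {k₁, k₂} := (hk _).1 this
    exact Subtype.ext (Submodule.disjoint_def.1 hS.disjoint _ hmem s.2)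
  have hfin : Module.finrank 𝕜 S = Module.finrank 𝕜 (S →L[𝕜] 𝕜) := by
    have e : (S →ₗ[𝕜] 𝕜) ≃ₗ[𝕜] (S →L[𝕜] 𝕜) := LinearMap.toContinuousLinearMap
    rw [← e.finrank_eq]
    exact (Subspace.dual_finrank_eq (K := 𝕜) (V := S)).symm
  let e₀ : S ≃L[𝕜] (S →L[𝕜] 𝕜) :=
    (LinearEquiv.ofInjectiveOfFinrankEq (restrictBilin S η₀ : S →ₗ[𝕜] (S →L[𝕜] 𝕜))
      hinj hfin).toContinuousLinearEquiv
  have he₀ : (e₀ : S →L[𝕜] (S →L[𝕜] 𝕜)) = restrictBilin S η₀ := by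
    ext s s'; rfl
  obtain ⟨h1, h2⟩ := germAt_inverse (restrictBilin S) η₀ e₀ he₀ r
  refine ⟨S, hS, hdec, _, h1, ?_⟩
  filter_upwards [h2] with η hη ξ s
  exact congrArg (fun A : S →L[𝕜] 𝕜 => A s) (hη ξ)

/-- Near an alternating form with two-dimensional kernel, alternating forms are block
diagonalised: `κ₁`, `κ₂` span the complement of a nondegenerate block, and `R` inverts the form
up to the factor `η (κ₁ η) (κ₂ η)`. -/
theorem exists_schur_frame [FiniteDimensional 𝕜 E] {η₀ : E →L[𝕜] E →L[𝕜] 𝕜}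
    (halt : ∀ v, η₀ v v = 0) {k₁ k₂ : E} (hk : ∀ v, η₀ v = 0 ↔ v ∈ Submodule.span 𝕜 {k₁, k₂})
    (hind : LinearIndependent 𝕜 ![k₁, k₂]) (r : WithTop ℕ∞) :
    ∃ (κ₁ κ₂ : (E →L[𝕜] E →L[𝕜] 𝕜) → E) (R : (E →L[𝕜] E →L[𝕜] 𝕜) × (E →L[𝕜] 𝕜) → E),
      GermAt 𝕜 r κ₁ η₀ ∧ GermAt 𝕜 r κ₂ η₀ ∧ (∀ ξ, GermAt 𝕜 r R (η₀, ξ)) ∧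
      (∀ η, R (η, 0) = 0) ∧ κ₁ η₀ = k₁ ∧ κ₂ η₀ = k₂ ∧
      ∀ᶠ η in 𝓝 η₀, (∀ v, η v v = 0) →
        (∀ ξ v, η (R (η, ξ)) v = η (κ₁ η) (κ₂ η) * ξ v) ∧
        (η (κ₁ η) (κ₂ η) = 0 → η (κ₁ η) = 0 ∧ η (κ₂ η) = 0) ∧
        (∀ a c : 𝕜, a • κ₁ η + c • κ₂ η = 0 → a = 0 ∧ c = 0) ∧
        (∀ v, η v = 0 → ∃ a c : 𝕜, v = a • κ₁ η + c • κ₂ η) := by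
  obtain ⟨S, hS, hdec, I, hIg, hI⟩ := exists_block_inverse halt hk r
  have hk1 : η₀ k₁ = 0 := (hk _).2 (Submodule.subset_span (by simp))
  have hk2 : η₀ k₂ = 0 := (hk _).2 (Submodule.subset_span (by simp))
  -- The correction lies in `S` and makes `κ k η` orthogonal to `S` with respect to `η`: the Schur
  -- complement of the nondegenerate block.
  let κ : E → (E →L[𝕜] E →L[𝕜] 𝕜) → E := fun k η => k - I η ((η k).comp S.subtypeL)
  have hκ : ∀ k, GermAt 𝕜 r (κ k) η₀ := by
    intro k
    filter_upwards [hIg] with η hη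
    have h1 : ContDiffAt 𝕜 r (fun η : E →L[𝕜] E →L[𝕜] 𝕜 => (η k).comp S.subtypeL) η :=
      (contDiffAt_id.clm_apply contDiffAt_const).clm_comp contDiffAt_const
    exact contDiffAt_const.sub (S.subtypeL.contDiff.contDiffAt.comp η (hη.clm_apply h1))
  have hκ0 : ∀ k, η₀ k = 0 → κ k η₀ = k := by
    intro k hk0
    simp [κ, hk0]
  -- In the splitting by `κ k₁`, `κ k₂` and `S`, this is the blockwise inverse of `η` multiplied by
  -- `m = η (κ k₁ η) (κ k₂ η)`. The factor clears the denominator of the 2 × 2 block, so `R` stays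
  -- regular where `m` vanishes.
  let R : (E →L[𝕜] E →L[𝕜] 𝕜) × (E →L[𝕜] 𝕜) → E := fun z =>
    z.2 (κ k₂ z.1) • κ k₁ z.1 - z.2 (κ k₁ z.1) • κ k₂ z.1
      + z.1 (κ k₁ z.1) (κ k₂ z.1) • (I z.1 (z.2.comp S.subtypeL) : E)
  have hRg : ∀ ξ, GermAt 𝕜 r R (η₀, ξ) := by
    intro ξ
    have h := (hIg.and ((hκ k₁).and (hκ k₂)))
    have h' := (continuousAt_fst (p := (η₀, ξ))).eventually h
    filter_upwards [h'] with z ⟨h0, h1, h2⟩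
    have g1 : ContDiffAt 𝕜 r (fun z : (E →L[𝕜] E →L[𝕜] 𝕜) × (E →L[𝕜] 𝕜) => κ k₁ z.1) z :=
      h1.comp z contDiffAt_fst
    have g2 : ContDiffAt 𝕜 r (fun z : (E →L[𝕜] E →L[𝕜] 𝕜) × (E →L[𝕜] 𝕜) => κ k₂ z.1) z :=
      h2.comp z contDiffAt_fst
    have g0 : ContDiffAt 𝕜 r (fun z : (E →L[𝕜] E →L[𝕜] 𝕜) × (E →L[𝕜] 𝕜) =>
        (I z.1 (z.2.comp S.subtypeL) : E)) z :=
      S.subtypeL.contDiff.contDiffAt.comp z ((h0.comp z contDiffAt_fst).clm_apply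
        (contDiffAt_snd.clm_comp contDiffAt_const))
    exact (((contDiffAt_snd.clm_apply g2).smul g1).sub ((contDiffAt_snd.clm_apply g1).smul g2)).add
      (((contDiffAt_fst.clm_apply g1).clm_apply g2).smul g0)
  refine ⟨κ k₁, κ k₂, R, hκ _, hκ _, hRg, fun η => by simp [R], hκ0 _ hk1, hκ0 _ hk2, ?_⟩
  filter_upwards [hI] with η hη hηalt
  have hs : ∀ k (s : S), η (κ k η) s = 0 := by
    intro k s
    have := hη ((η k).comp S.subtypeL) s
    simp only [κ, map_sub, sub_apply, this]
    simp
  have hs' : ∀ k (s : S), η s (κ k η) = 0 := fun k s => by rw [bilin_swap hηalt, hs, neg_zero]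
  have hdec' : ∀ v : E, ∃ a c : 𝕜, ∃ s : S, v = a • κ k₁ η + c • κ k₂ η + s := by
    intro v
    obtain ⟨a, c, s, rfl⟩ := hdec v
    refine ⟨a, c, s + a • I η ((η k₁).comp S.subtypeL) + c • I η ((η k₂).comp S.subtypeL), ?_⟩
    simp only [κ, Submodule.coe_add, Submodule.coe_smul, smul_sub]
    abel
  refine ⟨?_, ?_, ?_, ?_⟩
  · intro ξ v
    have h1 : ∀ v, η (R (η, ξ)) v = ξ (κ k₂ η) * η (κ k₁ η) v - ξ (κ k₁ η) * η (κ k₂ η) v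
        + η (κ k₁ η) (κ k₂ η) * η (I η (ξ.comp S.subtypeL)) v := by
      intro v
      simp [R]
    obtain ⟨a, c, s, rfl⟩ := hdec' v
    have h2 := hη (ξ.comp S.subtypeL) s
    have h3 := bilin_swap hηalt (κ k₂ η) (κ k₁ η)
    rw [h1]
    simp only [map_add, map_smul, smul_eq_mul, hs, hs', h2, hηalt, h3]
    simp
    ring
  · intro h0
    have h3 := bilin_swap hηalt (κ k₂ η) (κ k₁ η)
    constructor <;> ext v <;> obtain ⟨a, c, s, rfl⟩ := hdec' v <;>
      simp [hs, hηalt, h0, h3]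
  · intro a c hac
    have h1 : a • k₁ + c • k₂ ∈ S := by
      have : a • k₁ + c • k₂ = ((a • I η ((η k₁).comp S.subtypeL)
          + c • I η ((η k₂).comp S.subtypeL) : S) : E) := by
        rw [← sub_eq_zero, ← hac]
        simp only [κ, Submodule.coe_add, Submodule.coe_smul, smul_sub]
        abel
      rw [this]; exact Subtype.property _
    have h2 : a • k₁ + c • k₂ = 0 :=
      Submodule.disjoint_def.1 hS.disjoint _ (Submodule.mem_span_pair.2 ⟨a, c, rfl⟩) h1
    exact LinearIndependent.pair_iff.1 hind a c h2
  · intro v hv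
    obtain ⟨a, c, s, rfl⟩ := hdec' v
    refine ⟨a, c, ?_⟩
    have hzero : ∀ ξ : S →L[𝕜] 𝕜, ξ s = 0 := by
      intro ξ
      have h1 := hη ξ s
      rw [bilin_swap hηalt] at h1
      have h2 : η (a • κ k₁ η + c • κ k₂ η + s) (I η ξ) = 0 := by rw [hv]; rfl
      simp only [map_add, map_smul, add_apply, smul_apply, hs] at h2
      rw [smul_zero, smul_zero, zero_add, zero_add] at h2
      rw [← h1, h2, neg_zero]
    have : s = 0 := by
      by_contra hne
      obtain ⟨ξ, -, hξ⟩ := exists_dual_vector 𝕜 s (by simpa using hne)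
      rw [hzero] at hξ
      exact hne (by simpa using hξ.symm)
    rw [this]; simp

end Schur

/-! ### Closed two-forms and the relative Poincaré lemma. -/

section Primitive

variable {𝕜 : Type} [RCLike 𝕜]
variable {H : Type} [NormedAddCommGroup H] [NormedSpace 𝕜 H]
variable {r : WithTop ℕ∞}

/-- A field of bilinear forms is a closed `2`-form germ at `0`. -/
structure IsClosedTwoForm {E : Type} [NormedAddCommGroup E] [NormedSpace 𝕜 E]
    (r : WithTop ℕ∞) (b : E → E →L[𝕜] E →L[𝕜] 𝕜) : Prop where
  germ : GermAt 𝕜 r b 0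
  alt : ∀ᶠ x in 𝓝 0, ∀ v, b x v v = 0
  closed : ∀ᶠ x in 𝓝 0, ∀ u v w,
    fderiv 𝕜 b x u v w - fderiv 𝕜 b x v u w + fderiv 𝕜 b x w u v = 0

lemma fderiv_bilin_alt {E : Type} [NormedAddCommGroup E] [NormedSpace 𝕜 E] {x : E}
    {b : E → E →L[𝕜] E →L[𝕜] 𝕜} (hb : DifferentiableAt 𝕜 b x)
    (h : ∀ᶠ x in 𝓝 x, ∀ v, b x v v = 0) (u v : E) : fderiv 𝕜 b x u v v = 0 := by
  have h1 : HasFDerivAt (fun x => b x v v) _ x :=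
    (hb.hasFDerivAt.clm_apply (hasFDerivAt_const v x)).clm_apply (hasFDerivAt_const v x)
  have h2 : (fun x => b x v v) =ᶠ[𝓝 x] fun _ => 0 := by
    filter_upwards [h] with y hy using hy v
  have h3 := congrArg (fun A : E →L[𝕜] 𝕜 => A u)
    (h1.unique ((hasFDerivAt_const (0 : 𝕜) x).congr_of_eventuallyEq h2))
  simpa using h3

lemma map_primitive_one {F G : Type} [NormedAddCommGroup F] [NormedSpace 𝕜 F] [NormedSpace ℝ F]
    [IsScalarTower ℝ 𝕜 F] [NormedAddCommGroup G] [NormedSpace 𝕜 G] [NormedSpace ℝ G]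
    [IsScalarTower ℝ 𝕜 G] [CompleteSpace F] [CompleteSpace G] (L : F →L[𝕜] G)
    (u : C(unitInterval, F)) :
    L (primitive 𝕜 F u 1) = primitive 𝕜 G (ContinuousLinearMap.compLeftContinuous 𝕜 _ L u) 1 := by
  simp only [primitive_apply]
  have h1 := (L.restrictScalars ℝ).intervalIntegral_comp_comm (μ := MeasureTheory.volume)
    ((continuous_extendLine u).intervalIntegrable (0 : ℝ) (1 : unitInterval))
  exact h1.symm

lemma fderiv_poincare_integrand {δ : 𝕜 × H → (𝕜 × H) →L[𝕜] (𝕜 × H) →L[𝕜] 𝕜} {x : 𝕜 × H}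
    (h : DifferentiableAt 𝕜 δ x) (u : 𝕜 × H) (w : H) :
    fderiv 𝕜 (fun x => (δ x (1, 0)).comp (ContinuousLinearMap.inr 𝕜 𝕜 H)) x u w
      = fderiv 𝕜 δ x u (1, 0) (0, w) := by
  have h1 : HasFDerivAt (fun x => (δ x (1, 0)).comp (ContinuousLinearMap.inr 𝕜 𝕜 H)) _ x :=
    (h.hasFDerivAt.clm_apply (hasFDerivAt_const _ x)).clm_comp (hasFDerivAt_const _ x)
  rw [h1.fderiv]
  simp

lemma poincare_integrand_germ {δ : 𝕜 × H → (𝕜 × H) →L[𝕜] (𝕜 × H) →L[𝕜] 𝕜} {x : 𝕜 × H}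
    (h : ContDiffAt 𝕜 r δ x) :
    ContDiffAt 𝕜 r (fun x => (δ x (1, 0)).comp (ContinuousLinearMap.inr 𝕜 𝕜 H)) x :=
  (h.clm_apply contDiffAt_const).clm_comp contDiffAt_const

/-- The coefficient form of the relative Poincaré lemma: if `δ` is closed and vanishes on vectors
tangent to `{t = 0}`, then `δ = d (t γ)`. -/
def poincareCoeff (δ : 𝕜 × H → (𝕜 × H) →L[𝕜] (𝕜 × H) →L[𝕜] 𝕜) : 𝕜 × H → H →L[𝕜] 𝕜 :=
  segmentAverage 𝕜 (fun x => (δ x (1, 0)).comp (ContinuousLinearMap.inr 𝕜 𝕜 H))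

/-- This is what makes the Moser field vanish at the origin. -/
theorem poincareCoeff_zero {δ : 𝕜 × H → (𝕜 × H) →L[𝕜] (𝕜 × H) →L[𝕜] 𝕜} (h0 : δ 0 = 0)
    (hδ : ContinuousAt δ 0) : poincareCoeff δ 0 = 0 := by
  have : superpose unitInterval (fun x => (δ x (1, 0)).comp (ContinuousLinearMap.inr 𝕜 𝕜 H))
      (contraction 𝕜 H 0) = 0 := by
    ext1 l
    have hp : ∀ l : ℝ, (((l : 𝕜) * (0 : 𝕜 × H).1, (0 : 𝕜 × H).2)) = (0 : 𝕜 × H) := by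
      intro l; ext <;> simp
    rw [superpose_contraction_apply, hp, h0]
    · simp
    · intro l _
      rw [hp]
      exact (hδ.clm_apply continuousAt_const).clm_comp continuousAt_const
  rw [poincareCoeff, segmentAverage, this, map_zero]
  rfl

variable [FiniteDimensional 𝕜 H]

theorem poincareCoeff_germ (hr : r = ∞ ∨ r = ω)
    {δ : 𝕜 × H → (𝕜 × H) →L[𝕜] (𝕜 × H) →L[𝕜] 𝕜} (hδ : GermAt 𝕜 r δ 0) :
    GermAt 𝕜 r (poincareCoeff δ) 0 := by
  have : CompleteSpace H := FiniteDimensional.complete 𝕜 H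
  refine germAt_segmentAverage hr ?_
  filter_upwards [hδ] with x hx using poincare_integrand_germ hx

variable [NormedSpace ℝ H] [IsScalarTower ℝ 𝕜 H]

/-- Pull `δ` back under `(t, q) ↦ (l t, q)`. At `l = 1` this is `δ`, at `l = 0` it vanishes by
`hres`, and closedness turns its derivative in `l` into the integrand of the left-hand side. -/
theorem poincareCoeff_spec (hr : r = ∞ ∨ r = ω)
    {δ : 𝕜 × H → (𝕜 × H) →L[𝕜] (𝕜 × H) →L[𝕜] 𝕜} (hδ : IsClosedTwoForm r δ)
    (hres : ∀ᶠ q in 𝓝 (0 : H), ∀ v w : H, δ (0, q) (0, v) (0, w) = 0) :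
    ∀ᶠ x in 𝓝 (0 : 𝕜 × H), ∀ v w : 𝕜 × H,
      (v.1 * poincareCoeff δ x w.2 + x.1 * fderiv 𝕜 (poincareCoeff δ) x v w.2)
      - (w.1 * poincareCoeff δ x v.2 + x.1 * fderiv 𝕜 (poincareCoeff δ) x w v.2) = δ x v w := by
  have : CompleteSpace H := FiniteDimensional.complete 𝕜 H
  set c : 𝕜 × H → H →L[𝕜] 𝕜 := fun x => (δ x (1, 0)).comp (ContinuousLinearMap.inr 𝕜 𝕜 H) with hc
  have hcg : GermAt 𝕜 r c (0, 0) := by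
    filter_upwards [hδ.germ] with x hx using poincare_integrand_germ hx
  have hres' : ∀ᶠ x in 𝓝 (0 : 𝕜 × H), ∀ v w : H, δ (0, x.2) (0, v) (0, w) = 0 :=
    (continuous_snd.tendsto (0 : 𝕜 × H)).eventually hres
  have hgood := ((hδ.germ.differentiableAt hr).and hδ.alt.eventually_nhds).and
    (hδ.closed.and (hcg.and (hcg.fderiv_right hr)))
  filter_upwards [hasFDerivAt_segmentAverage hr hcg, eventually_contraction (p := (0 : H)) hgood,
    hres'] with x hx hgx hresx v w
  have hcc : ∀ l : ℝ, l ∈ Icc (0 : ℝ) 1 → ContinuousAt c ((l : 𝕜) * x.1, x.2) := fun l hl =>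
    (hgx l hl).2.2.1.continuousAt
  have hcc' : ∀ l : ℝ, l ∈ Icc (0 : ℝ) 1 → ContinuousAt (fderiv 𝕜 c) ((l : 𝕜) * x.1, x.2) :=
    fun l hl => (hgx l hl).2.2.2.continuousAt
  set U : C(unitInterval, H →L[𝕜] 𝕜) := superpose unitInterval c (contraction 𝕜 H x) with hU
  set D : 𝕜 × H → C(unitInterval, H →L[𝕜] 𝕜) := fun v => pointwiseApply unitInterval
    (superpose unitInterval (fderiv 𝕜 c) (contraction 𝕜 H x)) (contraction 𝕜 H v) with hD
  have e1 : poincareCoeff δ x = primitive 𝕜 _ U 1 := rfl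
  have e2 : ∀ v, fderiv 𝕜 (poincareCoeff δ) x v = primitive 𝕜 _ (D v) 1 := by
    intro v
    have : fderiv 𝕜 (poincareCoeff δ) x = _ := hx.fderiv
    rw [this]
    rfl
  let ev : H → (H →L[𝕜] 𝕜) →L[𝕜] 𝕜 := fun w => ContinuousLinearMap.apply 𝕜 𝕜 w
  let T : H → C(unitInterval, H →L[𝕜] 𝕜) →L[𝕜] C(unitInterval, 𝕜) := fun w =>
    ContinuousLinearMap.compLeftContinuous 𝕜 unitInterval (ev w)
  have e3 : ∀ (u : C(unitInterval, H →L[𝕜] 𝕜)) (w : H),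
      (primitive 𝕜 _ u 1) w = primitive 𝕜 𝕜 (T w u) 1 := fun u w => map_primitive_one (ev w) u
  have e4 : (v.1 * primitive 𝕜 𝕜 (T w.2 U) 1 + x.1 * primitive 𝕜 𝕜 (T w.2 (D v)) 1)
      - (w.1 * primitive 𝕜 𝕜 (T v.2 U) 1 + x.1 * primitive 𝕜 𝕜 (T v.2 (D w)) 1)
      = primitive 𝕜 𝕜 ((v.1 • T w.2 U + x.1 • T w.2 (D v))
        - (w.1 • T v.2 U + x.1 • T v.2 (D w))) 1 := by
    simp only [map_sub, map_add, map_smul, ContinuousMap.sub_apply, ContinuousMap.add_apply,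
      ContinuousMap.smul_apply, smul_eq_mul]
  rw [e1, e2, e2, e3, e3, e3, e3, e4]
  have hline : ∀ (v : 𝕜 × H) (l : ℝ), HasDerivAt (fun l : ℝ => ((l : 𝕜) * v.1, v.2))
      (v.1, (0 : H)) l := by
    intro v l
    refine HasDerivAt.prodMk ?_ (hasDerivAt_const _ _)
    simpa using (RCLike.ofRealCLM (K := 𝕜)).hasDerivAt.mul_const v.1 (x := l)
  rw [primitive_superpose_eq (𝕜 := 𝕜) (f := fun l : ℝ =>
    δ ((l : 𝕜) * x.1, x.2) ((l : 𝕜) * v.1, v.2) ((l : 𝕜) * w.1, w.2))]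
  · simp [hresx]
  · intro l
    obtain ⟨⟨hd, ha⟩, hcl, -, -⟩ := hgx l l.2
    have ha0 := ha.self_of_nhds
    obtain ⟨L, hL, hLv⟩ := hasFDerivAt_bilin_apply hd (((l : ℝ) : 𝕜) * v.1, v.2)
      (((l : ℝ) : 𝕜) * w.1, w.2)
    have d5 := (hL.restrictScalars ℝ).comp_hasDerivAt (l : ℝ)
      ((hline x l).prodMk ((hline v l).prodMk (hline w l)))
    refine d5.congr_deriv ?_
    have e5 : ∀ w, T w U l = δ (((l : ℝ) : 𝕜) * x.1, x.2) (1, 0) (0, w) := by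
      intro w
      show (U l) w = _
      rw [hU, superpose_contraction_apply hcc]
      simp [hc]
    have e6 : ∀ v w, T w (D v) l = fderiv 𝕜 δ (((l : ℝ) : 𝕜) * x.1, x.2)
        (((l : ℝ) : 𝕜) * v.1, v.2) (1, 0) (0, w) := by
      intro v w
      show (D v l) w = _
      rw [hD]
      simp only [pointwiseApply_apply]
      rw [superpose_contraction_apply hcc', contraction_apply, hc, fderiv_poincare_integrand hd]
    simp only [ContinuousLinearMap.coe_restrictScalars', hLv, ContinuousMap.sub_apply,
      ContinuousMap.add_apply, ContinuousMap.smul_apply, smul_eq_mul, e5, e6]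
    have s1 : ∀ (a : 𝕜), ((a, 0) : 𝕜 × H) = a • (1, 0) := by intro a; simp
    have s2 : ∀ (a : 𝕜) (h : H), ((a, h) : 𝕜 × H) = a • (1, 0) + (0, h) := by intro a h; simp
    have a1 := hcl (1, 0) (((l : ℝ) : 𝕜) * v.1, v.2) (((l : ℝ) : 𝕜) * w.1, w.2)
    have a2 : ∀ u, fderiv 𝕜 δ (((l : ℝ) : 𝕜) * x.1, x.2) u (1, 0) (1, 0) = 0 := fun u =>
      fderiv_bilin_alt hd ha u _
    have a3 := bilin_swap ha0 (((l : ℝ) : 𝕜) * v.1, v.2) (1, 0)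
    have a4 : ∀ u (a : 𝕜) (h : H), fderiv 𝕜 δ (((l : ℝ) : 𝕜) * x.1, x.2) u (1, 0) (a, h)
        = fderiv 𝕜 δ (((l : ℝ) : 𝕜) * x.1, x.2) u (1, 0) (0, h) := by
      intro u a h
      rw [s2 a h, map_add, map_smul, a2]; simp
    have a5 : ∀ (a : 𝕜) (h : H), δ (((l : ℝ) : 𝕜) * x.1, x.2) (1, 0) (a, h)
        = δ (((l : ℝ) : 𝕜) * x.1, x.2) (1, 0) (0, h) := by
      intro a h
      rw [s2 a h, map_add, map_smul, ha0]; simp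
    rw [s1 x.1, s1 v.1, s1 w.1]
    simp only [map_smul, smul_apply, smul_eq_mul, a3]
    rw [a4 _ _ w.2, a4 _ _ v.2] at a1
    rw [a5 _ w.2, a5 _ v.2]
    linear_combination x.1 * a1

end Primitive

/-! ### Moser's method for forms degenerating on a hyperplane. -/

section Moser

lemma exists_dual_ne_zero {𝕜 E : Type} [RCLike 𝕜] [NormedAddCommGroup E] [NormedSpace 𝕜 E]
    {v : E} (hv : v ≠ 0) : ∃ ξ : E →L[𝕜] 𝕜, ξ v ≠ 0 := by
  obtain ⟨ξ, -, hξ⟩ := exists_dual_vector 𝕜 v (by simpa using hv)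
  exact ⟨ξ, by rw [hξ]; simpa using hv⟩

variable {𝕜 : Type} [RCLike 𝕜]
variable {r : WithTop ℕ∞}

/-- The derivatives of `κ₁` and `κ₂` are paired with kernel vectors and drop out, so the
differential of the Pfaffian factor involves only that of `b`. -/
lemma hasFDerivAt_pfaffian {E Y : Type} [NormedAddCommGroup E] [NormedSpace 𝕜 E]
    [NormedAddCommGroup Y] [NormedSpace 𝕜 Y] {b : Y → E →L[𝕜] E →L[𝕜] 𝕜} {y : Y}
    (hb : DifferentiableAt 𝕜 b y) (halt : ∀ v, b y v v = 0) {κ₁ κ₂ : Y → E}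
    (h₁ : DifferentiableAt 𝕜 κ₁ y) (h₂ : DifferentiableAt 𝕜 κ₂ y)
    (e₁ : b y (κ₁ y) = 0) (e₂ : b y (κ₂ y) = 0) (u : Y) :
    fderiv 𝕜 (fun y => b y (κ₁ y) (κ₂ y)) y u = fderiv 𝕜 b y u (κ₁ y) (κ₂ y) := by
  obtain ⟨L, hL, hLv⟩ := hasFDerivAt_bilin_apply hb (κ₁ y) (κ₂ y)
  have h := (hasFDerivAt_id (𝕜 := 𝕜) y).prodMk (h₁.hasFDerivAt.prodMk h₂.hasFDerivAt)
  have h' := HasFDerivAt.comp y (f := fun y => (y, κ₁ y, κ₂ y)) hL h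
  have e3 : ∀ x, b y x (κ₂ y) = 0 := fun x => by rw [bilin_swap halt, e₂]; simp
  have h'' : HasFDerivAt (fun y => b y (κ₁ y) (κ₂ y)) _ y := h'
  rw [h''.fderiv]
  simp only [ContinuousLinearMap.comp_apply, ContinuousLinearMap.prod_apply, hLv, e3, e₁]
  simp

lemma segmentAverage_zero {P F : Type} [NormedAddCommGroup P] [NormedSpace 𝕜 P]
    [NormedAddCommGroup F] [NormedSpace 𝕜 F] [NormedSpace ℝ F] [IsScalarTower ℝ 𝕜 F]
    [CompleteSpace F] {g : 𝕜 × P → F} {p : P}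
    (hg : ContinuousAt g (0, p)) : segmentAverage 𝕜 g (0, p) = g (0, p) := by
  have : superpose unitInterval g (contraction 𝕜 P (0, p))
      = ContinuousMap.const unitInterval (g (0, p)) := by
    ext1 l
    rw [superpose_contraction_apply]
    · simp
    · intro l _
      simpa using hg
  rw [segmentAverage, this, primitive_apply]
  have h1 : ∀ s, extendLine (ContinuousMap.const unitInterval (g (0, p))) s = g (0, p) :=
    fun s => rfl
  simp [h1]

lemma fderiv_sub_dir {E F : Type} [NormedAddCommGroup E] [NormedSpace 𝕜 E]
    [NormedAddCommGroup F] [NormedSpace 𝕜 F] {f g : E → F} {x : E} (hf : DifferentiableAt 𝕜 f x)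
    (hg : DifferentiableAt 𝕜 g x) (u : E) :
    fderiv 𝕜 (fun x => f x - g x) x u = fderiv 𝕜 f x u - fderiv 𝕜 g x u := by
  rw [(hf.hasFDerivAt.fun_sub hg.hasFDerivAt).fderiv]
  rfl

lemma IsClosedTwoForm.sub {E : Type} [NormedAddCommGroup E] [NormedSpace 𝕜 E]
    (hr : r = ∞ ∨ r = ω) {b₁ b₀ : E → E →L[𝕜] E →L[𝕜] 𝕜}
    (h₁ : IsClosedTwoForm r b₁) (h₀ : IsClosedTwoForm r b₀) :
    IsClosedTwoForm r (fun x => b₁ x - b₀ x) where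
  germ := by
    filter_upwards [h₀.germ, h₁.germ] with x x0 x1 using x1.sub x0
  alt := by
    filter_upwards [h₀.alt, h₁.alt] with x x0 x1 v
    simp [x0, x1]
  closed := by
    filter_upwards [h₀.closed, h₁.closed, h₀.germ.differentiableAt hr,
      h₁.germ.differentiableAt hr] with x c0 c1 x0 x1 u v w
    have h : ∀ u v w, fderiv 𝕜 (fun x => b₁ x - b₀ x) x u v w
        = fderiv 𝕜 b₁ x u v w - fderiv 𝕜 b₀ x u v w := fun u v w =>
      congrArg (fun A : E →L[𝕜] E →L[𝕜] 𝕜 => A v w) (fderiv_sub_dir x1 x0 u)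
    simp only [h]
    linear_combination c1 u v w - c0 u v w

/-- The linear path from `b₀` to `b₁`. -/
def linearPath {E F : Type} [AddCommGroup F] [Module 𝕜 F] (b₀ b₁ : E → F) (y : 𝕜 × E) : F :=
  b₀ y.2 + y.1 • (b₁ y.2 - b₀ y.2)

lemma linearPath_zero {E F : Type} [AddCommGroup F] [Module 𝕜 F] (b₀ b₁ : E → F) (x : E) :
    linearPath b₀ b₁ ((0 : 𝕜), x) = b₀ x := by simp [linearPath]

lemma linearPath_one {E F : Type} [AddCommGroup F] [Module 𝕜 F] (b₀ b₁ : E → F) (x : E) :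
    linearPath b₀ b₁ ((1 : 𝕜), x) = b₁ x := by simp [linearPath]

lemma linearPath_of_eq {E F : Type} [AddCommGroup F] [Module 𝕜 F] {b₀ b₁ : E → F} {x : E}
    (h : b₁ x = b₀ x) (s : 𝕜) : linearPath b₀ b₁ (s, x) = b₀ x := by simp [linearPath, h]

lemma linearPath_contDiffAt {E F : Type} [NormedAddCommGroup E] [NormedSpace 𝕜 E]
    [NormedAddCommGroup F] [NormedSpace 𝕜 F]
    {b₀ b₁ : E → F} {y : 𝕜 × E} (h₀ : ContDiffAt 𝕜 r b₀ y.2)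
    (h₁ : ContDiffAt 𝕜 r b₁ y.2) : ContDiffAt 𝕜 r (linearPath b₀ b₁) y := by
  have g₀ : ContDiffAt 𝕜 r (fun y : 𝕜 × E => b₀ y.2) y := h₀.comp y contDiffAt_snd
  have g₁ : ContDiffAt 𝕜 r (fun y : 𝕜 × E => b₁ y.2) y := h₁.comp y contDiffAt_snd
  exact g₀.add (contDiffAt_fst.smul (g₁.sub g₀))

lemma fderiv_linearPath {E F : Type} [NormedAddCommGroup E] [NormedSpace 𝕜 E]
    [NormedAddCommGroup F] [NormedSpace 𝕜 F]
    {b₀ b₁ : E → F} {y : 𝕜 × E} (h₀ : DifferentiableAt 𝕜 b₀ y.2)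
    (h₁ : DifferentiableAt 𝕜 b₁ y.2) (a : 𝕜) (u : E) :
    fderiv 𝕜 (linearPath b₀ b₁) y (a, u) = fderiv 𝕜 b₀ y.2 u
      + y.1 • (fderiv 𝕜 b₁ y.2 u - fderiv 𝕜 b₀ y.2 u) + a • (b₁ y.2 - b₀ y.2) := by
  have hs : HasFDerivAt (Prod.snd : 𝕜 × E → E) (ContinuousLinearMap.snd 𝕜 𝕜 E) y := hasFDerivAt_snd
  have hf : HasFDerivAt (Prod.fst : 𝕜 × E → 𝕜) (ContinuousLinearMap.fst 𝕜 𝕜 E) y := hasFDerivAt_fst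
  have g : ∀ b : E → F, DifferentiableAt 𝕜 b y.2 →
      HasFDerivAt (fun y : 𝕜 × E => b y.2)
        ((fderiv 𝕜 b y.2).comp (ContinuousLinearMap.snd 𝕜 𝕜 E)) y := fun b hb =>
    HasFDerivAt.comp y hb.hasFDerivAt hs
  have h := (g b₀ h₀).add (hf.smul ((g b₁ h₁).sub (g b₀ h₀)))
  change HasFDerivAt (linearPath b₀ b₁) _ y at h
  rw [h.fderiv]
  exact (add_assoc _ _ _).symm

lemma fderiv_linearPath_bilin {E G : Type} [NormedAddCommGroup E] [NormedSpace 𝕜 E]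
    [NormedAddCommGroup G] [NormedSpace 𝕜 G] {b₀ b₁ : E → G →L[𝕜] G →L[𝕜] 𝕜} {y : 𝕜 × E}
    (h₀ : DifferentiableAt 𝕜 b₀ y.2) (h₁ : DifferentiableAt 𝕜 b₁ y.2) (a : 𝕜) (u : E) (c d : G) :
    fderiv 𝕜 (linearPath b₀ b₁) y (a, u) c d = fderiv 𝕜 b₀ y.2 u c d
      + y.1 * (fderiv 𝕜 b₁ y.2 u c d - fderiv 𝕜 b₀ y.2 u c d) + a * (b₁ y.2 c d - b₀ y.2 c d) := by
  have h := fderiv_linearPath (F := G →L[𝕜] G →L[𝕜] 𝕜) h₀ h₁ a u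
  exact congrArg (fun A : G →L[𝕜] G →L[𝕜] 𝕜 => A c d) h

variable {H : Type} [NormedAddCommGroup H] [NormedSpace 𝕜 H]


/-- Moser's method on the infinitesimal level: the contraction equation implies that the Lie
derivative along the path `b₀ + s (b₁ - b₀)` vanishes. -/
lemma lie_eq_zero_of_contraction {b₀ b₁ : 𝕜 × H → (𝕜 × H) →L[𝕜] (𝕜 × H) →L[𝕜] 𝕜}
    {η : 𝕜 × (𝕜 × H) → (𝕜 × H) →L[𝕜] (𝕜 × H) →L[𝕜] 𝕜}
    {V : 𝕜 × (𝕜 × H) → 𝕜 × H} {γ : 𝕜 × H → H →L[𝕜] 𝕜} {y : 𝕜 × (𝕜 × H)}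
    (h₀ : DifferentiableAt 𝕜 b₀ y.2) (h₁ : DifferentiableAt 𝕜 b₁ y.2)
    (hV : DifferentiableAt 𝕜 V y) (hγ : DifferentiableAt 𝕜 γ y.2)
    (halt₀ : ∀ᶠ x in 𝓝 y.2, ∀ v, b₀ x v v = 0) (halt₁ : ∀ᶠ x in 𝓝 y.2, ∀ v, b₁ x v v = 0)
    (hcl₀ : ∀ u v w, fderiv 𝕜 b₀ y.2 u v w - fderiv 𝕜 b₀ y.2 v u w + fderiv 𝕜 b₀ y.2 w u v = 0)
    (hcl₁ : ∀ u v w, fderiv 𝕜 b₁ y.2 u v w - fderiv 𝕜 b₁ y.2 v u w + fderiv 𝕜 b₁ y.2 w u v = 0)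
    (hδ : ∀ v w : 𝕜 × H, (v.1 * γ y.2 w.2 + y.2.1 * fderiv 𝕜 γ y.2 v w.2)
      - (w.1 * γ y.2 v.2 + y.2.1 * fderiv 𝕜 γ y.2 w v.2) = b₁ y.2 v w - b₀ y.2 v w)
    (hηd : DifferentiableAt 𝕜 η y) (haltη : ∀ v, η y v v = 0)
    (hD : ∀ a u c d, fderiv 𝕜 η y (a, u) c d = fderiv 𝕜 b₀ y.2 u c d
      + y.1 * (fderiv 𝕜 b₁ y.2 u c d - fderiv 𝕜 b₀ y.2 u c d) + a * (b₁ y.2 c d - b₀ y.2 c d))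
    (hc : ∀ᶠ y in 𝓝 y, ∀ w, η y (V y) w = -(y.2.1 * γ y.2 w.2)) (v w : 𝕜 × H) :
    fderiv 𝕜 η y (1, V y) v w + η y (fderiv 𝕜 V y (0, v)) w + η y v (fderiv 𝕜 V y (0, w)) = 0 := by
  have hs : HasFDerivAt (Prod.snd : 𝕜 × (𝕜 × H) → 𝕜 × H)
    (ContinuousLinearMap.snd 𝕜 𝕜 (𝕜 × H)) y := hasFDerivAt_snd
  -- This is the contraction equation differentiated in the direction `v`. Antisymmetrised in `v`,
  -- `w` and combined with closedness it gives Cartan's formula L_V η = d(V⌟η) = -d(tγ), which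
  -- cancels the derivative of the path in `s`.
  have key : ∀ v w, fderiv 𝕜 η y (0, v) (V y) w + η y (fderiv 𝕜 V y (0, v)) w
      = -(v.1 * γ y.2 w.2 + y.2.1 * fderiv 𝕜 γ y.2 v w.2) := by
    intro v w
    obtain ⟨L, hL, hLv⟩ := hasFDerivAt_bilin_apply hηd (V y) w
    have e1 : HasFDerivAt (fun y => η y (V y) w) _ y :=
      HasFDerivAt.comp y (f := fun y => (y, V y, w)) hL
      ((hasFDerivAt_id (𝕜 := 𝕜) y).prodMk (hV.hasFDerivAt.prodMk (hasFDerivAt_const w y)))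
    have e2 : HasFDerivAt (fun y : 𝕜 × (𝕜 × H) => γ y.2)
        ((fderiv 𝕜 γ y.2).comp (ContinuousLinearMap.snd 𝕜 𝕜 (𝕜 × H))) y :=
      HasFDerivAt.comp (g := γ) y hγ.hasFDerivAt hs
    have e3 : HasFDerivAt (fun y : 𝕜 × (𝕜 × H) => -(y.2.1 * γ y.2 w.2)) _ y :=
      ((HasFDerivAt.comp y (hasFDerivAt_fst (p := y.2)) hs).mul
        (e2.clm_apply (hasFDerivAt_const w.2 y))).neg
    have e4 : (fun y => η y (V y) w) =ᶠ[𝓝 y] fun y => -(y.2.1 * γ y.2 w.2) := by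
      filter_upwards [hc] with y hy using hy w
    have e5 := congrArg (fun A : 𝕜 × (𝕜 × H) →L[𝕜] 𝕜 => A (0, v))
      (e1.unique (e3.congr_of_eventuallyEq e4))
    simp only [ContinuousLinearMap.comp_apply, ContinuousLinearMap.prod_apply, hLv] at e5
    simp at e5
    linear_combination e5
  have s₀ := fun u => bilin_swap (fderiv_bilin_alt h₀ halt₀ u)
  have s₁ := fun u => bilin_swap (fderiv_bilin_alt h₁ halt₁ u)
  have k1 := key v w
  have k2 := key w v
  rw [hD] at k1 k2
  rw [hD, bilin_swap haltη v]
  have := hδ v w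
  have c0 := hcl₀ (V y) v w
  have c1 := hcl₁ (V y) v w
  linear_combination k1 - k2 + c0 + y.1 * (c1 - c0) - this

variable [NormedSpace ℝ H] [IsScalarTower ℝ 𝕜 H] [FiniteDimensional 𝕜 H]

/-- The equation to solve is V⌟η_s = -tγ. The operator `R` inverts η_s up to the Pfaffian factor,
and by the degeneracy and derivative hypotheses this factor is t times a unit, so the t on the right
absorbs it. -/
theorem bilinEquivalent_linearPath (hr : r = ∞ ∨ r = ω)
    {b₀ b₁ : 𝕜 × H → (𝕜 × H) →L[𝕜] (𝕜 × H) →L[𝕜] 𝕜}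
    (h₀ : IsClosedTwoForm r b₀) (h₁ : IsClosedTwoForm r b₁)
    (hres : ∀ᶠ q in 𝓝 (0 : H), ∀ v w : H, b₁ (0, q) (0, v) (0, w) = b₀ (0, q) (0, v) (0, w))
    (h00 : b₁ 0 = b₀ 0) {k₁ k₂ : 𝕜 × H}
    (hk : ∀ v, b₀ 0 v = 0 ↔ v ∈ Submodule.span 𝕜 {k₁, k₂})
    (hind : LinearIndependent 𝕜 ![k₁, k₂])
    (hdeg : ∀ᶠ q in 𝓝 (0 : H), ∀ s : 𝕜, ∃ v, v ≠ 0 ∧ linearPath b₀ b₁ (s, (0, q)) v = 0)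
    (hd0 : fderiv 𝕜 b₀ 0 (1, 0) k₁ k₂ ≠ 0)
    (hd1 : fderiv 𝕜 b₁ 0 (1, 0) k₁ k₂ = fderiv 𝕜 b₀ 0 (1, 0) k₁ k₂) (s₀ : 𝕜) :
    ∀ᶠ ε in 𝓝 (0 : 𝕜), BilinEquivalent r (fun x => linearPath b₀ b₁ (s₀, x))
      (fun x => linearPath b₀ b₁ (s₀ + ε, x)) := by
  have hrp : r ≠ 0 := by rcases hr with rfl | rfl <;> simp
  have : CompleteSpace H := FiniteDimensional.complete 𝕜 H
  set η : 𝕜 × (𝕜 × H) → (𝕜 × H) →L[𝕜] (𝕜 × H) →L[𝕜] 𝕜 := linearPath b₀ b₁ with hη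
  have hη0 : ∀ s, η (s, 0) = b₀ 0 := fun s => linearPath_of_eq h00 s
  have hsnd : Tendsto (Prod.snd : 𝕜 × (𝕜 × H) → 𝕜 × H) (𝓝 (s₀, 0)) (𝓝 0) :=
    continuous_snd.tendsto (s₀, (0 : 𝕜 × H))
  have hηg : GermAt 𝕜 r η (s₀, 0) := by
    filter_upwards [hsnd.eventually h₀.germ, hsnd.eventually h₁.germ] with y g₀ g₁
    exact linearPath_contDiffAt g₀ g₁
  obtain ⟨κ₁, κ₂, R, hκ₁, hκ₂, hR, hR0, e₁, e₂, hframe⟩ :=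
    exists_schur_frame h₀.alt.self_of_nhds hk hind r
  have hδ : IsClosedTwoForm r (fun x => b₁ x - b₀ x) := h₁.sub hr h₀
  have hδres : ∀ᶠ q in 𝓝 (0 : H), ∀ v w : H, (b₁ (0, q) - b₀ (0, q)) (0, v) (0, w) = 0 := by
    filter_upwards [hres] with q hq v w
    simp [hq]
  set γ := poincareCoeff (fun x => b₁ x - b₀ x) with hγ
  have hγ0 : γ 0 = 0 := poincareCoeff_zero (sub_eq_zero.2 h00) hδ.germ.self_of_nhds.continuousAt
  have hγg : GermAt 𝕜 r γ 0 := poincareCoeff_germ hr hδ.germ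
  have hγs := poincareCoeff_spec hr hδ hδres
  -- the exchange of the coordinates `s` and `t`
  let τ : 𝕜 × (𝕜 × H) →L[𝕜] 𝕜 × (𝕜 × H) :=
    ((ContinuousLinearMap.fst 𝕜 𝕜 H).comp (ContinuousLinearMap.snd 𝕜 𝕜 (𝕜 × H))).prod
      ((ContinuousLinearMap.fst 𝕜 𝕜 (𝕜 × H)).prod
        ((ContinuousLinearMap.snd 𝕜 𝕜 H).comp (ContinuousLinearMap.snd 𝕜 𝕜 (𝕜 × H))))
  have hτ : ∀ a b c, τ (a, b, c) = (b, a, c) := fun a b c => rfl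
  have hτg : ∀ p, GermAt 𝕜 r τ p := fun p => Eventually.of_forall fun x => τ.contDiff.contDiffAt
  have hητ : GermAt 𝕜 r (fun z => η (τ z)) (0, s₀, 0) := GermAt.comp (g := η) hηg (hτg _)
  have hητ0 : η (τ (0, s₀, 0)) = b₀ 0 := hη0 s₀
  have c₁ : GermAt 𝕜 r (fun z => κ₁ (η (τ z))) (0, s₀, 0) :=
    GermAt.comp (f := fun z => η (τ z)) (by rw [hητ0]; exact hκ₁) hητ
  have c₂ : GermAt 𝕜 r (fun z => κ₂ (η (τ z))) (0, s₀, 0) :=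
    GermAt.comp (f := fun z => η (τ z)) (by rw [hητ0]; exact hκ₂) hητ
  set g : 𝕜 × (𝕜 × H) → 𝕜 := fun z => η (τ z) (κ₁ (η (τ z))) (κ₂ (η (τ z))) with hg
  have hgg : GermAt 𝕜 r g (0, s₀, 0) := by
    filter_upwards [hητ, c₁, c₂] with z x1 x2 x3 using (x1.clm_apply x2).clm_apply x3
  set μ := segmentAverage 𝕜 (fun y => fderiv 𝕜 g y (1, 0)) with hμ
  have hdg : GermAt 𝕜 r (fun y => fderiv 𝕜 g y (1, 0)) (0, s₀, 0) := by
    filter_upwards [hgg.fderiv_right hr] with y hy using hy.clm_apply contDiffAt_const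
  have hμg : GermAt 𝕜 r μ (0, s₀, 0) := germAt_segmentAverage hr hdg
  -- By `hd1` the normal derivative on `k₁`, `k₂` is constant along the path, so the unit factor is
  -- nonzero at every `s₀`, not only at the endpoints.
  have hμ0 : μ (0, s₀, 0) ≠ 0 := by
    have m1 : μ (0, s₀, 0) = fderiv 𝕜 g (0, s₀, 0) (1, 0) :=
      segmentAverage_zero hdg.self_of_nhds.continuousAt
    have m2 := hasFDerivAt_pfaffian (b := fun z => η (τ z)) (y := (0, s₀, 0))
      (κ₁ := fun z => κ₁ (η (τ z))) (κ₂ := fun z => κ₂ (η (τ z)))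
      (hητ.self_of_nhds.differentiableAt hrp)
      (by simp only [hητ0]; exact h₀.alt.self_of_nhds)
      (c₁.self_of_nhds.differentiableAt hrp) (c₂.self_of_nhds.differentiableAt hrp)
      (by simp only [hητ0, e₁]; exact (hk _).2 (Submodule.subset_span (by simp)))
      (by simp only [hητ0, e₂]; exact (hk _).2 (Submodule.subset_span (by simp))) (1, 0)
    have m3 : fderiv 𝕜 (fun z => η (τ z)) (0, s₀, 0) (1, 0) k₁ k₂ = fderiv 𝕜 b₀ 0 (1, 0) k₁ k₂ := by
      have := HasFDerivAt.comp (0, s₀, (0 : H)) (g := η) (f := τ)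
        (hηg.self_of_nhds.differentiableAt hrp).hasFDerivAt τ.hasFDerivAt
      change HasFDerivAt (fun z => η (τ z)) _ _ at this
      rw [this.fderiv, ContinuousLinearMap.comp_apply]
      have := fderiv_linearPath_bilin (y := (s₀, 0)) (h₀.germ.self_of_nhds.differentiableAt hrp)
        (h₁.germ.self_of_nhds.differentiableAt hrp) (0 : 𝕜) (1, 0) k₁ k₂
      rw [hd1, sub_self, mul_zero, add_zero, zero_mul, add_zero] at this
      exact this
    rw [m1, m2]
    simp only [hητ0, e₁, e₂]
    rw [m3]
    exact hd0
  have hμd : ∀ᶠ z in 𝓝 ((0 : 𝕜), s₀, (0 : H)), g z - g (0, z.2) = z.1 • μ z := hadamard_division hr hgg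
  have hτt : Tendsto τ (𝓝 (s₀, 0, (0 : H))) (𝓝 (0, s₀, (0 : H))) :=
    τ.continuous.tendsto (s₀, 0, (0 : H))
  have hηalt : ∀ᶠ y in 𝓝 (s₀, (0 : 𝕜 × H)), ∀ v, η y v v = 0 := by
    filter_upwards [hsnd.eventually h₀.alt, hsnd.eventually h₁.alt] with y a₀ a₁ v
    change b₀ y.2 v v + y.1 * (b₁ y.2 v v - b₀ y.2 v v) = 0
    rw [a₀, a₁]; ring
  have hηt : Tendsto η (𝓝 (s₀, 0)) (𝓝 (b₀ 0)) := by
    have := hηg.self_of_nhds.continuousAt.tendsto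
    rwa [hη0] at this
  have hηframe := hηt.eventually hframe
  -- A nonzero kernel vector `v` makes the left side of η(Rξ, v) = g ξ(v) vanish; a covector with
  -- ξ(v) ≠ 0 then forces g = 0.
  have hg0 : ∀ᶠ z in 𝓝 ((0 : 𝕜), s₀, (0 : H)), g (0, z.2) = 0 := by
    have hp : Tendsto (fun z : 𝕜 × 𝕜 × H => ((z.2.1, 0, z.2.2) : 𝕜 × 𝕜 × H))
        (𝓝 (0, s₀, 0)) (𝓝 (s₀, 0, 0)) := by
      refine Continuous.tendsto' (by fun_prop) _ _ rfl
    have hq : Tendsto (fun z : 𝕜 × 𝕜 × H => z.2.2) (𝓝 (0, s₀, 0)) (𝓝 0) :=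
      Continuous.tendsto' (by fun_prop) _ _ rfl
    filter_upwards [hp.eventually hηframe, hp.eventually hηalt, hq.eventually hdeg]
      with z f1 a1 d1
    obtain ⟨v, hv, hv0⟩ := d1 z.2.1
    obtain ⟨ξ, hξ⟩ := exists_dual_ne_zero (𝕜 := 𝕜) hv
    have f2 := (f1 a1).1 ξ v
    rw [bilin_swap a1] at f2
    have hv0' : η (z.2.1, 0, z.2.2) v = 0 := hv0
    rw [hv0'] at f2
    rw [zero_apply, neg_zero] at f2
    exact (mul_eq_zero.1 f2.symm).resolve_right hξ
  set V : 𝕜 × (𝕜 × H) → 𝕜 × H := fun y =>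
    -((μ (τ y))⁻¹ • R (η y, (γ y.2).comp (ContinuousLinearMap.snd 𝕜 𝕜 H))) with hV
  have hμτ : ∀ᶠ y in 𝓝 (s₀, (0 : 𝕜 × H)), μ (τ y) ≠ 0 :=
    (hτt.eventually (hμg.self_of_nhds.continuousAt.eventually_ne hμ0))
  have hξg : GermAt 𝕜 r (fun y : 𝕜 × (𝕜 × H) =>
      (γ y.2).comp (ContinuousLinearMap.snd 𝕜 𝕜 H)) (s₀, 0) := by
    filter_upwards [hsnd.eventually hγg] with y hy
    exact ContDiffAt.clm_comp (hy.comp y contDiffAt_snd) contDiffAt_const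
  have hVg : GermAt 𝕜 r V (s₀, 0) := by
    have hRg : GermAt 𝕜 r (fun y : 𝕜 × (𝕜 × H) =>
        R (η y, (γ y.2).comp (ContinuousLinearMap.snd 𝕜 𝕜 H))) (s₀, 0) := by
      refine GermAt.comp (f := fun y : 𝕜 × (𝕜 × H) =>
        (η y, (γ y.2).comp (ContinuousLinearMap.snd 𝕜 𝕜 H))) (g := R) ?_ ?_
      · rw [hη0]; exact hR _
      · filter_upwards [hηg, hξg] with y x1 x2 using x1.prodMk x2
    have hμτg : GermAt 𝕜 r (fun y => μ (τ y)) (s₀, 0) := GermAt.comp (g := μ) hμg (hτg _)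
    filter_upwards [hRg, hμτg, hμτ] with y x1 x2 x3
    exact ((x2.inv x3).smul x1).neg
  refine bilinEquivalent_of_lie_eq_zero hr hVg hηg ?_ ?_
  · refine Eventually.of_forall fun s => ?_
    simp [hV, hγ0, hR0]
  · have hc : ∀ᶠ y in 𝓝 (s₀, (0 : 𝕜 × H)), ∀ w, η y (V y) w = -(y.2.1 * γ y.2 w.2) := by
      filter_upwards [hηframe, hηalt, hμτ, hτt.eventually hμd, hτt.eventually hg0]
        with y x1 x2 x3 x4 x5 w
      rw [x5, sub_zero] at x4
      have x6 := (x1 x2).1 ((γ y.2).comp (ContinuousLinearMap.snd 𝕜 𝕜 H)) w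
      have x7 : η y (κ₁ (η y)) (κ₂ (η y)) = y.2.1 * μ (τ y) := x4
      rw [x7] at x6
      simp only [hV, map_neg, map_smul, neg_apply, smul_apply, x6, smul_eq_mul]
      simp only [ContinuousLinearMap.comp_apply, ContinuousLinearMap.coe_snd']
      field_simp
    filter_upwards [hc.eventually_nhds, hVg.differentiableAt hr,
      hsnd.eventually (h₀.germ.differentiableAt hr), hsnd.eventually (h₁.germ.differentiableAt hr),
      hsnd.eventually (hγg.differentiableAt hr), hsnd.eventually h₀.alt.eventually_nhds,
      hsnd.eventually h₁.alt.eventually_nhds, hsnd.eventually h₀.closed,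
      hsnd.eventually h₁.closed, hsnd.eventually hγs, hηalt, hηg.differentiableAt hr] with
      y x1 x2 x3 x4 x5 x6 x7 x8 x9 x10 x11 x12
    refine lie_eq_zero_of_contraction x3 x4 x2 x5 x6 x7 x8 x9 x10
      x12 x11 (fderiv_linearPath_bilin x3 x4) x1

/-- Moser's theorem for forms which degenerate along `{t = 0}`. -/
theorem bilinEquivalent_of_eq_on_hyperplane (hr : r = ∞ ∨ r = ω)
    {b₀ b₁ : 𝕜 × H → (𝕜 × H) →L[𝕜] (𝕜 × H) →L[𝕜] 𝕜}
    (h₀ : IsClosedTwoForm r b₀) (h₁ : IsClosedTwoForm r b₁)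
    (hres : ∀ᶠ q in 𝓝 (0 : H), ∀ v w : H, b₁ (0, q) (0, v) (0, w) = b₀ (0, q) (0, v) (0, w))
    (h00 : b₁ 0 = b₀ 0) {k₁ k₂ : 𝕜 × H}
    (hk : ∀ v, b₀ 0 v = 0 ↔ v ∈ Submodule.span 𝕜 {k₁, k₂})
    (hind : LinearIndependent 𝕜 ![k₁, k₂])
    (hdeg : ∀ᶠ q in 𝓝 (0 : H), ∀ s : 𝕜, ∃ v, v ≠ 0 ∧ linearPath b₀ b₁ (s, (0, q)) v = 0)
    (hd0 : fderiv 𝕜 b₀ 0 (1, 0) k₁ k₂ ≠ 0)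
    (hd1 : fderiv 𝕜 b₁ 0 (1, 0) k₁ k₂ = fderiv 𝕜 b₀ 0 (1, 0) k₁ k₂) :
    BilinEquivalent r b₀ b₁ := by
  set A : 𝕜 → Prop := fun s => BilinEquivalent r b₀ (fun x => linearPath b₀ b₁ (s, x)) with hA
  have hloc : ∀ s₀, ∀ᶠ s in 𝓝 s₀, A s ↔ A s₀ := by
    intro s₀
    have h := bilinEquivalent_linearPath hr h₀ h₁ hres h00 hk hind hdeg hd0 hd1 s₀
    have ht : Tendsto (fun s => s - s₀) (𝓝 s₀) (𝓝 0) :=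
      Continuous.tendsto' (by fun_prop) _ _ (by simp)
    filter_upwards [ht.eventually h] with s hs
    rw [add_sub_cancel] at hs
    exact ⟨fun h => h.trans hr (hs.symm hr), fun h => h.trans hr hs⟩
  -- Equivalence to the nearby forms of the path makes the set of good parameters both open and
  -- closed, so no flow has to exist for a full unit of time.
  have hclopen : IsClopen {s | A s} := by
    refine ⟨⟨isOpen_iff_mem_nhds.2 fun s hs => ?_⟩, isOpen_iff_mem_nhds.2 fun s hs => ?_⟩
    · filter_upwards [hloc s] with s' hs' h using hs (hs'.1 h)
    · filter_upwards [hloc s] with s' hs' using hs'.2 hs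
  have : PreconnectedSpace 𝕜 :=
    ⟨(convex_univ (𝕜 := ℝ) (E := 𝕜)).isPreconnected⟩
  have h0 : (0 : 𝕜) ∈ {s | A s} := by
    simpa only [hA, mem_ofPred_eq, linearPath_zero] using BilinEquivalent.refl b₀
  have h1 : (1 : 𝕜) ∈ {s | A s} := by
    rw [hclopen.eq_univ ⟨0, h0⟩]; trivial
  simpa only [hA, mem_ofPred_eq, linearPath_one] using h1

end Moser

/-! ### Powers of a two-form and their kernels. -/

section WedgeAlgebra

variable {𝕜 V V' : Type} [RCLike 𝕜] [AddCommGroup V] [Module 𝕜 V] [AddCommGroup V'] [Module 𝕜 V']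

/-- The sum over shuffles is replaced by a normalised sum over all permutations, whose terms can be
pulled back, differentiated and tested for vanishing one by one. -/
lemma wedge_apply {p q : ℕ} (a : V [⋀^Fin p]→ₗ[𝕜] 𝕜) (b : V [⋀^Fin q]→ₗ[𝕜] 𝕜)
    (v : Fin (p + q) → V) : wedge a b v = ((p.factorial * q.factorial : ℕ) : 𝕜)⁻¹ *
      ∑ s : Equiv.Perm (Fin p ⊕ Fin q), ((Equiv.Perm.sign s : ℤ) : 𝕜) *
        (a (fun i => v (finSumFinEquiv (s (Sum.inl i)))) *
          b (fun j => v (finSumFinEquiv (s (Sum.inr j))))) := by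
  have h := congrArg (fun f => LinearMap.mul' 𝕜 𝕜 (f (fun i => v (finSumFinEquiv i))))
    (MultilinearMap.domCoprod_alternization_eq a b)
  simp only [MultilinearMap.alternatization_apply, AlternatingMap.smul_apply, map_sum,
    Fintype.card_fin, map_nsmul] at h
  have h2 : ((p.factorial * q.factorial : ℕ) : 𝕜) ≠ 0 := by
    exact_mod_cast (Nat.mul_pos p.factorial_pos q.factorial_pos).ne'
  rw [eq_inv_mul_iff_mul_eq₀ h2, ← nsmul_eq_mul]
  refine Eq.trans h.symm (Finset.sum_congr rfl fun s _ => ?_)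
  rw [Units.smul_def, map_zsmul, zsmul_eq_mul]
  rfl

lemma wedge_compLinearMap {p q : ℕ} (a : V [⋀^Fin p]→ₗ[𝕜] 𝕜) (b : V [⋀^Fin q]→ₗ[𝕜] 𝕜)
    (L : V' →ₗ[𝕜] V) : wedge (a.compLinearMap L) (b.compLinearMap L)
      = (wedge a b).compLinearMap L := by
  ext v
  simp only [wedge_apply, AlternatingMap.compLinearMap_apply]

lemma wedgePow_compLinearMap (η : V [⋀^Fin 2]→ₗ[𝕜] 𝕜) (L : V' →ₗ[𝕜] V) (k : ℕ) :
    wedgePow (η.compLinearMap L) k = (wedgePow η k).compLinearMap L := by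
  induction k with
  | zero => rfl
  | succ k ih => rw [wedgePow, ih, wedge_compLinearMap]; rfl

lemma formKernel_inf_le_wedge {p q : ℕ} (a : V [⋀^Fin p]→ₗ[𝕜] 𝕜) (b : V [⋀^Fin q]→ₗ[𝕜] 𝕜) :
    formKernel a ⊓ formKernel b ≤ formKernel (wedge a b) := by
  rintro v ⟨ha, hb⟩ w i
  rw [wedge_apply]
  refine mul_eq_zero_of_right _ (Finset.sum_eq_zero fun s _ => mul_eq_zero_of_right _ ?_)
  obtain ⟨j, rfl⟩ := finSumFinEquiv.surjective i
  obtain ⟨j, rfl⟩ := s.surjective j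
  rcases j with j | j
  · refine mul_eq_zero_of_left ?_ _
    have := ha (fun i => w (finSumFinEquiv (s (Sum.inl i)))) j
    convert this using 2
    ext1 i
    by_cases hij : i = j
    · subst hij; simp
    · simp [Function.update_of_ne, hij]
  · refine mul_eq_zero_of_right _ ?_
    have := hb (fun i => w (finSumFinEquiv (s (Sum.inr i)))) j
    convert this using 2
    ext1 i
    by_cases hij : i = j
    · subst hij; simp
    · simp [Function.update_of_ne, hij]

lemma formKernel_le_wedgePow (η : V [⋀^Fin 2]→ₗ[𝕜] 𝕜) (k : ℕ) :
    formKernel η ≤ formKernel (wedgePow η k) := by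
  induction k with
  | zero => exact fun v _ w i => i.elim0
  | succ k ih => exact fun v hv => formKernel_inf_le_wedge _ _ ⟨ih hv, hv⟩

lemma pair_swap (η : V [⋀^Fin 2]→ₗ[𝕜] 𝕜) (v w : V) : η ![v, w] = -η ![w, v] := by
  have := η.map_swap ![w, v] (show (0 : Fin 2) ≠ 1 by decide)
  rw [← this]
  congr 1
  ext1 i
  fin_cases i <;> simp

lemma pair_add (η : V [⋀^Fin 2]→ₗ[𝕜] 𝕜) (v v' w : V) :
    η ![v + v', w] = η ![v, w] + η ![v', w] := η.map_vecCons_add _ _ _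

lemma pair_smul (η : V [⋀^Fin 2]→ₗ[𝕜] 𝕜) (c : 𝕜) (v w : V) :
    η ![c • v, w] = c * η ![v, w] := η.map_vecCons_smul _ _ _

lemma pair_add_right (η : V [⋀^Fin 2]→ₗ[𝕜] 𝕜) (v w w' : V) :
    η ![v, w + w'] = η ![v, w] + η ![v, w'] := by
  rw [pair_swap, pair_add, pair_swap η w, pair_swap η w']; ring

lemma pair_smul_right (η : V [⋀^Fin 2]→ₗ[𝕜] 𝕜) (c : 𝕜) (v w : V) :
    η ![v, c • w] = c * η ![v, w] := by
  rw [pair_swap, pair_smul, pair_swap η w]; ring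

lemma pair_self (η : V [⋀^Fin 2]→ₗ[𝕜] 𝕜) (v : V) : η ![v, v] = 0 :=
  η.map_eq_zero_of_eq _ (i := 0) (j := 1) rfl (by decide)

lemma vec_two {X : Type} (v : Fin 2 → X) : v = ![v 0, v 1] := by
  ext1 i; fin_cases i <;> rfl

lemma mem_formKernel_two {η : V [⋀^Fin 2]→ₗ[𝕜] 𝕜} {v : V} :
    v ∈ formKernel η ↔ ∀ w, η ![v, w] = 0 := by
  constructor
  · intro h w
    have := h ![w, w] 0
    convert this using 2
    rw [vec_two (Function.update _ _ _)]
    simp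
  · intro h w i
    rw [vec_two (Function.update _ _ _)]
    fin_cases i
    · simpa using h _
    · rw [pair_swap]; simpa using h _

/-- The bilinear form of a `2`-form. -/
def pairing (η : V [⋀^Fin 2]→ₗ[𝕜] 𝕜) : V →ₗ[𝕜] V →ₗ[𝕜] 𝕜 :=
  LinearMap.mk₂ 𝕜 (fun v w => η ![v, w]) (pair_add η) (pair_smul η) (pair_add_right η)
    (pair_smul_right η)

lemma pairing_apply (η : V [⋀^Fin 2]→ₗ[𝕜] 𝕜) (v w : V) : pairing η v w = η ![v, w] := rfl

/-- A linear form which vanishes on the kernel of an alternating form is a contraction of it. -/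
lemma exists_contraction_eq [FiniteDimensional 𝕜 V] (B : V →ₗ[𝕜] V →ₗ[𝕜] 𝕜)
    (hB : ∀ v, B v v = 0) (ξ : V →ₗ[𝕜] 𝕜) (hξ : ∀ v, B v = 0 → ξ v = 0) : ∃ h, B h = ξ := by
  -- The range of `B` is its own double annihilator, and since `B` is alternating the vectors
  -- annihilated by its range are exactly its kernel.
  have h1 : ξ ∈ (LinearMap.range B).dualCoannihilator.dualAnnihilator := by
    rw [Submodule.mem_dualAnnihilator]
    intro w hw
    rw [Submodule.mem_dualCoannihilator] at hw
    refine hξ w (LinearMap.ext fun v => ?_)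
    have h2 := hw (B v) ⟨v, rfl⟩
    have h3 := hB (v + w)
    simp only [map_add, LinearMap.add_apply, hB, h2] at h3
    simpa using h3
  rwa [Subspace.dualCoannihilator_dualAnnihilator_eq] at h1

/-- Some `w i` occurs in `v` with nonzero coefficient; replacing `w i` by `v` multiplies `g w` by
that coefficient. -/
lemma eq_zero_of_mem_formKernel {ι : Type} [Fintype ι] [DecidableEq ι] {g : V [⋀^ι]→ₗ[𝕜] 𝕜}
    {w : ι → V} {v : V} (hv : v ≠ 0) (hmem : v ∈ Submodule.span 𝕜 (range w))
    (hk : ∀ i, g (Function.update w i v) = 0) : g w = 0 := by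
  obtain ⟨c, rfl⟩ := (Submodule.mem_span_range_iff_exists_fun 𝕜).1 hmem
  obtain ⟨i, hi⟩ : ∃ i, c i ≠ 0 := by
    by_contra! h
    exact hv (by simp [h])
  have h1 := hk i
  rw [g.map_update_sum, Finset.sum_eq_single i] at h1
  · rw [g.map_update_smul, Function.update_eq_self] at h1
    exact (smul_eq_zero.1 h1).resolve_left hi
  · intro j _ hj
    rw [g.map_update_smul, g.map_update_self _ (Ne.symm hj), smul_zero]
  · simp

/-- The powers of a `2`-form with a large kernel vanish. -/
lemma wedgePow_eq_zero [FiniteDimensional 𝕜 V] (η : V [⋀^Fin 2]→ₗ[𝕜] 𝕜) (k : ℕ)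
    (h : Module.finrank 𝕜 V < 2 * k + Module.finrank 𝕜 (formKernel η)) : wedgePow η k = 0 := by
  ext w
  by_cases hw : LinearIndependent 𝕜 w
  · have h1 : Module.finrank 𝕜 (Submodule.span 𝕜 (range w)) = 2 * k := by
      rw [finrank_span_eq_card hw, Fintype.card_fin]
    have h2 : Submodule.span 𝕜 (range w) ⊓ formKernel η ≠ ⊥ := by
      intro h0
      have h3 := Submodule.finrank_sup_add_finrank_inf_eq (Submodule.span 𝕜 (range w))
        (formKernel η)
      have h4 := Submodule.finrank_le (Submodule.span 𝕜 (range w) ⊔ formKernel η)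
      rw [h0, finrank_bot] at h3
      omega
    obtain ⟨v, hv, hv0⟩ := Submodule.exists_mem_ne_zero_of_ne_bot h2
    exact eq_zero_of_mem_formKernel hv0 hv.1 fun i => formKernel_le_wedgePow η k hv.2 w i
  · exact (wedgePow η k).map_linearDependent w hw

/-- The transvections `x ↦ x + c η(x, u) u` preserve `η`, hence also the kernel of its power. A
vector `v` of that kernel outside the kernel of `η` is moved along every `u` with η(v, u) ≠ 0, and
such `u` span the whole space. -/
lemma formKernel_wedgePow_dichotomy (η : V [⋀^Fin 2]→ₗ[𝕜] 𝕜) (k : ℕ) :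
    formKernel (wedgePow η k) = formKernel η ∨ formKernel (wedgePow η k) = ⊤ := by
  by_cases h : formKernel (wedgePow η k) ≤ formKernel η
  · exact Or.inl (le_antisymm h (formKernel_le_wedgePow η k))
  right
  obtain ⟨v, hv, hv'⟩ := SetLike.not_le_iff_exists.1 h
  rw [mem_formKernel_two] at hv'
  push Not at hv'
  obtain ⟨u₀, hu₀⟩ := hv'
  have hinv : ∀ (T T' : V →ₗ[𝕜] V), T.comp T' = LinearMap.id → η.compLinearMap T = η →
      T v ∈ formKernel (wedgePow η k) := by
    intro T T' hT hη w i
    have h1 := hv (T' ∘ w) i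
    rw [← hη, wedgePow_compLinearMap, AlternatingMap.compLinearMap_apply] at h1
    convert h1 using 2
    ext1 j
    by_cases hj : j = i
    · subst hj; simp
    · simp only [Function.update_of_ne hj, Function.comp_apply]
      exact (LinearMap.congr_fun hT (w j)).symm
  have key : ∀ u, η ![v, u] ≠ 0 → u ∈ formKernel (wedgePow η k) := by
    intro u hu
    set T : 𝕜 → V →ₗ[𝕜] V := fun c => LinearMap.id + c • ((pairing η).flip u).smulRight u with hT
    have hTa : ∀ c x, T c x = x + (c * η ![x, u]) • u := by
      intro c x
      simp [hT, pairing_apply, smul_smul]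
    have h2 := hinv (T 1) (T (-1)) (by
      ext x
      simp only [LinearMap.comp_apply, hTa, pair_add, pair_smul, pair_self, LinearMap.id_apply]
      module) (by
      ext w
      rw [AlternatingMap.compLinearMap_apply, vec_two w, vec_two (fun i => _)]
      simp only [hTa, Matrix.cons_val_zero, Matrix.cons_val_one, pair_add, pair_add_right,
        pair_smul, pair_smul_right, pair_self]
      rw [pair_swap η u (w 1)]
      ring)
    rw [hTa] at h2
    have h3 := Submodule.sub_mem _ h2 hv
    rw [add_sub_cancel_left, one_mul] at h3
    exact (Submodule.smul_mem_iff _ hu).1 h3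
  rw [eq_top_iff]
  intro u _
  by_cases hu : η ![v, u] = 0
  · have := Submodule.sub_mem _ (key (u + u₀) (by rwa [pair_add_right, hu, zero_add])) (key u₀ hu₀)
    simpa using this
  · exact key u hu

/-- An isomorphism which fixes the kernel pointwise respects the kernels of the powers. -/
lemma formKernel_wedgePow_eq (η η' : V [⋀^Fin 2]→ₗ[𝕜] 𝕜) (A : V ≃ₗ[𝕜] V)
    (hA : η'.compLinearMap (A : V →ₗ[𝕜] V) = η) (hfix : ∀ v ∈ formKernel η, A v = v) (k : ℕ) :
    formKernel (wedgePow η k) = formKernel (wedgePow η' k) := by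
  have hmap : ∀ v, v ∈ formKernel (wedgePow η k) ↔ A v ∈ formKernel (wedgePow η' k) := by
    intro v
    rw [← hA, wedgePow_compLinearMap]
    constructor
    · intro h w i
      have := h (A.symm ∘ w) i
      rw [AlternatingMap.compLinearMap_apply] at this
      convert this using 2
      ext1 j
      by_cases hj : j = i
      · subst hj; simp
      · simp [Function.update_of_ne hj]
    · intro h w i
      have := h (A ∘ w) i
      rw [AlternatingMap.compLinearMap_apply]
      convert this using 2
      ext1 j
      by_cases hj : j = i
      · subst hj; simp
      · simp [Function.update_of_ne hj]
  -- If the kernel of the power is that of `η`, then `A` fixes it pointwise and the two kernels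
  -- agree; otherwise both are the whole space. There is thus no need to know whether the power
  -- vanishes.
  rcases formKernel_wedgePow_dichotomy η k with h | h
  · have hfix' : ∀ v ∈ formKernel (wedgePow η k), A v = v := by rwa [h]
    ext v
    rw [hmap]
    constructor
    · intro hv
      rwa [hfix' v ((hmap v).2 hv)] at hv
    · intro hv
      have h1 : A.symm v ∈ formKernel (wedgePow η k) := by rw [hmap]; simpa using hv
      have h2 := hfix' _ h1
      rw [A.apply_symm_apply] at h2
      rwa [h2, A.apply_symm_apply]
  · rw [h, eq_comm, eq_top_iff]
    intro v _
    have := (hmap (A.symm v)).1 (by rw [h]; trivial)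
    simpa using this

end WedgeAlgebra

/-! ### First variation of the powers of a two-form. -/

section PowerDerivative

variable {𝕜 E : Type} [RCLike 𝕜] [NormedAddCommGroup E] [NormedSpace 𝕜 E]

lemma differentiableAt_wedgePow (k : ℕ) (v : Fin (2 * k) → E) (η₀ : E [⋀^Fin 2]→L[𝕜] 𝕜) :
    DifferentiableAt 𝕜 (fun η : E [⋀^Fin 2]→L[𝕜] 𝕜 => wedgePow η.toAlternatingMap k v) η₀ := by
  induction k with
  | zero => exact differentiableAt_const _
  | succ k ih =>
    have h : ∀ v : Fin 2 → E, DifferentiableAt 𝕜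
        (fun η : E [⋀^Fin 2]→L[𝕜] 𝕜 => η.toAlternatingMap v) η₀ := fun v =>
      (ContinuousAlternatingMap.apply 𝕜 E 𝕜 v).differentiableAt
    have h2 : ∀ η : E [⋀^Fin 2]→L[𝕜] 𝕜, wedgePow η.toAlternatingMap (k + 1) v
        = wedge (wedgePow η.toAlternatingMap k) η.toAlternatingMap v := fun η => rfl
    simp only [h2, wedge_apply]
    refine DifferentiableAt.const_mul (DifferentiableAt.fun_sum fun s _ => ?_) _
    exact DifferentiableAt.const_mul ((ih _).mul (h _)) _

lemma hasDerivAt_quadratic_curve {F : Type} [NormedAddCommGroup F] [NormedSpace 𝕜 F]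
    (η₀ η₁ ρ : F) : HasDerivAt (fun ε : 𝕜 => η₀ + ε • (η₁ + ε • ρ)) η₁ 0 := by
  have h2 : HasDerivAt (fun ε : 𝕜 => η₁ + ε • ρ) ((1 : 𝕜) • ρ) 0 :=
    ((hasDerivAt_id (0 : 𝕜)).smul_const ρ).const_add η₁
  have h3 := ((hasDerivAt_id (0 : 𝕜)).smul h2).const_add η₀
  simpa using h3

lemma compContinuousLinearMap_pair {G : Type} [NormedAddCommGroup G] [NormedSpace 𝕜 G]
    (η : G [⋀^Fin 2]→L[𝕜] 𝕜) (L : E →L[𝕜] G) (v w : E) :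
    η.compContinuousLinearMap L ![v, w] = η ![L v, L w] := by
  rw [ContinuousAlternatingMap.compContinuousLinearMap_apply]
  congr 1
  ext1 i
  fin_cases i <;> rfl

/-- The derivative of a power along a direction in which the power vanishes up to second order. -/
lemma fderiv_wedgePow_eq_zero {k : ℕ} {v : Fin (2 * k) → E} {η₀ η₁ ρ : E [⋀^Fin 2]→L[𝕜] 𝕜}
    (h : ∀ ε : 𝕜, wedgePow (η₀ + ε • (η₁ + ε • ρ)).toAlternatingMap k v = 0) :
    fderiv 𝕜 (fun η : E [⋀^Fin 2]→L[𝕜] 𝕜 => wedgePow η.toAlternatingMap k v) η₀ η₁ = 0 := by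
  have h1 := hasDerivAt_quadratic_curve (𝕜 := 𝕜) η₀ η₁ ρ
  have h4 := (differentiableAt_wedgePow k v (η₀ + (0 : 𝕜) • (η₁ + (0 : 𝕜) • ρ))).hasFDerivAt
  have h5 := h4.comp_hasDerivAt (0 : 𝕜) h1
  have h6 := h5.unique (by
    refine (hasDerivAt_const (0 : 𝕜) (0 : 𝕜)).congr_of_eventuallyEq (Eventually.of_forall fun ε => ?_)
    exact h ε)
  simpa using h6

variable [FiniteDimensional 𝕜 E]

/-- The power has no first order variation in the directions which vanish on the kernel. -/
lemma fderiv_wedgePow_of_vanish_on_ker {k : ℕ} {v : Fin (2 * k) → E} {η₀ η₁ : E [⋀^Fin 2]→L[𝕜] 𝕜}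
    (h0 : wedgePow η₀.toAlternatingMap k = 0)
    (h1 : ∀ v ∈ formKernel η₀.toAlternatingMap, ∀ w ∈ formKernel η₀.toAlternatingMap,
      η₁ ![v, w] = 0) :
    fderiv 𝕜 (fun η : E [⋀^Fin 2]→L[𝕜] 𝕜 => wedgePow η.toAlternatingMap k v) η₀ η₁ = 0 := by
  set N := formKernel η₀.toAlternatingMap with hN
  obtain ⟨g, hg⟩ := N.subtype.exists_leftInverse_of_injective (Submodule.ker_subtype N)
  set B₀ := pairing η₀.toAlternatingMap
  set B₁ := pairing η₁.toAlternatingMap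
  have hB0 : ∀ v, B₀ v v = 0 := pair_self _
  have hB1 : ∀ v, B₁ v v = 0 := pair_self _
  set P : E →ₗ[𝕜] E := LinearMap.id - N.subtype ∘ₗ g with hP
  have hPN : ∀ v, v - P v ∈ N := by
    intro v
    simp [hP]
  have hP0 : ∀ v ∈ N, P v = 0 := by
    intro v hv
    have := LinearMap.congr_fun hg ⟨v, hv⟩
    simp only [LinearMap.comp_apply, Submodule.subtype_apply, LinearMap.id_apply] at this
    simp [hP, this]
  -- The aim is `M` with η₀(Mv, w) + η₀(v, Mw) = η₁(v, w), meaning that η₁ is tangent to the linear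
  -- orbit of η₀. The term with 1/2 is chosen so that antisymmetrising `β` yields B₁(v, w) - B₁(v -
  -- Pv, w - Pw), whose last term vanishes by `h1`. Each `β v` kills `N` because `P` does, so it is
  -- a contraction of η₀.
  set β : E →ₗ[𝕜] E →ₗ[𝕜] 𝕜 := B₁.compl₂ P - (2⁻¹ : 𝕜) • (B₁.compl₁₂ P P) with hβ
  have hβa : ∀ v w, β v w = B₁ v (P w) - 2⁻¹ * B₁ (P v) (P w) := fun v w => rfl
  have hex : ∀ v, ∃ h, B₀ h = β v := by
    intro v
    refine exists_contraction_eq B₀ hB0 _ fun w hw => ?_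
    have : w ∈ N := mem_formKernel_two.2 fun x => LinearMap.congr_fun hw x
    rw [hβa, hP0 w this]; simp
  choose h hh using hex
  let b := Module.finBasis 𝕜 E
  let M : E →ₗ[𝕜] E := b.constr 𝕜 (fun i => h (b i))
  have hM : ∀ v w, B₀ (M v) w = β v w := by
    intro v w
    have : B₀ ∘ₗ M = β := b.ext fun i => by simp [M, hh]
    exact LinearMap.congr_fun (LinearMap.congr_fun this v) w
  have hswap0 : ∀ v w, B₀ v w = - B₀ w v := pair_swap _
  have hswap1 : ∀ v w, B₁ v w = - B₁ w v := pair_swap _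
  have key : ∀ v w, B₀ (M v) w + B₀ v (M w) = B₁ v w := by
    intro v w
    rw [hswap0 v, hM, hM, hβa, hβa, hswap1 w, hswap1 (P w)]
    have h2 : B₁ (v - P v) (w - P w) = 0 := h1 _ (hPN v) _ (hPN w)
    simp only [map_sub, LinearMap.sub_apply] at h2
    linear_combination -h2
  let Mc : E →L[𝕜] E := LinearMap.toContinuousLinearMap M
  refine fderiv_wedgePow_eq_zero (ρ := η₀.compContinuousLinearMap Mc) fun ε => ?_
  -- The quadratic term makes the curve exactly the pullback of η₀ under 1 + εM, so its power
  -- vanishes for every ε.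
  have : (η₀ + ε • (η₁ + ε • η₀.compContinuousLinearMap Mc)).toAlternatingMap
      = η₀.toAlternatingMap.compLinearMap (LinearMap.id + ε • M) := by
    ext w
    rw [AlternatingMap.compLinearMap_apply, vec_two w, vec_two (fun i => _)]
    have e0 : ∀ v w, B₀ v w = η₀.toAlternatingMap ![v, w] := fun v w => rfl
    have e1 : ∀ v w, B₁ v w = η₁.toAlternatingMap ![v, w] := fun v w => rfl
    have e2 : (η₀ + ε • (η₁ + ε • η₀.compContinuousLinearMap Mc)).toAlternatingMap ![w 0, w 1]
        = B₀ (w 0) (w 1) + ε * (B₁ (w 0) (w 1) + ε * B₀ (M (w 0)) (M (w 1))) := by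
      have e3 := compContinuousLinearMap_pair η₀ Mc (w 0) (w 1)
      change η₀ ![w 0, w 1] + ε * (η₁ ![w 0, w 1]
        + ε * η₀.compContinuousLinearMap Mc ![w 0, w 1]) = _
      rw [e3]
      rfl
    rw [e2, ← e0]
    simp only [Matrix.cons_val_zero, Matrix.cons_val_one, LinearMap.add_apply,
      LinearMap.smul_apply, LinearMap.id_apply, map_add, map_smul, smul_eq_mul, ← key]
    ring
  rw [this, wedgePow_compLinearMap, h0]
  rfl

/-- The top power has no first order variation at a form of corank at least `3`. -/
lemma fderiv_wedgePow_of_corank {k : ℕ} {v : Fin (2 * k) → E} {η₀ η₁ : E [⋀^Fin 2]→L[𝕜] 𝕜}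
    (hk : Module.finrank 𝕜 E = 2 * k)
    (h0 : 3 ≤ Module.finrank 𝕜 (formKernel η₀.toAlternatingMap)) :
    fderiv 𝕜 (fun η : E [⋀^Fin 2]→L[𝕜] 𝕜 => wedgePow η.toAlternatingMap k v) η₀ η₁ = 0 := by
  let b := Module.finBasis 𝕜 E
  -- `P i j` maps into the span of two basis vectors. Pulling η₁ back by these maps and summing
  -- counts each pair of coordinates twice, hence the factor 1/2; the diagonal pullbacks vanish.
  let P : Fin (Module.finrank 𝕜 E) → Fin (Module.finrank 𝕜 E) → E →L[𝕜] E := fun i j =>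
    LinearMap.toContinuousLinearMap ((b.coord i).smulRight (b i) + (b.coord j).smulRight (b j))
  have hPa : ∀ i j x, P i j x = b.repr x i • b i + b.repr x j • b j := fun i j x => rfl
  have hdec : η₁ = (2⁻¹ : 𝕜) • ∑ i, ∑ j, η₁.compContinuousLinearMap (P i j) := by
    ext w
    rw [vec_two w]
    generalize w 0 = x
    generalize w 1 = y
    have e1 : ∀ i j, η₁.compContinuousLinearMap (P i j) ![x, y]
        = b.repr x i * b.repr y j * η₁ ![b i, b j] + b.repr x j * b.repr y i * η₁ ![b j, b i] := by
      intro i j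
      rw [compContinuousLinearMap_pair, hPa, hPa]
      have a1 := pair_add η₁.toAlternatingMap
      have a2 := pair_add_right η₁.toAlternatingMap
      have a3 := pair_smul η₁.toAlternatingMap
      have a4 := pair_smul_right η₁.toAlternatingMap
      have a5 := pair_self η₁.toAlternatingMap
      simp only [ContinuousAlternatingMap.coe_toAlternatingMap] at a1 a2 a3 a4 a5
      simp only [a1, a2, a3, a4, a5]
      ring
    have e2 : η₁ ![x, y] = ∑ i, ∑ j, b.repr x i * b.repr y j * η₁ ![b i, b j] := by
      change pairing η₁.toAlternatingMap x y
        = ∑ i, ∑ j, b.repr x i * b.repr y j * pairing η₁.toAlternatingMap (b i) (b j)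
      conv_lhs => rw [← b.sum_repr x, ← b.sum_repr y]
      simp only [map_sum, LinearMap.sum_apply, map_smul, LinearMap.smul_apply, smul_eq_mul,
        Finset.mul_sum]
      rw [Finset.sum_comm]
      exact Finset.sum_congr rfl fun i _ => Finset.sum_congr rfl fun j _ => by ring
    have e3 : ((2⁻¹ : 𝕜) • ∑ i, ∑ j, η₁.compContinuousLinearMap (P i j)) ![x, y]
        = 2⁻¹ * ∑ i, ∑ j, η₁.compContinuousLinearMap (P i j) ![x, y] := by
      simp [ContinuousAlternatingMap.sum_apply]
    rw [e3]
    simp only [e1, Finset.sum_add_distrib]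
    rw [Finset.sum_comm (f := fun i j => b.repr x j * b.repr y i * η₁ ![b j, b i]), ← e2]
    ring
  rw [hdec, map_smul, map_sum]
  refine smul_eq_zero_of_right _ (Finset.sum_eq_zero fun i _ => ?_)
  rw [map_sum]
  refine Finset.sum_eq_zero fun j _ => ?_
  refine fderiv_wedgePow_eq_zero (ρ := 0) fun ε => ?_
  set N := formKernel η₀.toAlternatingMap with hN
  -- A kernel of dimension at least three contains a nonzero vector whose i-th and j-th coordinates
  -- vanish. It is killed by every form on the line from η₀, so the top power vanishes along that
  -- line.
  let φ : N →ₗ[𝕜] 𝕜 × 𝕜 := ((b.coord i).prod (b.coord j)) ∘ₗ N.subtype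
  have hφ : LinearMap.ker φ ≠ ⊥ := by
    refine LinearMap.ker_ne_bot_of_finrank_lt ?_
    rw [Module.finrank_prod, Module.finrank_self]
    omega
  obtain ⟨x, hx, hx0⟩ := Submodule.exists_mem_ne_zero_of_ne_bot hφ
  have hx1 : b.repr x i = 0 := (Prod.ext_iff.1 (LinearMap.mem_ker.1 hx)).1
  have hx2 : b.repr x j = 0 := (Prod.ext_iff.1 (LinearMap.mem_ker.1 hx)).2
  rw [wedgePow_eq_zero]
  · rfl
  rw [hk]
  have hmem : (x : E) ∈ formKernel (η₀ + ε • (η₁.compContinuousLinearMap (P i j)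
      + ε • (0 : E [⋀^Fin 2]→L[𝕜] 𝕜))).toAlternatingMap := by
    rw [mem_formKernel_two]
    intro w
    have h2 : η₀ ![(x : E), w] = 0 := mem_formKernel_two.1 x.2 w
    have h3 := compContinuousLinearMap_pair η₁ (P i j) x w
    have h4 : P i j x = 0 := by rw [hPa, hx1, hx2]; simp
    have h5 : η₁ ![(0 : E), P i j w] = 0 := η₁.map_coord_zero (0 : Fin 2) rfl
    rw [h4, h5] at h3
    change η₀ ![(x : E), w] + ε * (η₁.compContinuousLinearMap (P i j) ![(x : E), w] + ε * 0) = 0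
    rw [h2, h3]
    ring
  have : 0 < Module.finrank 𝕜 (formKernel (η₀ + ε • (η₁.compContinuousLinearMap (P i j)
      + ε • (0 : E [⋀^Fin 2]→L[𝕜] 𝕜))).toAlternatingMap) := by
    rw [Module.finrank_pos_iff_exists_ne_zero]
    refine ⟨⟨x, hmem⟩, fun h => hx0 ?_⟩
    have h' : (x : E) = 0 := congrArg Subtype.val h
    exact Subtype.ext h'
  omega

end PowerDerivative

/-! ### Pullbacks of closed two-forms. -/

section Pullback

variable {𝕜 E E' : Type} [RCLike 𝕜] [NormedAddCommGroup E] [NormedSpace 𝕜 E]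
  [NormedAddCommGroup E'] [NormedSpace 𝕜 E'] {r : WithTop ℕ∞}

/-- The pullback of a bilinear form under a linear map. -/
def compBilin (η : E' →L[𝕜] E' →L[𝕜] 𝕜) (L : E →L[𝕜] E') : E →L[𝕜] E →L[𝕜] 𝕜 :=
  ((ContinuousLinearMap.compL 𝕜 E E' 𝕜).flip L).comp (η.comp L)

@[simp] lemma compBilin_apply (η : E' →L[𝕜] E' →L[𝕜] 𝕜) (L : E →L[𝕜] E') (v w : E) :
    compBilin η L v w = η (L v) (L w) := rfl

lemma contDiffAt_compBilin {X : Type} [NormedAddCommGroup X] [NormedSpace 𝕜 X] {x : X}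
    {η : X → E' →L[𝕜] E' →L[𝕜] 𝕜} {L : X → E →L[𝕜] E'} (hη : ContDiffAt 𝕜 r η x)
    (hL : ContDiffAt 𝕜 r L x) : ContDiffAt 𝕜 r (fun x => compBilin (η x) (L x)) x := by
  have h1 : ContDiffAt 𝕜 r (fun x => (ContinuousLinearMap.compL 𝕜 E E' 𝕜).flip (L x)) x :=
    contDiffAt_const.clm_apply hL
  exact h1.clm_comp (hη.clm_comp hL)

/-- The pullback of a field of bilinear forms. -/
def pullbackBilin (Θ : E → E') (b : E' → E' →L[𝕜] E' →L[𝕜] 𝕜) (x : E) : E →L[𝕜] E →L[𝕜] 𝕜 :=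
  compBilin (b (Θ x)) (fderiv 𝕜 Θ x)

lemma pullbackBilin_apply (Θ : E → E') (b : E' → E' →L[𝕜] E' →L[𝕜] 𝕜) (x v w : E) :
    pullbackBilin Θ b x v w = b (Θ x) (fderiv 𝕜 Θ x v) (fderiv 𝕜 Θ x w) := rfl

lemma pullbackBilin_germ (hr : r = ∞ ∨ r = ω) {Θ : E → E'} {b : E' → E' →L[𝕜] E' →L[𝕜] 𝕜}
    (hb : GermAt 𝕜 r b 0) (hΘ : GermAt 𝕜 r Θ 0) (h0 : Θ 0 = 0) :
    GermAt 𝕜 r (pullbackBilin Θ b) 0 := by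
  have h1 : GermAt 𝕜 r (fun x => b (Θ x)) 0 := GermAt.comp (f := Θ) (by rwa [h0]) hΘ
  filter_upwards [h1, hΘ.fderiv_right hr] with x x1 x2 using contDiffAt_compBilin x1 x2

lemma fderiv_bilin_dir {b : E → E' →L[𝕜] E' →L[𝕜] 𝕜} {x : E} (hb : DifferentiableAt 𝕜 b x)
    (v w : E') : HasFDerivAt (fun x => b x v w) (fderiv 𝕜 (fun x => b x v w) x) x ∧
      ∀ u, fderiv 𝕜 (fun x => b x v w) x u = fderiv 𝕜 b x u v w := by
  have h1 : HasFDerivAt (fun x => b x v w) _ x :=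
    (hb.hasFDerivAt.clm_apply (hasFDerivAt_const v x)).clm_apply (hasFDerivAt_const w x)
  refine ⟨h1.differentiableAt.hasFDerivAt, fun u => ?_⟩
  rw [h1.fderiv]
  simp

/-- The derivative of `x ↦ b x (V x) (W x)`. -/
lemma hasFDerivAt_bilin_comp {b : E → E' →L[𝕜] E' →L[𝕜] 𝕜} {V W : E → E'} {x : E}
    (hb : DifferentiableAt 𝕜 b x) (hV : DifferentiableAt 𝕜 V x) (hW : DifferentiableAt 𝕜 W x) :
    HasFDerivAt (fun x => b x (V x) (W x)) (fderiv 𝕜 (fun x => b x (V x) (W x)) x) x ∧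
      ∀ u, fderiv 𝕜 (fun x => b x (V x) (W x)) x u = fderiv 𝕜 b x u (V x) (W x)
        + b x (fderiv 𝕜 V x u) (W x) + b x (V x) (fderiv 𝕜 W x u) := by
  obtain ⟨L, hL, hLv⟩ := hasFDerivAt_bilin_apply hb (V x) (W x)
  have h := (hasFDerivAt_id (𝕜 := 𝕜) x).prodMk (hV.hasFDerivAt.prodMk hW.hasFDerivAt)
  have h' : HasFDerivAt (fun x => b x (V x) (W x)) _ x :=
    HasFDerivAt.comp x (f := fun x => (x, V x, W x)) hL h
  refine ⟨h'.differentiableAt.hasFDerivAt, fun u => ?_⟩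
  rw [h'.fderiv]
  simp only [ContinuousLinearMap.comp_apply, ContinuousLinearMap.prod_apply, hLv]
  simp

lemma fderiv_pullbackBilin {Θ : E → E'} {b : E' → E' →L[𝕜] E' →L[𝕜] 𝕜} {x : E}
    (hb : DifferentiableAt 𝕜 b (Θ x)) (hΘ : DifferentiableAt 𝕜 Θ x)
    (hDΘ : DifferentiableAt 𝕜 (fderiv 𝕜 Θ) x) (hp : DifferentiableAt 𝕜 (pullbackBilin Θ b) x)
    (u v w : E) : fderiv 𝕜 (pullbackBilin Θ b) x u v w
      = fderiv 𝕜 b (Θ x) (fderiv 𝕜 Θ x u) (fderiv 𝕜 Θ x v) (fderiv 𝕜 Θ x w)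
        + b (Θ x) (fderiv 𝕜 (fderiv 𝕜 Θ) x u v) (fderiv 𝕜 Θ x w)
        + b (Θ x) (fderiv 𝕜 Θ x v) (fderiv 𝕜 (fderiv 𝕜 Θ) x u w) := by
  rw [← (fderiv_bilin_dir hp v w).2 u]
  have hc : HasFDerivAt (fun x => b (Θ x)) ((fderiv 𝕜 b (Θ x)).comp (fderiv 𝕜 Θ x)) x :=
    HasFDerivAt.comp (G := E' →L[𝕜] E' →L[𝕜] 𝕜) (g := b) x hb.hasFDerivAt hΘ.hasFDerivAt
  have hv : ∀ v, HasFDerivAt (fun x => fderiv 𝕜 Θ x v) ((fderiv 𝕜 (fderiv 𝕜 Θ) x).flip v) x := by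
    intro v
    have := hDΘ.hasFDerivAt.clm_apply (hasFDerivAt_const v x)
    convert this using 1
    ext u; simp
  have h := (hasFDerivAt_bilin_comp hc.differentiableAt (hv v).differentiableAt
    (hv w).differentiableAt).2 u
  rw [hc.fderiv, (hv v).fderiv, (hv w).fderiv] at h
  exact h

/-- In the cyclic sum the terms containing second derivatives of `Θ` cancel in pairs, by symmetry of
those derivatives and antisymmetry of `b`. -/
lemma IsClosedTwoForm.pullback (hr : r = ∞ ∨ r = ω) {Θ : E → E'}
    {b : E' → E' →L[𝕜] E' →L[𝕜] 𝕜} (hb : IsClosedTwoForm r b) (hΘ : GermAt 𝕜 r Θ 0)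
    (h0 : Θ 0 = 0) : IsClosedTwoForm r (pullbackBilin Θ b) := by
  have hg := pullbackBilin_germ hr hb.germ hΘ h0
  have ht : Tendsto Θ (𝓝 0) (𝓝 0) := by
    have := hΘ.self_of_nhds.continuousAt.tendsto
    rwa [h0] at this
  have hr2 : minSmoothness 𝕜 2 ≤ r := by
    rw [minSmoothness_of_isRCLikeNormedField]
    rcases hr with rfl | rfl
    · exact ENat.LEInfty.out
    · exact le_top
  refine ⟨hg, ?_, ?_⟩
  · filter_upwards [ht.eventually hb.alt] with x hx v using hx _
  · filter_upwards [ht.eventually hb.alt, ht.eventually hb.closed, hΘ,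
      hΘ.differentiableAt hr, (hΘ.fderiv_right hr).differentiableAt hr, hg.differentiableAt hr,
      ht.eventually (hb.germ.differentiableAt hr)] with x x1 x2 x3 x4 x5 x6 x7 u v w
    have hs : ∀ u v, fderiv 𝕜 (fderiv 𝕜 Θ) x u v = fderiv 𝕜 (fderiv 𝕜 Θ) x v u := fun u v =>
      (x3.isSymmSndFDerivAt hr2).eq u v
    simp only [fderiv_pullbackBilin x7 x4 x5 x6]
    have c := x2 (fderiv 𝕜 Θ x u) (fderiv 𝕜 Θ x v) (fderiv 𝕜 Θ x w)
    rw [hs v u, hs w u, hs w v, bilin_swap x1 (fderiv 𝕜 Θ x u) (fderiv 𝕜 (fderiv 𝕜 Θ) x v w),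
      bilin_swap x1 (fderiv 𝕜 (fderiv 𝕜 Θ) x u v) (fderiv 𝕜 Θ x w),
      bilin_swap x1 (fderiv 𝕜 (fderiv 𝕜 Θ) x u w) (fderiv 𝕜 Θ x v)]
    linear_combination c

lemma bilinEquivalent_pullback (hr : r = ∞ ∨ r = ω) [CompleteSpace E] {Θ : E → E'}
    (b : E' → E' →L[𝕜] E' →L[𝕜] 𝕜) (hΘ : GermAt 𝕜 r Θ 0) (h0 : Θ 0 = 0) (e : E ≃L[𝕜] E')
    (he : (e : E →L[𝕜] E') = fderiv 𝕜 Θ 0) : BilinEquivalent r (pullbackBilin Θ b) b := by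
  have hd : HasFDerivAt Θ (e : E →L[𝕜] E') 0 := by
    rw [he]; exact (hΘ.differentiableAt hr).self_of_nhds.hasFDerivAt
  obtain ⟨Φ, hs, hΦ, h1, h2⟩ := hΘ.exists_openPartialHomeomorph hr e hd
  refine ⟨Φ, hs, by rw [hΦ, h0], h1, h2, Eventually.of_forall fun x v w => ?_⟩
  rw [hΦ]; rfl

end Pullback

/-! ### Fold forms and their kernels along the hypersurface. -/

section Fold

variable {𝕜 H : Type} [RCLike 𝕜] [NormedAddCommGroup H] [NormedSpace 𝕜 H] {r : WithTop ℕ∞}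

/-- Closed `2`-forms on `𝕜 × H` which degenerate to first order along `{t = 0}`, with
two-dimensional kernel at `0` spanned by the tangent vectors `k₁`, `k₂`. The kernel at `0` of the
restriction to `{t = 0}` is spanned by `k₁`, `k₂` and `p`. -/
structure IsFold (r : WithTop ℕ∞) (b : 𝕜 × H → (𝕜 × H) →L[𝕜] (𝕜 × H) →L[𝕜] 𝕜)
    (k₁ k₂ p : H) : Prop where
  closed : IsClosedTwoForm r b
  ker : ∀ v, b 0 v = 0 ↔ v ∈ Submodule.span 𝕜 {((0 : 𝕜), k₁), ((0 : 𝕜), k₂)}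
  ind : LinearIndependent 𝕜 ![((0 : 𝕜), k₁), ((0 : 𝕜), k₂)]
  tangent : ∀ w : H, b 0 (0, p) (0, w) = 0
  nontrivial : b 0 (1, 0) (0, p) ≠ 0
  transverse : ∃ v w, b 0 v = 0 ∧ b 0 w = 0 ∧ fderiv 𝕜 b 0 (1, 0) v w ≠ 0
  degenerate : ∀ᶠ x in 𝓝 0, ∀ v, v ≠ 0 → b x v = 0 → x.1 = 0

variable {b : 𝕜 × H → (𝕜 × H) →L[𝕜] (𝕜 × H) →L[𝕜] 𝕜} {k₁ k₂ p : H}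

lemma IsFold.ker_left (h : IsFold r b k₁ k₂ p) : b 0 (0, k₁) = 0 :=
  (h.ker _).2 (Submodule.subset_span (by simp))

lemma IsFold.ker_right (h : IsFold r b k₁ k₂ p) : b 0 (0, k₂) = 0 :=
  (h.ker _).2 (Submodule.subset_span (by simp))

lemma IsClosedTwoForm.alt_zero (h : IsClosedTwoForm r b) (v : 𝕜 × H) : b 0 v v = 0 :=
  h.alt.self_of_nhds v

lemma IsClosedTwoForm.fderiv_swap (hr : r = ∞ ∨ r = ω) (h : IsClosedTwoForm r b)
    (u v w : 𝕜 × H) : fderiv 𝕜 b 0 u v w = - fderiv 𝕜 b 0 u w v :=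
  bilin_swap (fderiv_bilin_alt (h.germ.differentiableAt hr).self_of_nhds h.alt u) v w

/-- A 2-form on a plane is determined by its value on a basis. -/
lemma IsFold.transverse_frame (hr : r = ∞ ∨ r = ω) (h : IsFold r b k₁ k₂ p) :
    fderiv 𝕜 b 0 (1, 0) (0, k₁) (0, k₂) ≠ 0 := by
  intro h0
  obtain ⟨v, w, hv, hw, hvw⟩ := h.transverse
  have halt := fderiv_bilin_alt (h.closed.germ.differentiableAt hr).self_of_nhds h.closed.alt
  obtain ⟨a, c, rfl⟩ := Submodule.mem_span_pair.1 ((h.ker v).1 hv)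
  obtain ⟨a', c', rfl⟩ := Submodule.mem_span_pair.1 ((h.ker w).1 hw)
  apply hvw
  have h1 := h.closed.fderiv_swap hr (1, 0) (0, k₂) (0, k₁)
  simp only [map_add, map_smul, add_apply, smul_apply, halt, h0, h1]
  simp

lemma bilin_prod (η : (𝕜 × H) →L[𝕜] (𝕜 × H) →L[𝕜] 𝕜) (v w : 𝕜 × H) :
    η v w = v.1 * η (1, 0) w + η (0, v.2) w := by
  have : v = v.1 • ((1 : 𝕜), (0 : H)) + ((0 : 𝕜), v.2) := by ext <;> simp
  conv_lhs => rw [this]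
  rw [map_add, map_smul]
  rfl

/-- The kernel of the restriction of a fold form to `{t = 0}`. -/
lemma IsFold.exists_eq_of_tangent (h : IsFold r b k₁ k₂ p) {y : H}
    (hy : ∀ w : H, b 0 (0, y) (0, w) = 0) : ∃ a c d : 𝕜, y = a • k₁ + c • k₂ + d • p := by
  set d := b 0 (1, 0) (0, y) / b 0 (1, 0) (0, p) with hd
  have h1 : b 0 (0, y - d • p) = 0 := by
    refine ContinuousLinearMap.ext fun x => ?_
    rw [bilin_swap h.closed.alt_zero, bilin_prod, bilin_swap h.closed.alt_zero (0, x.2)]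
    have e : ((0 : 𝕜), y - d • p) = (0, y) - d • (0, p) := by ext <;> simp
    rw [e, map_sub, map_smul, map_sub, map_smul]
    simp only [sub_apply, smul_apply, hy, h.tangent, smul_eq_mul, hd]
    rw [div_mul_cancel₀ _ h.nontrivial]
    simp
  obtain ⟨a, c, hac⟩ := Submodule.mem_span_pair.1 ((h.ker _).1 h1)
  refine ⟨a, c, d, ?_⟩
  have h2 := congrArg Prod.snd hac
  simp only [Prod.snd_add, Prod.smul_snd] at h2
  rw [h2]; abel

lemma IsFold.tangent_left (h : IsFold r b k₁ k₂ p) (w : H) : b 0 (0, k₁) (0, w) = 0 := by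
  rw [h.ker_left]; rfl

lemma IsFold.tangent_right (h : IsFold r b k₁ k₂ p) (w : H) : b 0 (0, k₂) (0, w) = 0 := by
  rw [h.ker_right]; rfl

lemma IsFold.normal_left (h : IsFold r b k₁ k₂ p) : b 0 (1, 0) (0, k₁) = 0 := by
  rw [bilin_swap h.closed.alt_zero, h.ker_left]; simp

lemma IsFold.normal_right (h : IsFold r b k₁ k₂ p) : b 0 (1, 0) (0, k₂) = 0 := by
  rw [bilin_swap h.closed.alt_zero, h.ker_right]; simp

/-- Frame germs of the kernels along `{t = 0}`. -/
structure IsKernelFrame (r : WithTop ℕ∞) (b : 𝕜 × H → (𝕜 × H) →L[𝕜] (𝕜 × H) →L[𝕜] 𝕜)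
    (k₁ k₂ : H) (K₁ K₂ : H → 𝕜 × H) : Prop where
  germ₁ : GermAt 𝕜 r K₁ 0
  germ₂ : GermAt 𝕜 r K₂ 0
  zero₁ : K₁ 0 = (0, k₁)
  zero₂ : K₂ 0 = (0, k₂)
  ker₁ : ∀ᶠ q in 𝓝 (0 : H), b (0, q) (K₁ q) = 0
  ker₂ : ∀ᶠ q in 𝓝 (0 : H), b (0, q) (K₂ q) = 0
  ind : ∀ᶠ q in 𝓝 (0 : H), ∀ a c : 𝕜, a • K₁ q + c • K₂ q = 0 → a = 0 ∧ c = 0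
  span : ∀ᶠ q in 𝓝 (0 : H), ∀ v, b (0, q) v = 0 → ∃ a c : 𝕜, v = a • K₁ q + c • K₂ q

lemma tendsto_zero_pair {𝕜 H : Type} [RCLike 𝕜] [NormedAddCommGroup H] :
    Tendsto (fun q : H => ((0 : 𝕜), q)) (𝓝 0) (𝓝 0) :=
  Continuous.tendsto' (by fun_prop) _ _ rfl

/-- The Schur vectors lie in the kernel wherever the Pfaffian factor `m` vanishes, so `m` must be
shown to vanish on `{t = 0}`. Its normal derivative is nonzero, so its zero set is a graph over `H`.
The form is degenerate on that graph, hence t = 0 there, and the graph is the whole of `{t = 0}`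
near the origin. -/
theorem IsFold.exists_frame [FiniteDimensional 𝕜 H] (hr : r = ∞ ∨ r = ω)
    (h : IsFold r b k₁ k₂ p) : ∃ K₁ K₂, IsKernelFrame r b k₁ k₂ K₁ K₂ := by
  have hrp : r ≠ 0 := by rcases hr with rfl | rfl <;> simp
  have : CompleteSpace H := FiniteDimensional.complete 𝕜 H
  obtain ⟨κ₁, κ₂, R, hκ₁, hκ₂, -, -, e₁, e₂, hframe⟩ :=
    exists_schur_frame h.closed.alt_zero h.ker h.ind r
  have c₁ : GermAt 𝕜 r (fun x => κ₁ (b x)) 0 := GermAt.comp (g := κ₁) hκ₁ h.closed.germ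
  have c₂ : GermAt 𝕜 r (fun x => κ₂ (b x)) 0 := GermAt.comp (g := κ₂) hκ₂ h.closed.germ
  have hb : Tendsto b (𝓝 0) (𝓝 (b 0)) := h.closed.germ.self_of_nhds.continuousAt
  set m : 𝕜 × H → 𝕜 := fun x => b x (κ₁ (b x)) (κ₂ (b x)) with hm
  have hmg : GermAt 𝕜 r m 0 := by
    filter_upwards [h.closed.germ, c₁, c₂] with x x0 x1 x2 using (x0.clm_apply x1).clm_apply x2
  have hd : fderiv 𝕜 m 0 (1, 0) ≠ 0 := by
    have := hasFDerivAt_pfaffian (b := b) (y := 0) (κ₁ := fun x => κ₁ (b x))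
      (κ₂ := fun x => κ₂ (b x)) (h.closed.germ.self_of_nhds.differentiableAt hrp)
      h.closed.alt_zero (c₁.self_of_nhds.differentiableAt hrp)
      (c₂.self_of_nhds.differentiableAt hrp) (by rw [e₁]; exact h.ker_left)
      (by rw [e₂]; exact h.ker_right) (1, 0)
    rw [hm, this, e₁, e₂]
    exact h.transverse_frame hr
  have hm0 : m 0 = 0 := by simp only [hm, e₁, h.ker_left]; rfl
  set Φ : 𝕜 × H → 𝕜 × H := fun x => (m x, x.2) with hΦ
  have hΦg : GermAt 𝕜 r Φ 0 := by
    filter_upwards [hmg] with x hx using hx.prodMk contDiffAt_snd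
  let D : (𝕜 × H) →L[𝕜] 𝕜 × H := (fderiv 𝕜 m 0).prod (ContinuousLinearMap.snd 𝕜 𝕜 H)
  have hΦd : HasFDerivAt Φ D 0 :=
    (hmg.self_of_nhds.differentiableAt hrp).hasFDerivAt.prodMk hasFDerivAt_snd
  have hD : Function.Injective (D : (𝕜 × H) →ₗ[𝕜] 𝕜 × H) := by
    rw [injective_iff_map_eq_zero]
    intro x hx
    have h1 : fderiv 𝕜 m 0 x = 0 := congrArg Prod.fst hx
    have h2 : x.2 = 0 := congrArg Prod.snd hx
    have h3 : x = x.1 • ((1 : 𝕜), (0 : H)) := by ext <;> simp [h2]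
    rw [h3, map_smul, smul_eq_mul] at h1
    rw [h3, (mul_eq_zero.1 h1).resolve_right hd, zero_smul]
  let e : (𝕜 × H) ≃L[𝕜] 𝕜 × H := (LinearEquiv.ofInjectiveEndo _ hD).toContinuousLinearEquiv
  have he : (e : (𝕜 × H) →L[𝕜] 𝕜 × H) = D :=
    ContinuousLinearMap.ext fun x => rfl
  obtain ⟨Ψ, hs, hΨ, -, -⟩ := hΦg.exists_openPartialHomeomorph hr e (by rw [he]; exact hΦd)
  have hΨ0 : Ψ 0 = 0 := by rw [hΨ]; simp [hΦ, hm0]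
  have ht : (0 : 𝕜 × H) ∈ Ψ.target := by rw [← hΨ0]; exact Ψ.map_source hs
  have hsymm : Tendsto Ψ.symm (𝓝 0) (𝓝 0) := by
    have h1 := (Ψ.symm.continuousAt (by simpa using ht)).tendsto
    have h2 : Ψ.symm 0 = 0 := by conv_lhs => rw [← hΨ0]; exact Ψ.left_inv hs
    rwa [h2] at h1
  have hpt : ∀ᶠ q in 𝓝 (0 : H), m (0, q) = 0 := by
    have ev := (hb.eventually hframe).and (h.closed.alt.and h.degenerate)
    filter_upwards [tendsto_zero_pair.eventually (hsymm.eventually ev),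
      tendsto_zero_pair.eventually (Ψ.open_target.mem_nhds ht)] with q ⟨f1, f2, f3⟩ hq
    set x := Ψ.symm (0, q) with hx
    have h1 : Φ x = (0, q) := by rw [← hΨ]; exact Ψ.right_inv hq
    have h2 : m x = 0 := congrArg Prod.fst h1
    have h3 : x.2 = q := congrArg Prod.snd h1
    obtain ⟨-, f4, f5, -⟩ := f1 f2
    have h4 : κ₁ (b x) ≠ 0 := by
      intro h0
      have := (f5 1 0 (by rw [h0]; simp)).1
      exact one_ne_zero this
    have h5 := f3 _ h4 (f4 h2).1
    have h6 : x = (0, q) := by rw [← h3, ← h5]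
    rwa [h6] at h2
  refine ⟨fun q => κ₁ (b (0, q)), fun q => κ₂ (b (0, q)), ?_⟩
  have hi : GermAt 𝕜 r (fun q : H => ((0 : 𝕜), q)) 0 :=
    Eventually.of_forall fun q => contDiffAt_const.prodMk contDiffAt_id
  have hall : ∀ᶠ q in 𝓝 (0 : H), (b (0, q) (κ₁ (b (0, q))) = 0 ∧ b (0, q) (κ₂ (b (0, q))) = 0) ∧
      (∀ a c : 𝕜, a • κ₁ (b (0, q)) + c • κ₂ (b (0, q)) = 0 → a = 0 ∧ c = 0) ∧
      ∀ v, b (0, q) v = 0 → ∃ a c : 𝕜, v = a • κ₁ (b (0, q)) + c • κ₂ (b (0, q)) := by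
    filter_upwards [hpt, tendsto_zero_pair.eventually (hb.eventually hframe),
      tendsto_zero_pair.eventually h.closed.alt] with q h1 h2 h3
    exact (h2 h3).2.imp_left fun h4 => h4 h1
  exact
    { germ₁ := GermAt.comp (f := fun q : H => ((0 : 𝕜), q)) c₁ hi
      germ₂ := GermAt.comp (f := fun q : H => ((0 : 𝕜), q)) c₂ hi
      zero₁ := e₁
      zero₂ := e₂
      ker₁ := hall.mono fun q hq => hq.1.1
      ker₂ := hall.mono fun q hq => hq.1.2
      ind := hall.mono fun q hq => hq.2.1
      span := hall.mono fun q hq => hq.2.2 }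

variable {K₁ K₂ : H → 𝕜 × H}

/-- Differentiate the kernel equation along the hypersurface and pair with `y`. As `y` lies in the
kernel of the restriction at 0, only the normal component of the derivative of `K` survives. -/
lemma fderiv_of_kernel (hr : r = ∞ ∨ r = ω) (h : IsClosedTwoForm r b) {K : H → 𝕜 × H}
    (hK : GermAt 𝕜 r K 0) (hker : ∀ᶠ q in 𝓝 (0 : H), b (0, q) (K q) = 0) {y : H}
    (hy : ∀ w : H, b 0 (0, y) (0, w) = 0) (x : H) :
    fderiv 𝕜 b 0 (0, x) (K 0) (0, y) = -((fderiv 𝕜 K 0 x).1 * b 0 (1, 0) (0, y)) := by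
  have hrp : r ≠ 0 := by rcases hr with rfl | rfl <;> simp
  have hi : HasFDerivAt (fun q : H => ((0 : 𝕜), q)) (ContinuousLinearMap.inr 𝕜 𝕜 H) 0 :=
    (ContinuousLinearMap.inr 𝕜 𝕜 H).hasFDerivAt
  have hb : HasFDerivAt (fun q : H => b (0, q))
      ((fderiv 𝕜 b 0).comp (ContinuousLinearMap.inr 𝕜 𝕜 H)) 0 :=
    HasFDerivAt.comp (G := (𝕜 × H) →L[𝕜] (𝕜 × H) →L[𝕜] 𝕜) (g := b) (0 : H)
      (h.germ.self_of_nhds.differentiableAt hrp).hasFDerivAt hi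
  have h1 := (hasFDerivAt_bilin_comp (W := fun _ => ((0 : 𝕜), y)) hb.differentiableAt
    (hK.self_of_nhds.differentiableAt hrp) (differentiableAt_const _)).2 x
  have h2 : (fun q : H => b (0, q) (K q) (0, y)) =ᶠ[𝓝 0] fun _ => 0 := by
    filter_upwards [hker] with q hq
    rw [hq]; rfl
  rw [h2.fderiv_eq, hb.fderiv] at h1
  simp only [fderiv_fun_const, Pi.zero_apply, zero_apply, map_zero, add_zero,
    ContinuousLinearMap.comp_apply] at h1
  have h3 : b 0 (fderiv 𝕜 K 0 x) (0, y) = (fderiv 𝕜 K 0 x).1 * b 0 (1, 0) (0, y) := by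
    rw [bilin_prod, bilin_swap h.alt_zero (0, _), hy]; simp
  change 0 = fderiv 𝕜 b 0 (0, x) (K 0) (0, y) + b 0 (fderiv 𝕜 K 0 x) (0, y) at h1
  rw [h3] at h1
  linear_combination -h1

end Fold

/-! ### The kernel at the origin is determined by the restriction. -/

section FoldVariation

variable {𝕜 H : Type} [RCLike 𝕜] [NormedAddCommGroup H] [NormedSpace 𝕜 H] {r : WithTop ℕ∞}
variable {b b₀ b₁ : 𝕜 × H → (𝕜 × H) →L[𝕜] (𝕜 × H) →L[𝕜] 𝕜} {k₁ k₂ p k₁' k₂' p' : H}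

lemma map_eq_zero_of_mem_span_pair {E F : Type} [NormedAddCommGroup E] [NormedSpace 𝕜 E]
    [NormedAddCommGroup F] [NormedSpace 𝕜 F] {A : E →L[𝕜] F} {u v w : E} (hu : A u = 0)
    (hv : A v = 0) (hw : w ∈ Submodule.span 𝕜 {u, v}) : A w = 0 := by
  obtain ⟨a, c, rfl⟩ := Submodule.mem_span_pair.1 hw
  simp [hu, hv]

lemma eq_zero_of_tangent_of_normal {η : (𝕜 × H) →L[𝕜] (𝕜 × H) →L[𝕜] 𝕜} (h : ∀ v, η v v = 0)
    {y : H} (hy : ∀ w : H, η (0, y) (0, w) = 0) (hn : η (1, 0) (0, y) = 0) : η (0, y) = 0 := by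
  refine ContinuousLinearMap.ext fun x => ?_
  rw [bilin_swap h, bilin_prod, hn, bilin_swap h (0, x.2), hy]
  simp

/-- The kernel plane is isotropic for all tangential derivatives: by `fderiv_of_kernel`, the
derivative of a kernel field pairs to zero with a kernel vector. This is the constraint that makes
two different planes impossible. -/
lemma fderiv_eq_zero_of_mem_ker [FiniteDimensional 𝕜 H] (hr : r = ∞ ∨ r = ω)
    (h : IsFold r b k₁ k₂ p) {v w : H} (hv : b 0 (0, v) = 0) (hw : b 0 (0, w) = 0) (x : H) :
    fderiv 𝕜 b 0 (0, x) (0, v) (0, w) = 0 := by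
  obtain ⟨K₁, K₂, hK⟩ := h.exists_frame hr
  have halt := fderiv_bilin_alt (h.closed.germ.differentiableAt hr).self_of_nhds h.closed.alt
  have h1 := fderiv_of_kernel hr h.closed hK.germ₁ hK.ker₁ h.tangent_right x
  rw [hK.zero₁, h.normal_right, mul_zero, neg_zero] at h1
  have h2 := h.closed.fderiv_swap hr (0, x) (0, k₂) (0, k₁)
  obtain ⟨a, c, hac⟩ := Submodule.mem_span_pair.1 ((h.ker _).1 hv)
  obtain ⟨a', c', hac'⟩ := Submodule.mem_span_pair.1 ((h.ker _).1 hw)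
  rw [← hac, ← hac']
  simp only [map_add, map_smul, add_apply, smul_apply, halt, h1, h2]
  simp

/-- The derivatives of `b` along `{t = 0}`, restricted to the kernel of the restriction of `b 0`
to `{t = 0}`, span a space of dimension at least two. -/
def HasRankTwo (b : 𝕜 × H → (𝕜 × H) →L[𝕜] (𝕜 × H) →L[𝕜] 𝕜) : Prop :=
  ∀ ℓ : H →L[𝕜] 𝕜, ∃ x, ℓ x = 0 ∧ ∃ v w : H, (∀ z : H, b 0 (0, v) (0, z) = 0) ∧
    (∀ z : H, b 0 (0, w) (0, z) = 0) ∧ fderiv 𝕜 b 0 (0, x) (0, v) (0, w) ≠ 0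

/-- Tangential derivatives of tangential components see only the restriction, so the isotropic plane
of `b₁` imposes conditions on the derivatives of `b₀`. -/
lemma fderiv_restrict (hr : r = ∞ ∨ r = ω) (h₀ : IsClosedTwoForm r b₀) (h₁ : IsClosedTwoForm r b₁)
    (hres : ∀ᶠ q in 𝓝 (0 : H), ∀ v w : H, b₁ (0, q) (0, v) (0, w) = b₀ (0, q) (0, v) (0, w))
    (x v w : H) : fderiv 𝕜 b₁ 0 (0, x) (0, v) (0, w) = fderiv 𝕜 b₀ 0 (0, x) (0, v) (0, w) := by
  have key : ∀ b : 𝕜 × H → (𝕜 × H) →L[𝕜] (𝕜 × H) →L[𝕜] 𝕜, DifferentiableAt 𝕜 b 0 →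
      fderiv 𝕜 (fun q : H => b (0, q) (0, v) (0, w)) 0 x
        = fderiv 𝕜 b 0 (0, x) (0, v) (0, w) := by
    intro b hb
    obtain ⟨h1, h2⟩ := fderiv_bilin_dir hb ((0 : 𝕜), v) ((0 : 𝕜), w)
    rw [← h2]
    have h3 := HasFDerivAt.comp (0 : H) (f := fun q : H => ((0 : 𝕜), q))
      (g := fun x => b x (0, v) (0, w)) h1 (ContinuousLinearMap.inr 𝕜 𝕜 H).hasFDerivAt
    change HasFDerivAt (fun q : H => b (0, q) (0, v) (0, w)) _ _ at h3
    rw [h3.fderiv]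
    rfl
  rw [← key b₁ (h₁.germ.differentiableAt hr).self_of_nhds,
    ← key b₀ (h₀.germ.differentiableAt hr).self_of_nhds]
  refine congrArg (fun A : H →L[𝕜] 𝕜 => A x) (Filter.EventuallyEq.fderiv_eq ?_)
  filter_upwards [hres] with q hq using hq v w

/-- The kernel at `0` is determined by the restriction to `{t = 0}`. -/
lemma normal_eq_zero [FiniteDimensional 𝕜 H] (hr : r = ∞ ∨ r = ω) (h₀ : IsFold r b₀ k₁ k₂ p)
    (h₁ : IsFold r b₁ k₁' k₂' p')
    (hres : ∀ᶠ q in 𝓝 (0 : H), ∀ v w : H, b₁ (0, q) (0, v) (0, w) = b₀ (0, q) (0, v) (0, w))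
    (hR : HasRankTwo b₀) {y : H} (hy : ∀ w : H, b₀ 0 (0, y) (0, w) = 0)
    (hn : b₀ 0 (1, 0) (0, y) = 0) : b₁ 0 (1, 0) (0, y) = 0 := by
  -- Let W be the kernel of the common restriction at 0. If `y` lies in the plane `β₀ = 0` of W but
  -- not in the plane `β₁ = 0`, then some `s` lies in the second and not in the first, and W is
  -- spanned by `y`, `s` and the intersection. Both planes are isotropic for every `T x`, so `T x`
  -- is determined by the number `T x y s`.
  by_contra hne
  have hres0 : ∀ v w : H, b₁ 0 (0, v) (0, w) = b₀ 0 (0, v) (0, w) := hres.self_of_nhds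
  set β₀ : H →L[𝕜] 𝕜 := (b₀ 0 (1, 0)).comp (ContinuousLinearMap.inr 𝕜 𝕜 H) with hβ₀
  set β₁ : H →L[𝕜] 𝕜 := (b₁ 0 (1, 0)).comp (ContinuousLinearMap.inr 𝕜 𝕜 H) with hβ₁
  set T : H → H → H → 𝕜 := fun x v w => fderiv 𝕜 b₀ 0 (0, x) (0, v) (0, w) with hT
  have hp : β₀ p ≠ 0 := h₀.nontrivial
  have hyn : β₁ y ≠ 0 := hne
  have hy0 : β₀ y = 0 := hn
  set s := p - (β₁ p / β₁ y) • y with hs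
  have hs1 : β₁ s = 0 := by
    rw [hs, map_sub, map_smul, smul_eq_mul, div_mul_cancel₀ _ hyn, sub_self]
  have hs0 : β₀ s ≠ 0 := by rw [hs, map_sub, map_smul, hy0]; simpa using hp
  have hW : ∀ (v w : H) (c : 𝕜), (∀ z : H, b₀ 0 (0, v) (0, z) = 0) →
      (∀ z : H, b₀ 0 (0, w) (0, z) = 0) → ∀ z : H, b₀ 0 (0, v - c • w) (0, z) = 0 := by
    intro v w c hv hw z
    have e : ((0 : 𝕜), v - c • w) = (0, v) - c • (0, w) := by ext <;> simp
    rw [e, map_sub, map_smul, sub_apply, smul_apply, hv, hw]; simp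
  have hsW := hW p y (β₁ p / β₁ y) h₀.tangent hy
  rw [← hs] at hsW
  have i₀ : ∀ x v w, (∀ z : H, b₀ 0 (0, v) (0, z) = 0) → (∀ z : H, b₀ 0 (0, w) (0, z) = 0) →
      β₀ v = 0 → β₀ w = 0 → T x v w = 0 := fun x v w hv hw hv0 hw0 =>
    fderiv_eq_zero_of_mem_ker hr h₀
      (eq_zero_of_tangent_of_normal h₀.closed.alt_zero hv hv0)
      (eq_zero_of_tangent_of_normal h₀.closed.alt_zero hw hw0) x
  have i₁ : ∀ x v w, (∀ z : H, b₀ 0 (0, v) (0, z) = 0) → (∀ z : H, b₀ 0 (0, w) (0, z) = 0) →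
      β₁ v = 0 → β₁ w = 0 → T x v w = 0 := by
    intro x v w hv hw hv0 hw0
    rw [hT]
    dsimp only
    rw [← fderiv_restrict hr h₀.closed h₁.closed hres]
    exact fderiv_eq_zero_of_mem_ker hr h₁
      (eq_zero_of_tangent_of_normal h₁.closed.alt_zero (fun z => by rw [hres0]; exact hv z) hv0)
      (eq_zero_of_tangent_of_normal h₁.closed.alt_zero (fun z => by rw [hres0]; exact hw z) hw0) x
  have hdec : ∀ v, (∀ z : H, b₀ 0 (0, v) (0, z) = 0) → ∃ (v' : H) (c d : 𝕜),
      v = v' + c • y + d • s ∧ (∀ z : H, b₀ 0 (0, v') (0, z) = 0) ∧ β₀ v' = 0 ∧ β₁ v' = 0 := by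
    intro v hv
    refine ⟨v - (β₁ v / β₁ y) • y - (β₀ v / β₀ s) • s, β₁ v / β₁ y, β₀ v / β₀ s, by abel,
      hW _ _ _ (hW _ _ _ hv hy) hsW, ?_, ?_⟩
    · simp only [map_sub, map_smul, smul_eq_mul, hy0, div_mul_cancel₀ _ hs0]; ring
    · simp only [map_sub, map_smul, smul_eq_mul, hs1, div_mul_cancel₀ _ hyn]; ring
  have hTadd : ∀ x v v' w, T x (v + v') w = T x v w + T x v' w := by
    intro x v v' w
    have e : ((0 : 𝕜), v + v') = (0, v) + (0, v') := by ext <;> simp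
    simp only [hT, e, map_add, add_apply]
  have hTsmul : ∀ x (c : 𝕜) v w, T x (c • v) w = c * T x v w := by
    intro x c v w
    have e : ((0 : 𝕜), c • v) = c • (0, v) := by ext <;> simp
    simp only [hT, e, map_smul, smul_apply, smul_eq_mul]
  have hTswap : ∀ x v w, T x v w = - T x w v := fun x v w => h₀.closed.fderiv_swap hr _ _ _
  -- On the kernel of this covector the whole variation on W vanishes, against `HasRankTwo`.
  let ℓ : H →L[𝕜] 𝕜 := ((fderiv 𝕜 b₀ 0).flip (0, y)).flip (0, s) |>.comp
    (ContinuousLinearMap.inr 𝕜 𝕜 H)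
  obtain ⟨x, hx, v, w, hv, hw, hvw⟩ := hR ℓ
  have hx' : T x y s = 0 := hx
  apply hvw
  change T x v w = 0
  obtain ⟨v', c, d, rfl, hv1, hv2, hv3⟩ := hdec v hv
  obtain ⟨w', c', d', rfl, hw1, hw2, hw3⟩ := hdec w hw
  have hx'' : T x s y = 0 := by rw [hTswap, hx', neg_zero]
  have hyy : T x y y = 0 := i₀ x y y hy hy hy0 hy0
  have hss : T x s s = 0 := i₁ x s s hsW hsW hs1 hs1
  have hT1 : ∀ v, T x v (w' + c' • y + d' • s) = T x v w' + c' * T x v y + d' * T x v s := by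
    intro v
    rw [hTswap, hTadd, hTadd, hTsmul, hTsmul, hTswap x w', hTswap x y, hTswap x s]; ring
  rw [hTadd, hTadd, hTsmul, hTsmul, hT1, hT1, hT1, hx', hx'', hyy, hss,
    i₀ x v' w' hv1 hw1 hv2 hw2, i₀ x v' y hv1 hy hv2 hy0, i₁ x v' s hv1 hsW hv3 hs1,
    i₀ x y w' hy hw1 hy0 hw2, i₁ x s w' hsW hw1 hs1 hw3]
  ring

/-- Two fold forms with the same restriction to `{t = 0}` have the same kernel at `0`. -/
lemma IsFold.common_kernel [FiniteDimensional 𝕜 H] (hr : r = ∞ ∨ r = ω)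
    (h₀ : IsFold r b₀ k₁ k₂ p) (h₁ : IsFold r b₁ k₁' k₂' p')
    (hres : ∀ᶠ q in 𝓝 (0 : H), ∀ v w : H, b₁ (0, q) (0, v) (0, w) = b₀ (0, q) (0, v) (0, w))
    (hR : HasRankTwo b₀) : IsFold r b₁ k₁ k₂ p := by
  have hres0 : ∀ v w : H, b₁ 0 (0, v) (0, w) = b₀ 0 (0, v) (0, w) := hres.self_of_nhds
  have n₁ := normal_eq_zero hr h₀ h₁ hres hR h₀.tangent_left h₀.normal_left
  have n₂ := normal_eq_zero hr h₀ h₁ hres hR h₀.tangent_right h₀.normal_right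
  have e₁ : b₁ 0 (0, k₁) = 0 := eq_zero_of_tangent_of_normal h₁.closed.alt_zero
    (fun w => by rw [hres0]; exact h₀.tangent_left w) n₁
  have e₂ : b₁ 0 (0, k₂) = 0 := eq_zero_of_tangent_of_normal h₁.closed.alt_zero
    (fun w => by rw [hres0]; exact h₀.tangent_right w) n₂
  have hform : ∀ {y : H} {a c d : 𝕜}, y = a • k₁ + c • k₂ + d • p →
      b₁ 0 (1, 0) (0, y) = d * b₁ 0 (1, 0) (0, p) := by
    rintro y a c d rfl
    have e : ((0 : 𝕜), a • k₁ + c • k₂ + d • p) = a • (0, k₁) + c • (0, k₂) + d • (0, p) := by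
      ext <;> simp
    rw [e, map_add, map_add, map_smul, map_smul, map_smul, n₁, n₂]
    simp
  have hnt : b₁ 0 (1, 0) (0, p) ≠ 0 := by
    intro h0
    obtain ⟨a, c, d, hd⟩ := h₀.exists_eq_of_tangent
      (fun w => by rw [← hres0]; exact h₁.tangent w)
    exact h₁.nontrivial (by rw [hform hd, h0, mul_zero])
  refine ⟨h₁.closed, fun v => ⟨fun hv => ?_, fun hv => ?_⟩, h₀.ind,
    fun w => by rw [hres0]; exact h₀.tangent w, hnt, h₁.transverse, h₁.degenerate⟩
  · obtain ⟨α, α', hα⟩ := Submodule.mem_span_pair.1 ((h₁.ker v).1 hv)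
    have hv1 : v = (0, v.2) := by
      ext
      · rw [← hα]; simp
      · rfl
    rw [hv1] at hv
    obtain ⟨a, c, d, hd⟩ := h₀.exists_eq_of_tangent (y := v.2)
      (fun w => by rw [← hres0, hv]; rfl)
    have h3 : b₁ 0 (1, 0) (0, v.2) = 0 := by rw [bilin_swap h₁.closed.alt_zero, hv]; simp
    rw [hform hd] at h3
    rw [(mul_eq_zero.1 h3).resolve_right hnt, zero_smul, add_zero] at hd
    refine Submodule.mem_span_pair.2 ⟨a, c, ?_⟩
    rw [hv1, hd]
    ext <;> simp
  · exact map_eq_zero_of_mem_span_pair e₁ e₂ hv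

end FoldVariation

/-! ### Matching two fold forms at the origin by a shear. -/

section FoldEquivalence

variable {𝕜 H : Type} [RCLike 𝕜] [NormedAddCommGroup H] [NormedSpace 𝕜 H] {r : WithTop ℕ∞}
variable {b b₀ b₁ : 𝕜 × H → (𝕜 × H) →L[𝕜] (𝕜 × H) →L[𝕜] 𝕜} {k₁ k₂ p : H}

/-- The linear map `(t, q) ↦ (c t, q + t h)`. -/
def shear (c : 𝕜) (h : H) : (𝕜 × H) →L[𝕜] 𝕜 × H :=
  (c • ContinuousLinearMap.fst 𝕜 𝕜 H).prod
    (ContinuousLinearMap.snd 𝕜 𝕜 H + (ContinuousLinearMap.fst 𝕜 𝕜 H).smulRight h)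

lemma shear_apply (c : 𝕜) (h : H) (x : 𝕜 × H) : shear c h x = (c * x.1, x.2 + x.1 • h) := rfl

lemma shear_zero_pair (c : 𝕜) (h : H) (q : H) : shear c h (0, q) = (0, q) := by
  simp [shear_apply]

lemma shear_one_zero (c : 𝕜) (h : H) : shear c h (1, 0) = (c, h) := by
  simp [shear_apply]

lemma shear_injective {c : 𝕜} (hc : c ≠ 0) (h : H) :
    Function.Injective (shear c h : (𝕜 × H) →ₗ[𝕜] 𝕜 × H) := by
  rw [injective_iff_map_eq_zero]
  intro x hx
  have h1 : c * x.1 = 0 := congrArg Prod.fst hx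
  have h2 : x.2 + x.1 • h = 0 := congrArg Prod.snd hx
  have h3 := (mul_eq_zero.1 h1).resolve_left hc
  rw [h3, zero_smul, add_zero] at h2
  exact Prod.ext h3 h2

/-- The scalar `c` matches the contractions with the normal vector on `p`. The remaining mismatch is
a covector killing `k₁`, `k₂` and `p`, hence the kernel of the restriction, so it is a contraction
by some tangent vector `h`. -/
lemma exists_shear [FiniteDimensional 𝕜 H] (h₀ : IsFold r b₀ k₁ k₂ p) (h₁ : IsFold r b₁ k₁ k₂ p)
    (hres : ∀ v w : H, b₁ 0 (0, v) (0, w) = b₀ 0 (0, v) (0, w)) :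
    ∃ (c : 𝕜) (h : H), c ≠ 0 ∧ compBilin (b₁ 0) (shear c h) = b₀ 0 := by
  set c := b₀ 0 (1, 0) (0, p) / b₁ 0 (1, 0) (0, p) with hc
  let B : H →ₗ[𝕜] H →ₗ[𝕜] 𝕜 := LinearMap.mk₂ 𝕜 (fun v w => b₀ 0 (0, v) (0, w))
    (fun v v' w => by rw [show ((0 : 𝕜), v + v') = (0, v) + (0, v') by ext <;> simp, map_add]; rfl)
    (fun a v w => by rw [show ((0 : 𝕜), a • v) = a • (0, v) by ext <;> simp, map_smul]; rfl)
    (fun v w w' => by rw [show ((0 : 𝕜), w + w') = (0, w) + (0, w') by ext <;> simp, map_add])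
    (fun a v w => by rw [show ((0 : 𝕜), a • w) = a • (0, w) by ext <;> simp, map_smul])
  have hB : ∀ v w, B v w = b₀ 0 (0, v) (0, w) := fun v w => rfl
  let ξ : H →L[𝕜] 𝕜 := (b₀ 0 (1, 0) - c • b₁ 0 (1, 0)).comp (ContinuousLinearMap.inr 𝕜 𝕜 H)
  have hξ : ∀ v, ξ v = b₀ 0 (1, 0) (0, v) - c * b₁ 0 (1, 0) (0, v) := fun v => rfl
  obtain ⟨h, hh⟩ := exists_contraction_eq B (fun v => h₀.closed.alt_zero _) (ξ : H →ₗ[𝕜] 𝕜) (by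
    intro v hv
    obtain ⟨a, a', d, rfl⟩ := h₀.exists_eq_of_tangent (fun w => LinearMap.congr_fun hv w)
    have e₁ : ξ k₁ = 0 := by rw [hξ, h₀.normal_left, h₁.normal_left]; ring
    have e₂ : ξ k₂ = 0 := by rw [hξ, h₀.normal_right, h₁.normal_right]; ring
    have e₃ : ξ p = 0 := by rw [hξ, hc, div_mul_cancel₀ _ h₁.nontrivial, sub_self]
    simp [e₁, e₂, e₃])
  have hh' : ∀ w, b₀ 0 (0, h) (0, w) = b₀ 0 (1, 0) (0, w) - c * b₁ 0 (1, 0) (0, w) := fun w =>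
    (LinearMap.congr_fun hh w).trans (hξ w)
  refine ⟨c, h, div_ne_zero h₀.nontrivial h₁.nontrivial, ?_⟩
  have hn : ∀ w : H, b₁ 0 (c, h) (0, w) = b₀ 0 (1, 0) (0, w) := by
    intro w
    rw [bilin_prod, hres, hh']
    ring
  refine ContinuousLinearMap.ext fun v => ContinuousLinearMap.ext fun w => ?_
  rw [compBilin_apply]
  have hsplit : ∀ v : 𝕜 × H, shear c h v = v.1 • (c, h) + (0, v.2) := by
    intro v
    rw [shear_apply]
    ext
    · simp [mul_comm]
    · simp [add_comm]
  have hsplit' : ∀ v : 𝕜 × H, v = v.1 • (1, 0) + (0, v.2) := by intro v; ext <;> simp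
  rw [hsplit v, hsplit w]
  conv_rhs => rw [hsplit' v, hsplit' w]
  simp only [map_add, map_smul, add_apply, smul_apply, hn, hres, h₀.closed.alt_zero,
    h₁.closed.alt_zero]
  rw [bilin_swap h₁.closed.alt_zero (0, v.2), hn, bilin_swap h₀.closed.alt_zero (0, v.2) (1, 0)]

lemma pullbackBilin_clm (A : (𝕜 × H) →L[𝕜] 𝕜 × H) (x : 𝕜 × H) :
    pullbackBilin A b x = compBilin (b (A x)) A := by
  rw [pullbackBilin, A.fderiv]

lemma fderiv_pullbackBilin_clm (hr : r = ∞ ∨ r = ω) (hb : IsClosedTwoForm r b)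
    (A : (𝕜 × H) →L[𝕜] 𝕜 × H) (u v w : 𝕜 × H) :
    fderiv 𝕜 (pullbackBilin A b) 0 u v w = fderiv 𝕜 b 0 (A u) (A v) (A w) := by
  have hA : GermAt 𝕜 r A 0 := Eventually.of_forall fun x => A.contDiff.contDiffAt
  have h1 : fderiv 𝕜 A = fun _ => A := funext fun x => A.fderiv
  rw [fderiv_pullbackBilin (by rw [map_zero]; exact (hb.germ.differentiableAt hr).self_of_nhds)
    A.differentiableAt (by rw [h1]; exact differentiableAt_const _)
    ((hb.pullback hr hA (map_zero A)).germ.differentiableAt hr).self_of_nhds]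
  rw [h1]
  simp

/-- The pullback of a fold form under a shear. -/
lemma IsFold.pullback_shear (hr : r = ∞ ∨ r = ω) (h₀ : IsFold r b₀ k₁ k₂ p)
    (h₁ : IsFold r b₁ k₁ k₂ p) {c : 𝕜} {h : H} (hc : c ≠ 0)
    (hs : compBilin (b₁ 0) (shear c h) = b₀ 0)
    (hiso : ∀ x : H, fderiv 𝕜 b₁ 0 (0, x) (0, k₁) (0, k₂) = 0) :
    IsFold r (pullbackBilin (shear c h) b₁) k₁ k₂ p := by
  have h00 : pullbackBilin (shear c h) b₁ 0 = b₀ 0 := by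
    rw [pullbackBilin_clm, map_zero, hs]
  have hA : GermAt 𝕜 r (shear c h) 0 :=
    Eventually.of_forall fun x => (shear c h).contDiff.contDiffAt
  refine ⟨h₁.closed.pullback hr hA (map_zero _), by rw [h00]; exact h₀.ker, h₀.ind,
    by rw [h00]; exact h₀.tangent, by rw [h00]; exact h₀.nontrivial,
    ⟨(0, k₁), (0, k₂), by rw [h00]; exact h₀.ker_left, by rw [h00]; exact h₀.ker_right, ?_⟩, ?_⟩
  · rw [fderiv_pullbackBilin_clm hr h₁.closed, shear_one_zero, shear_zero_pair, shear_zero_pair]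
    -- By `hiso` the tangential part `h` contributes nothing, so the normal derivative is only
    -- rescaled by `c`.
    have e : (c, h) = c • ((1 : 𝕜), (0 : H)) + (0, h) := by ext <;> simp
    rw [e, map_add, map_smul, add_apply, add_apply, hiso, smul_apply, smul_apply, add_zero]
    exact smul_ne_zero hc (h₁.transverse_frame hr)
  · have ht : Tendsto (shear c h) (𝓝 0) (𝓝 0) := by
      simpa using (shear c h).continuous.tendsto 0
    filter_upwards [ht.eventually h₁.degenerate] with x hx v hv hv0
    have hv' : shear c h v ≠ 0 := fun h0 => hv (shear_injective hc h (h0.trans (map_zero _).symm))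
    have := hx _ hv' (by
      refine ContinuousLinearMap.ext fun w => ?_
      obtain ⟨w', rfl⟩ : ∃ w', shear c h w' = w := by
        refine ⟨(c⁻¹ * w.1, w.2 - (c⁻¹ * w.1) • h), ?_⟩
        rw [shear_apply]
        ext
        · simp [hc]
        · simp
      rw [pullbackBilin_clm] at hv0
      exact congrArg (fun A : (𝕜 × H) →L[𝕜] 𝕜 => A w') hv0)
    exact (mul_eq_zero.1 this).resolve_left hc

end FoldEquivalence

/-! ### Common kernel vectors and a lemma on products of linear forms. -/

section FirstOrder

variable {𝕜 H : Type} [RCLike 𝕜] [NormedAddCommGroup H] [NormedSpace 𝕜 H] {r : WithTop ℕ∞}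
variable {b b₀ b₁ : 𝕜 × H → (𝕜 × H) →L[𝕜] (𝕜 × H) →L[𝕜] 𝕜} {k₁ k₂ p : H}

lemma bilin_zero_pair {η₀ η₁ : (𝕜 × H) →L[𝕜] (𝕜 × H) →L[𝕜] 𝕜}
    (hres : ∀ v w : H, η₁ (0, v) (0, w) = η₀ (0, v) (0, w)) (h₁ : ∀ v, η₁ v v = 0)
    {v : 𝕜 × H} (hv : v.1 = 0) (h0 : η₀ v = 0) (hn : η₁ (1, 0) v = 0) : η₁ v = 0 := by
  obtain ⟨t, v⟩ := v
  obtain rfl : t = 0 := hv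
  exact eq_zero_of_tangent_of_normal h₁ (fun w => by rw [hres, h0]; rfl) hn

/-- The tangent kernel vectors of two forms with the same restriction to `{t = 0}`. -/
lemma kernel_combination {η₀ η₁ : (𝕜 × H) →L[𝕜] (𝕜 × H) →L[𝕜] 𝕜}
    (hres : ∀ v w : H, η₁ (0, v) (0, w) = η₀ (0, v) (0, w)) (h₀ : ∀ v, η₀ v v = 0)
    {u₁ u₂ w₁ w₂ : 𝕜 × H} (hu₁ : η₀ u₁ = 0) (hu₂ : η₀ u₂ = 0)
    (hspan : ∀ v, η₀ v = 0 → ∃ a c : 𝕜, v = a • u₁ + c • u₂) (hw₁ : η₁ w₁ = 0) (hw₂ : η₁ w₂ = 0)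
    (hw : ∀ a c : 𝕜, a • w₁ + c • w₂ = 0 → a = 0 ∧ c = 0) :
    η₁ (u₂.1 • u₁ - u₁.1 • u₂) = 0 := by
  by_cases hX : u₁.1 = 0 ∧ u₂.1 = 0
  · rw [hX.1, hX.2, zero_smul, zero_smul, sub_zero, map_zero]
  -- The plane spanned by `w₁`, `w₂` meets the tangent hyperplane in a nonzero vector `y`.
  obtain ⟨y, hy0, hy1, hy⟩ : ∃ y, y ≠ 0 ∧ y.1 = 0 ∧ η₁ y = 0 := by
    by_cases hY : w₂.1 = 0
    · refine ⟨w₂, fun h0 => ?_, hY, hw₂⟩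
      exact one_ne_zero (hw 0 1 (by rw [h0]; simp)).2
    · refine ⟨w₂.1 • w₁ + (-w₁.1) • w₂, fun h0 => hY (hw _ _ h0).1, by simp; ring, ?_⟩
      exact map_eq_zero_of_mem_span_pair hw₁ hw₂ (Submodule.mem_span_pair.2 ⟨_, _, rfl⟩)
  -- A kernel vector `u` of η₀ transverse to the hyperplane gives 0 = η₀(u, y) = u.1 η₀((1, 0), y),
  -- because the tangential part is computed by η₁ and `y` is in its kernel.
  have hn : η₀ (1, 0) y = 0 := by
    have h1 : ∀ u, η₀ u = 0 → u.1 ≠ 0 → η₀ (1, 0) y = 0 := by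
      intro u hu hu1
      have h2 : η₀ u y = 0 := by rw [hu]; rfl
      rw [bilin_prod] at h2
      have h3 : η₀ (0, u.2) y = 0 := by
        have : y = (0, y.2) := Prod.ext hy1 rfl
        rw [this, bilin_swap h₀, ← hres, ← this, hy]
        simp
      rw [h3, add_zero] at h2
      exact (mul_eq_zero.1 h2).resolve_left hu1
    by_cases hu : u₁.1 = 0
    · exact h1 u₂ hu₂ fun h => hX ⟨hu, h⟩
    · exact h1 u₁ hu₁ hu
  have hy' : η₀ y = 0 := bilin_zero_pair (fun v w => (hres v w).symm) h₀ hy1 hy hn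
  obtain ⟨a, c, hac⟩ := hspan y hy'
  have hlin : a * u₁.1 + c * u₂.1 = 0 := by rw [← hy1, hac]; simp
  -- The tangent vectors of the plane spanned by `u₁`, `u₂` form a line in the present case, so the
  -- combination is a multiple of `y`.
  have hmul : ∃ d : 𝕜, u₂.1 • u₁ - u₁.1 • u₂ = d • y := by
    by_cases hu : u₁.1 = 0
    · have hu' : u₂.1 ≠ 0 := fun h => hX ⟨hu, h⟩
      rw [hu, mul_zero, zero_add] at hlin
      have hc := (mul_eq_zero.1 hlin).resolve_right hu'
      have ha : a ≠ 0 := fun h => hy0 (by rw [hac, h, hc]; simp)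
      refine ⟨u₂.1 / a, ?_⟩
      rw [hac, hc, hu, zero_smul 𝕜 u₂, sub_zero, add_zero, smul_smul, div_mul_cancel₀ _ ha]
    · have hc : c ≠ 0 := by
        intro h
        rw [h, zero_mul, add_zero] at hlin
        have ha := (mul_eq_zero.1 hlin).resolve_right hu
        exact hy0 (by rw [hac, h, ha]; simp)
      refine ⟨-u₁.1 / c, ?_⟩
      rw [hac, smul_add, smul_smul, smul_smul, div_mul_cancel₀ _ hc]
      have h3 : -u₁.1 / c * a = u₂.1 := by
        field_simp
        linear_combination -hlin
      rw [h3, neg_smul, sub_eq_add_neg]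
  obtain ⟨d, hd⟩ := hmul
  rw [hd]
  exact map_eq_zero_of_mem_span_pair hy hy (Submodule.mem_span_pair.2 ⟨d, 0, by simp⟩)

/-- If the kernel plane of η₀ is tangent, belonging to the kernel of η₁ is one linear condition on
it, with a nonzero solution. Otherwise the combination in `hX` is itself nonzero. The vector found
is killed by every form on the line through η₀ and η₁. -/
lemma exists_common_kernel {η₀ η₁ : (𝕜 × H) →L[𝕜] (𝕜 × H) →L[𝕜] 𝕜}
    (hres : ∀ v w : H, η₁ (0, v) (0, w) = η₀ (0, v) (0, w)) (h₁ : ∀ v, η₁ v v = 0)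
    {u₁ u₂ : 𝕜 × H} (hu₁ : η₀ u₁ = 0) (hu₂ : η₀ u₂ = 0)
    (hu : ∀ a c : 𝕜, a • u₁ + c • u₂ = 0 → a = 0 ∧ c = 0)
    (hX : η₁ (u₂.1 • u₁ - u₁.1 • u₂) = 0) : ∃ v, v ≠ 0 ∧ η₀ v = 0 ∧ η₁ v = 0 := by
  have hcomb : ∀ a c : 𝕜, η₀ (a • u₁ + c • u₂) = 0 := fun a c =>
    map_eq_zero_of_mem_span_pair hu₁ hu₂ (Submodule.mem_span_pair.2 ⟨a, c, rfl⟩)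
  by_cases h0 : u₁.1 = 0 ∧ u₂.1 = 0
  · obtain ⟨a, c, hac, hn⟩ : ∃ a c : 𝕜, ¬ (a = 0 ∧ c = 0) ∧
        η₁ (1, 0) (a • u₁ + c • u₂) = 0 := by
      by_cases h : η₁ (1, 0) u₂ = 0
      · exact ⟨0, 1, by simp, by simp [h]⟩
      · refine ⟨η₁ (1, 0) u₂, -η₁ (1, 0) u₁, fun h' => h h'.1, ?_⟩
        rw [map_add, map_smul, map_smul, smul_eq_mul, smul_eq_mul]; ring
    refine ⟨a • u₁ + c • u₂, fun h => hac (hu _ _ h), hcomb a c,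
      bilin_zero_pair hres h₁ ?_ (hcomb a c) hn⟩
    simp [h0.1, h0.2]
  · refine ⟨u₂.1 • u₁ - u₁.1 • u₂, fun h => h0 ?_, ?_, hX⟩
    · rw [sub_eq_add_neg, ← neg_smul] at h
      have := hu _ _ h
      exact ⟨neg_eq_zero.1 this.2, this.1⟩
    · rw [sub_eq_add_neg, ← neg_smul]; exact hcomb _ _

lemma hasFDerivAt_apply_const {E F : Type} [NormedAddCommGroup E] [NormedSpace 𝕜 E]
    [NormedAddCommGroup F] [NormedSpace 𝕜 F] {f : H → E →L[𝕜] F} {x : H}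
    (hf : DifferentiableAt 𝕜 f x) (v : E) :
    HasFDerivAt (fun x => f x v) ((fderiv 𝕜 f x).flip v) x := by
  convert hf.hasFDerivAt.clm_apply (hasFDerivAt_const v x) using 1
  ext u
  simp

/-- This is the second-order coefficient of `f (X)` when both factors vanish at 0; taking the
product of two slopes requires only first derivatives. -/
lemma clm_apply_fderiv_eq_zero {E F : Type} [NormedAddCommGroup E] [NormedSpace 𝕜 E]
    [NormedAddCommGroup F] [NormedSpace 𝕜 F] {f : H → E →L[𝕜] F} {X : H → E}
    (hf : DifferentiableAt 𝕜 f 0) (hX : DifferentiableAt 𝕜 X 0) (f0 : f 0 = 0) (X0 : X 0 = 0)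
    (h : ∀ᶠ q in 𝓝 (0 : H), f q (X q) = 0) (x : H) :
    fderiv 𝕜 f 0 x (fderiv 𝕜 X 0 x) = 0 := by
  have hline : HasDerivAt (fun t : 𝕜 => t • x) x 0 := by
    simpa using (hasDerivAt_id (0 : 𝕜)).smul_const x
  have hf1 : HasDerivAt (fun t : 𝕜 => f (t • x)) (fderiv 𝕜 f 0 x) 0 :=
    HasFDerivAt.comp_hasDerivAt (0 : 𝕜) (by rw [zero_smul]; exact hf.hasFDerivAt) hline
  have hX1 : HasDerivAt (fun t : 𝕜 => X (t • x)) (fderiv 𝕜 X 0 x) 0 :=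
    HasFDerivAt.comp_hasDerivAt (0 : 𝕜) (by rw [zero_smul]; exact hX.hasFDerivAt) hline
  have s1 := hf1.tendsto_slope_zero
  have s2 := hX1.tendsto_slope_zero
  simp only [zero_add, zero_smul, f0, X0, sub_zero] at s1 s2
  have s3 := (isBoundedBilinearMap_apply.continuous.tendsto
    (fderiv 𝕜 f 0 x, fderiv 𝕜 X 0 x)).comp (s1.prodMk_nhds s2)
  have ht : Tendsto (fun t : 𝕜 => t • x) (𝓝[≠] 0) (𝓝 0) := by
    have := hline.continuousAt.tendsto
    rw [zero_smul] at this
    exact this.mono_left nhdsWithin_le_nhds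
  refine tendsto_nhds_unique s3 (tendsto_const_nhds.congr' ?_)
  filter_upwards [ht.eventually h] with t hq
  simp only [Function.comp_apply, smul_apply, map_smul, hq, smul_zero]

/-- As `a` and `c` are independent, the identity c p = a q forces p = λ a and q = λ c with a common
scalar, whence p(v) = λ a(v) = λ c(u) = q(u). Polarisation avoids naming λ. -/
lemma apply_eq_of_quadratic {a c p q : H →L[𝕜] 𝕜} (h : ∀ x, c x * p x = a x * q x) {y₁ y₂ : H}
    (h1 : a y₁ = 1) (h2 : c y₁ = 0) (h3 : a y₂ = 0) (h4 : c y₂ = 1) {u v : H} (huv : a v = c u) :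
    p v = q u := by
  have hpol : ∀ x y, c x * p y + c y * p x = a x * q y + a y * q x := by
    intro x y
    have := h (x + y)
    simp only [map_add] at this
    linear_combination this - h x - h y
  have e1 := h y₁
  have e2 := h y₂
  rw [h1, h2] at e1
  rw [h3, h4] at e2
  have e3 := hpol v y₂
  have e4 := hpol u y₁
  have e5 := hpol y₁ y₂
  rw [h3, h4] at e3
  rw [h1, h2] at e4
  rw [h1, h2, h3, h4] at e5
  linear_combination e3 + e4 - c v * e2 - a u * e1 + (huv * q y₂) - c u * e5
end FirstOrder

/-! ### Normal components of the derivatives of the kernel frame. -/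

section Dual

variable {𝕜 H : Type} [RCLike 𝕜] [NormedAddCommGroup H] [NormedSpace 𝕜 H] {r : WithTop ℕ∞}
variable {b b₀ b₁ : 𝕜 × H → (𝕜 × H) →L[𝕜] (𝕜 × H) →L[𝕜] 𝕜} {k₁ k₂ p : H} {K₁ K₂ : H → 𝕜 × H}

/-- Evaluate closedness on `k₁`, `k₂`, `p`: the derivative along `p` vanishes by isotropy, and the
other two terms are the normal components times the nonzero number `b 0 (1, 0) (0, p)`. -/
lemma IsKernelFrame.normal_symm (hr : r = ∞ ∨ r = ω) (h : IsFold r b k₁ k₂ p)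
    (hK : IsKernelFrame r b k₁ k₂ K₁ K₂) :
    (fderiv 𝕜 K₁ 0 k₂).1 = (fderiv 𝕜 K₂ 0 k₁).1 := by
  have d₁ := fderiv_of_kernel hr h.closed hK.germ₁ hK.ker₁ h.tangent
  have d₂ := fderiv_of_kernel hr h.closed hK.germ₂ hK.ker₂ h.tangent
  have d₃ := fderiv_of_kernel hr h.closed hK.germ₁ hK.ker₁ h.tangent_right
  simp only [hK.zero₁, hK.zero₂, h.normal_right] at d₁ d₂ d₃
  have hc := h.closed.closed.self_of_nhds (0, k₁) (0, k₂) (0, p)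
  rw [d₁, d₂, d₃] at hc
  refine mul_right_cancel₀ h.nontrivial ?_
  linear_combination hc

/-- Where both normal components vanish, every tangential derivative of `b` on the kernel of the
restriction vanishes too. Rank two therefore makes the two normal components linearly independent
covectors. -/
lemma IsKernelFrame.exists_dual (hr : r = ∞ ∨ r = ω) (h : IsFold r b k₁ k₂ p)
    (hK : IsKernelFrame r b k₁ k₂ K₁ K₂) (hR : HasRankTwo b) :
    ∃ y₁ y₂, (fderiv 𝕜 K₁ 0 y₁).1 = 1 ∧ (fderiv 𝕜 K₂ 0 y₁).1 = 0 ∧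
      (fderiv 𝕜 K₁ 0 y₂).1 = 0 ∧ (fderiv 𝕜 K₂ 0 y₂).1 = 1 := by
  have halt := fderiv_bilin_alt (h.closed.germ.differentiableAt hr).self_of_nhds h.closed.alt
  have key : ∀ x, (fderiv 𝕜 K₁ 0 x).1 = 0 → (fderiv 𝕜 K₂ 0 x).1 = 0 → ∀ v w : H,
      (∀ z : H, b 0 (0, v) (0, z) = 0) → (∀ z : H, b 0 (0, w) (0, z) = 0) →
      fderiv 𝕜 b 0 (0, x) (0, v) (0, w) = 0 := by
    intro x h1 h2 v w hv hw
    have d₁ : ∀ y : H, (∀ z : H, b 0 (0, y) (0, z) = 0) →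
        fderiv 𝕜 b 0 (0, x) (0, k₁) (0, y) = 0 := by
      intro y hy
      have := fderiv_of_kernel hr h.closed hK.germ₁ hK.ker₁ hy x
      rwa [hK.zero₁, h1, zero_mul, neg_zero] at this
    have d₂ : ∀ y : H, (∀ z : H, b 0 (0, y) (0, z) = 0) →
        fderiv 𝕜 b 0 (0, x) (0, k₂) (0, y) = 0 := by
      intro y hy
      have := fderiv_of_kernel hr h.closed hK.germ₂ hK.ker₂ hy x
      rwa [hK.zero₂, h2, zero_mul, neg_zero] at this
    have hpw : fderiv 𝕜 b 0 (0, x) (0, p) (0, w) = 0 := by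
      obtain ⟨a, c, d, rfl⟩ := h.exists_eq_of_tangent hw
      have e : ((0 : 𝕜), a • k₁ + c • k₂ + d • p) = a • (0, k₁) + c • (0, k₂) + d • (0, p) := by
        ext <;> simp
      rw [e]
      simp only [map_add, map_smul, halt, h.closed.fderiv_swap hr (0, x) (0, p) (0, k₁),
        h.closed.fderiv_swap hr (0, x) (0, p) (0, k₂), d₁ p h.tangent, d₂ p h.tangent]
      simp
    obtain ⟨a, c, d, rfl⟩ := h.exists_eq_of_tangent hv
    have e : ((0 : 𝕜), a • k₁ + c • k₂ + d • p) = a • (0, k₁) + c • (0, k₂) + d • (0, p) := by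
      ext <;> simp
    rw [e]
    simp only [map_add, map_smul, add_apply, smul_apply, d₁ w hw, d₂ w hw, hpw]
    simp
  set A₁ : H →L[𝕜] 𝕜 := (ContinuousLinearMap.fst 𝕜 𝕜 H).comp (fderiv 𝕜 K₁ 0) with hA₁
  set A₂ : H →L[𝕜] 𝕜 := (ContinuousLinearMap.fst 𝕜 𝕜 H).comp (fderiv 𝕜 K₂ 0) with hA₂
  obtain ⟨x₁, hx₁, v₁, w₁, hv₁, hw₁, hne₁⟩ := hR A₂
  obtain ⟨x₂, hx₂, v₂, w₂, hv₂, hw₂, hne₂⟩ := hR A₁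
  have n₁ : A₁ x₁ ≠ 0 := fun h0 => hne₁ (key x₁ h0 hx₁ v₁ w₁ hv₁ hw₁)
  have n₂ : A₂ x₂ ≠ 0 := fun h0 => hne₂ (key x₂ hx₂ h0 v₂ w₂ hv₂ hw₂)
  have g : ∀ (A : H →L[𝕜] 𝕜) (x : H) (c : 𝕜), A (c • x) = c * A x := fun A x c => by simp
  refine ⟨(A₁ x₁)⁻¹ • x₁, (A₂ x₂)⁻¹ • x₂, ?_, ?_, ?_, ?_⟩
  · exact (g A₁ _ _).trans (inv_mul_cancel₀ n₁)
  · exact (g A₂ _ _).trans (by rw [hx₁, mul_zero])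
  · exact (g A₁ _ _).trans (by rw [hx₂, mul_zero])
  · exact (g A₂ _ _).trans (inv_mul_cancel₀ n₂)

end Dual

/-! ### Equivalence of fold forms with equal restriction. -/

section FoldTheorem

variable {𝕜 H : Type} [RCLike 𝕜] [NormedAddCommGroup H] [NormedSpace 𝕜 H] {r : WithTop ℕ∞}
variable {b b₀ b₁ : 𝕜 × H → (𝕜 × H) →L[𝕜] (𝕜 × H) →L[𝕜] 𝕜} {k₁ k₂ p : H} {K₁ K₂ : H → 𝕜 × H}

/-- The tangent kernel vectors of `b₀` along `{t = 0}` are kernel vectors of `b₁`. -/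
lemma IsKernelFrame.eventually_mem_ker {K₁' K₂' : H → 𝕜 × H} (h₀ : IsClosedTwoForm r b₀)
    (hK : IsKernelFrame r b₀ k₁ k₂ K₁ K₂) (hK' : IsKernelFrame r b₁ k₁ k₂ K₁' K₂')
    (hres : ∀ᶠ q in 𝓝 (0 : H), ∀ v w : H, b₁ (0, q) (0, v) (0, w) = b₀ (0, q) (0, v) (0, w)) :
    ∀ᶠ q in 𝓝 (0 : H), b₁ (0, q) ((K₂ q).1 • K₁ q - (K₁ q).1 • K₂ q) = 0 := by
  filter_upwards [tendsto_zero_pair.eventually h₀.alt, hres, hK.ker₁, hK.ker₂, hK.span, hK'.ker₁,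
    hK'.ker₂, hK'.ind] with q a0 x1 x2 x3 x4 x5 x6 x7
  exact kernel_combination x1 a0 x2 x3 x4 x5 x6 x7

/-- The first order terms in the normal direction agree. -/
lemma fderiv_normal_eq [FiniteDimensional 𝕜 H] (hr : r = ∞ ∨ r = ω)
    (h₀ : IsFold r b₀ k₁ k₂ p) (h₁ : IsFold r b₁ k₁ k₂ p) (h00 : b₁ 0 = b₀ 0)
    (hres : ∀ᶠ q in 𝓝 (0 : H), ∀ v w : H, b₁ (0, q) (0, v) (0, w) = b₀ (0, q) (0, v) (0, w))
    (hR : HasRankTwo b₀) :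
    fderiv 𝕜 b₁ 0 (1, 0) (0, k₁) (0, k₂) = fderiv 𝕜 b₀ 0 (1, 0) (0, k₁) (0, k₂) := by
  have hrp : r ≠ 0 := by rcases hr with rfl | rfl <;> simp
  obtain ⟨K₁, K₂, hK⟩ := h₀.exists_frame hr
  obtain ⟨K₁', K₂', hK'⟩ := h₁.exists_frame hr
  have hX := hK.eventually_mem_ker h₀.closed hK' hres
  have dK₁ := hK.germ₁.self_of_nhds.differentiableAt hrp
  have dK₂ := hK.germ₂.self_of_nhds.differentiableAt hrp
  have hδ := h₁.closed.sub hr h₀.closed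
  set δ : 𝕜 × H → (𝕜 × H) →L[𝕜] (𝕜 × H) →L[𝕜] 𝕜 := fun x => b₁ x - b₀ x with hδdef
  have dδ := hδ.germ.self_of_nhds.differentiableAt hrp
  -- This combination has no normal component, so it is annihilated by both forms along the
  -- hypersurface.
  set X : H → 𝕜 × H := fun q => (K₂ q).1 • K₁ q - (K₁ q).1 • K₂ q with hXdef
  set f : H → (𝕜 × H) →L[𝕜] 𝕜 := fun q => δ (0, q) (1, 0) with hf
  have hfd : HasFDerivAt f (((fderiv 𝕜 δ 0).flip (1, 0)).comp
      (ContinuousLinearMap.inr 𝕜 𝕜 H)) 0 := by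
    have h1 : HasFDerivAt (fun x => δ x (1, 0)) ((fderiv 𝕜 δ 0).flip (1, 0)) (0 : 𝕜 × H) :=
      hasFDerivAt_apply_const dδ _
    exact HasFDerivAt.comp (g := fun x => δ x (1, 0)) (0 : H) h1
      (ContinuousLinearMap.inr 𝕜 𝕜 H).hasFDerivAt
  have hXd : ∀ x, fderiv 𝕜 X 0 x
      = (fderiv 𝕜 K₂ 0 x).1 • (0, k₁) - (fderiv 𝕜 K₁ 0 x).1 • (0, k₂) := by
    intro x
    have e₁ : HasFDerivAt (fun q => (K₁ q).1)
        ((ContinuousLinearMap.fst 𝕜 𝕜 H).comp (fderiv 𝕜 K₁ 0)) 0 :=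
      HasFDerivAt.comp (0 : H) (hasFDerivAt_fst (p := K₁ 0)) dK₁.hasFDerivAt
    have e₂ : HasFDerivAt (fun q => (K₂ q).1)
        ((ContinuousLinearMap.fst 𝕜 𝕜 H).comp (fderiv 𝕜 K₂ 0)) 0 :=
      HasFDerivAt.comp (0 : H) (hasFDerivAt_fst (p := K₂ 0)) dK₂.hasFDerivAt
    have e₃ : HasFDerivAt X _ 0 := (e₂.smul dK₁.hasFDerivAt).sub (e₁.smul dK₂.hasFDerivAt)
    rw [e₃.fderiv]
    simp [hK.zero₁, hK.zero₂]
  have hXdiff : DifferentiableAt 𝕜 X 0 := by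
    have e₁ : DifferentiableAt 𝕜 (fun q => (K₁ q).1) 0 := dK₁.fst
    have e₂ : DifferentiableAt 𝕜 (fun q => (K₂ q).1) 0 := dK₂.fst
    exact (e₂.smul dK₁).sub (e₁.smul dK₂)
  have hzero : ∀ᶠ q in 𝓝 (0 : H), f q (X q) = 0 := by
    filter_upwards [hX, hK.ker₁, hK.ker₂, tendsto_zero_pair.eventually h₀.closed.alt,
      tendsto_zero_pair.eventually h₁.closed.alt] with q x1 x2 x3 x4 x5
    have x6 : b₀ (0, q) (X q) = 0 := by
      rw [hXdef]
      dsimp only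
      rw [sub_eq_add_neg, ← neg_smul]
      exact map_eq_zero_of_mem_span_pair x2 x3 (Submodule.mem_span_pair.2 ⟨_, _, rfl⟩)
    change b₁ (0, q) (1, 0) (X q) - b₀ (0, q) (1, 0) (X q) = 0
    rw [bilin_swap x5, bilin_swap x4, x1, x6]
    simp
  -- Both `f` and `X` vanish at 0, so the second-order part of `f (X) = 0` is an equality between
  -- products of linear forms.
  have hquad : ∀ x, (fderiv 𝕜 K₂ 0 x).1 * fderiv 𝕜 δ 0 (0, x) (1, 0) (0, k₁)
      = (fderiv 𝕜 K₁ 0 x).1 * fderiv 𝕜 δ 0 (0, x) (1, 0) (0, k₂) := by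
    intro x
    have h1 := clm_apply_fderiv_eq_zero hfd.differentiableAt hXdiff
      (ContinuousLinearMap.ext fun w => by
        change b₁ (0, 0) (1, 0) w - b₀ (0, 0) (1, 0) w = 0
        rw [Prod.mk_zero_zero, h00, sub_self])
      (by simp [hXdef, hK.zero₁, hK.zero₂]) hzero x
    rw [hfd.fderiv, hXd, map_sub, map_smul, map_smul] at h1
    exact sub_eq_zero.1 h1
  obtain ⟨y₁, y₂, d1, d2, d3, d4⟩ := hK.exists_dual hr h₀ hR
  have hsymm := hK.normal_symm hr h₀
  let B : H → H →L[𝕜] 𝕜 := fun k =>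
    (((fderiv 𝕜 δ 0).flip (1, 0)).flip (0, k)).comp (ContinuousLinearMap.inr 𝕜 𝕜 H)
  have hB := apply_eq_of_quadratic
    (a := (ContinuousLinearMap.fst 𝕜 𝕜 H).comp (fderiv 𝕜 K₁ 0))
    (c := (ContinuousLinearMap.fst 𝕜 𝕜 H).comp (fderiv 𝕜 K₂ 0)) (p := B k₁) (q := B k₂)
    hquad d1 d2 d3 d4 hsymm
  have hB' : fderiv 𝕜 δ 0 (0, k₂) (1, 0) (0, k₁) = fderiv 𝕜 δ 0 (0, k₁) (1, 0) (0, k₂) := hB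
  -- Closedness expresses the normal derivative of `δ` on `k₁`, `k₂` as the difference of the two
  -- quantities equated in `hB'`, so it is zero.
  have hcl := hδ.closed.self_of_nhds (1, 0) (0, k₁) (0, k₂)
  have hsub := congrArg (fun A : (𝕜 × H) →L[𝕜] (𝕜 × H) →L[𝕜] 𝕜 => A (0, k₁) (0, k₂))
    (fderiv_sub_dir (h₁.closed.germ.self_of_nhds.differentiableAt hrp)
      (h₀.closed.germ.self_of_nhds.differentiableAt hrp) ((1 : 𝕜), (0 : H)))
  rw [hB'] at hcl
  change fderiv 𝕜 δ 0 (1, 0) (0, k₁) (0, k₂) = fderiv 𝕜 b₁ 0 (1, 0) (0, k₁) (0, k₂)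
    - fderiv 𝕜 b₀ 0 (1, 0) (0, k₁) (0, k₂) at hsub
  linear_combination hcl - hsub

variable [NormedSpace ℝ H] [IsScalarTower ℝ 𝕜 H] [FiniteDimensional 𝕜 H]

/-- Fold forms with the same restriction to `{t = 0}` are equivalent. -/
theorem IsFold.equivalent {k₁' k₂' p' : H} (hr : r = ∞ ∨ r = ω)
    (h₀ : IsFold r b₀ k₁ k₂ p) (h₁ : IsFold r b₁ k₁' k₂' p')
    (hres : ∀ᶠ q in 𝓝 (0 : H), ∀ v w : H, b₁ (0, q) (0, v) (0, w) = b₀ (0, q) (0, v) (0, w))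
    (hR : HasRankTwo b₀) : BilinEquivalent r b₀ b₁ ∧
      ∃ A : (𝕜 × H) ≃L[𝕜] 𝕜 × H, (∀ v w, b₁ 0 (A v) (A w) = b₀ 0 v w) ∧
        ∀ v, b₀ 0 v = 0 → A v = v := by
  have : CompleteSpace H := FiniteDimensional.complete 𝕜 H
  have h₁' := h₀.common_kernel hr h₁ hres hR
  obtain ⟨c, h, hc, hs⟩ := exists_shear h₀ h₁' hres.self_of_nhds
  set A : (𝕜 × H) →L[𝕜] 𝕜 × H := shear c h with hA
  let e : (𝕜 × H) ≃L[𝕜] 𝕜 × H :=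
    (LinearEquiv.ofInjectiveEndo _ (shear_injective hc h)).toContinuousLinearEquiv
  have he : (e : (𝕜 × H) →L[𝕜] 𝕜 × H) = A := ContinuousLinearMap.ext fun x => rfl
  have hAg : GermAt 𝕜 r A 0 := Eventually.of_forall fun x => A.contDiff.contDiffAt
  have hiso : ∀ x : H, fderiv 𝕜 b₁ 0 (0, x) (0, k₁) (0, k₂) = 0 := fun x =>
    fderiv_eq_zero_of_mem_ker hr h₁' h₁'.ker_left h₁'.ker_right x
  have h₂ := h₀.pullback_shear hr h₁' hc hs hiso
  have hres2 : ∀ᶠ q in 𝓝 (0 : H), ∀ v w : H,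
      pullbackBilin A b₁ (0, q) (0, v) (0, w) = b₀ (0, q) (0, v) (0, w) := by
    filter_upwards [hres] with q hq v w
    rw [pullbackBilin_clm, compBilin_apply, hA, shear_zero_pair, shear_zero_pair, shear_zero_pair,
      hq]
  have h20 : pullbackBilin A b₁ 0 = b₀ 0 := by rw [pullbackBilin_clm, map_zero, hs]
  refine ⟨?_, e, fun v w => ?_, fun v hv => ?_⟩
  · have hequiv : BilinEquivalent r (pullbackBilin A b₁) b₁ :=
      bilinEquivalent_pullback hr b₁ hAg (map_zero A) e (by rw [he, A.fderiv])
    refine BilinEquivalent.trans hr ?_ hequiv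
    obtain ⟨K₁, K₂, hK⟩ := h₀.exists_frame hr
    obtain ⟨K₁', K₂', hK'⟩ := h₂.exists_frame hr
    refine bilinEquivalent_of_eq_on_hyperplane hr h₀.closed h₂.closed hres2 h20 h₀.ker h₀.ind ?_
      (h₀.transverse_frame hr) (fderiv_normal_eq hr h₀ h₂ h20 hres2 hR)
    -- One common kernel vector at each point of the hypersurface makes all members of the linear
    -- path degenerate there.
    filter_upwards [hK.eventually_mem_ker h₀.closed hK' hres2, hK.ker₁, hK.ker₂, hK.ind, hres2,
      tendsto_zero_pair.eventually h₂.closed.alt] with q x1 x2 x3 x4 x5 x6 s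
    obtain ⟨v, hv, hv0, hv1⟩ := exists_common_kernel x5 x6 x2 x3 x4 x1
    refine ⟨v, hv, ?_⟩
    refine ContinuousLinearMap.ext fun w => ?_
    change b₀ (0, q) v w + s * (pullbackBilin A b₁ (0, q) v w - b₀ (0, q) v w) = 0
    rw [hv0, hv1]
    simp
  · have := congrArg (fun B : (𝕜 × H) →L[𝕜] (𝕜 × H) →L[𝕜] 𝕜 => B v w) hs
    exact this
  · obtain ⟨a, c', rfl⟩ := Submodule.mem_span_pair.1 ((h₀.ker v).1 hv)
    have : ∀ v, e v = A v := fun v => rfl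
    rw [this, map_add, map_smul, map_smul, hA, shear_zero_pair, shear_zero_pair]

end FoldTheorem

/-! ### From alternating forms to bilinear forms. -/

section BilOf

variable {𝕜 E : Type} [RCLike 𝕜] [NormedAddCommGroup E] [NormedSpace 𝕜 E]

/-- The bilinear form of an alternating `2`-form. -/
def bilOf : (E [⋀^Fin 2]→L[𝕜] 𝕜) →L[𝕜] E →L[𝕜] E →L[𝕜] 𝕜 :=
  ((ContinuousLinearMap.compL 𝕜 E (E [⋀^Fin 1]→L[𝕜] 𝕜) (E →L[𝕜] 𝕜))
    (ContinuousAlternatingMap.ofSubsingletonLIE (𝕜 := 𝕜) (E := E) (F := 𝕜)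
      (0 : Fin 1)).symm.toContinuousLinearEquiv.toContinuousLinearMap).comp
    ContinuousAlternatingMap.curryLeftLI.toContinuousLinearMap

lemma bilOf_apply (η : E [⋀^Fin 2]→L[𝕜] 𝕜) (v w : E) : bilOf η v w = η ![v, w] := by
  change η (Matrix.vecCons v fun _ => w) = _
  congr 1
  ext1 i
  fin_cases i <;> rfl

attribute [irreducible] bilOf

lemma hasFDerivAt_clm_comp {F G : Type} [NormedAddCommGroup F] [NormedSpace 𝕜 F]
    [NormedAddCommGroup G] [NormedSpace 𝕜 G] (L : F →L[𝕜] G) {f : E → F} {x : E}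
    (h : DifferentiableAt 𝕜 f x) : HasFDerivAt (fun x => L (f x)) (L.comp (fderiv 𝕜 f x)) x :=
  L.hasFDerivAt.comp x h.hasFDerivAt

lemma contDiffAt_clm_comp {F G : Type} [NormedAddCommGroup F] [NormedSpace 𝕜 F]
    [NormedAddCommGroup G] [NormedSpace 𝕜 G] (L : F →L[𝕜] G) {f : E → F} {x : E}
    {r : WithTop ℕ∞} (h : ContDiffAt 𝕜 r f x) : ContDiffAt 𝕜 r (fun x => L (f x)) x :=
  L.contDiff.contDiffAt.comp x h

lemma fderiv_bilOf {x : E} {η : E → E [⋀^Fin 2]→L[𝕜] 𝕜} (h : DifferentiableAt 𝕜 η x)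
    (u v w : E) : fderiv 𝕜 (fun x => bilOf (η x)) x u v w = fderiv 𝕜 η x u ![v, w] := by
  have h1 := hasFDerivAt_clm_comp (G := E →L[𝕜] E →L[𝕜] 𝕜) (bilOf (𝕜 := 𝕜) (E := E)) h
  rw [h1.fderiv]
  exact bilOf_apply _ v w

lemma isClosedTwoForm_bilOf {r : WithTop ℕ∞} (hr : r = ∞ ∨ r = ω) {η : E → E [⋀^Fin 2]→L[𝕜] 𝕜}
    (h : GermAt 𝕜 r η 0) (hd : ∀ᶠ x in 𝓝 0, extDeriv η x = 0) :
    IsClosedTwoForm r (fun x => bilOf (η x)) := by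
  refine ⟨?_, ?_, ?_⟩
  · filter_upwards [h] with x hx
    exact contDiffAt_clm_comp (G := E →L[𝕜] E →L[𝕜] 𝕜) (bilOf (𝕜 := 𝕜) (E := E)) hx
  · exact Eventually.of_forall fun x v => by
      rw [bilOf_apply]; exact pair_self (η x).toAlternatingMap v
  · filter_upwards [h.differentiableAt hr, hd] with x h1 h2 u v w
    have h3 : ∑ i : Fin 3, (-1) ^ i.val •
        (fderiv 𝕜 (fun x => η x (i.removeNth ![u, v, w])) x) ((![u, v, w] : Fin 3 → E) i) = 0 := by
      rw [← extDeriv_apply h1, h2]; rfl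
    have h4 : ∀ z y, fderiv 𝕜 (fun x => η x z) x y = fderiv 𝕜 η x y z := by
      intro z y
      have h5 : HasFDerivAt (fun x => η x z)
          ((ContinuousAlternatingMap.apply 𝕜 E 𝕜 z).comp (fderiv 𝕜 η x)) x :=
        HasFDerivAt.comp (g := ContinuousAlternatingMap.apply 𝕜 E 𝕜 z) x
          (ContinuousAlternatingMap.apply 𝕜 E 𝕜 z).hasFDerivAt h1.hasFDerivAt
      rw [h5.fderiv]; rfl
    rw [Fin.sum_univ_three] at h3
    simp only [fderiv_bilOf h1]
    have r0 : (0 : Fin 3).removeNth ![u, v, w] = ![v, w] := by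
      ext1 i; fin_cases i <;> rfl
    have r1 : (1 : Fin 3).removeNth ![u, v, w] = ![u, w] := by
      ext1 i; fin_cases i <;> rfl
    have r2 : (2 : Fin 3).removeNth ![u, v, w] = ![u, v] := by
      ext1 i; fin_cases i <;> rfl
    simp only [r0, r1, r2, h4] at h3
    simp at h3
    linear_combination h3

end BilOf

/-! ### Singular symplectic forms are fold forms. -/

section ExistsFold

variable {𝕜 H E : Type} [RCLike 𝕜] [NormedAddCommGroup H] [NormedSpace 𝕜 H]
  [FiniteDimensional 𝕜 H] [NormedAddCommGroup E] [NormedSpace 𝕜 E] [FiniteDimensional 𝕜 E]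
  {r : WithTop ℕ∞}

/-- A bilinear form with at most two-dimensional kernel, whose restriction to a hyperplane has
three-dimensional kernel. -/
lemma exists_kernel_frame {β : (𝕜 × H) →L[𝕜] (𝕜 × H) →L[𝕜] 𝕜} (halt : ∀ v, β v v = 0)
    (W : Submodule 𝕜 H) (hW : ∀ v, v ∈ W ↔ ∀ w : H, β (0, v) (0, w) = 0)
    (h3 : Module.finrank 𝕜 W = 3)
    (h2 : Module.finrank 𝕜 (LinearMap.ker (β : (𝕜 × H) →ₗ[𝕜] (𝕜 × H) →L[𝕜] 𝕜)) ≤ 2) :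
    ∃ k₁ k₂ p : H, (∀ v, β v = 0 ↔ v ∈ Submodule.span 𝕜 {((0 : 𝕜), k₁), ((0 : 𝕜), k₂)}) ∧
      LinearIndependent 𝕜 ![((0 : 𝕜), k₁), ((0 : 𝕜), k₂)] ∧
      (∀ w : H, β (0, p) (0, w) = 0) ∧ β (1, 0) (0, p) ≠ 0 := by
  set N := LinearMap.ker (β : (𝕜 × H) →ₗ[𝕜] (𝕜 × H) →L[𝕜] 𝕜) with hN
  let i : W →ₗ[𝕜] 𝕜 × H := LinearMap.inr 𝕜 𝕜 H ∘ₗ W.subtype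
  have hi : Function.Injective i := LinearMap.inr_injective.comp W.injective_subtype
  let φ : W →ₗ[𝕜] 𝕜 := (β (1, 0) : (𝕜 × H) →ₗ[𝕜] 𝕜) ∘ₗ i
  have hker : ∀ v : W, φ v = 0 → i v ∈ N := fun v hv =>
    eq_zero_of_tangent_of_normal halt ((hW v).1 v.2) hv
  -- Otherwise the three-dimensional `W` would embed in the kernel of `β`, of dimension at most two.
  have hp : ∃ p, φ p ≠ 0 := by
    by_contra! h
    let j : W →ₗ[𝕜] N := i.codRestrict N fun v => hker v (h v)
    have hj : Function.Injective j := fun x y hxy => hi (congrArg Subtype.val hxy)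
    have := LinearMap.finrank_le_finrank_of_injective hj
    omega
  obtain ⟨p, hp⟩ := hp
  have hdim : 1 < Module.finrank 𝕜 (LinearMap.ker φ) := by
    have h5 := φ.finrank_range_add_finrank_ker
    have h6 := (LinearMap.range φ).finrank_le
    rw [Module.finrank_self] at h6
    omega
  have : Nontrivial (LinearMap.ker φ) :=
    Module.nontrivial_of_finrank_pos (zero_lt_one.trans hdim)
  obtain ⟨x, hx⟩ := exists_ne (0 : LinearMap.ker φ)
  obtain ⟨y, hxy⟩ := exists_linearIndependent_pair_of_one_lt_finrank hdim hx
  have hind : LinearIndependent 𝕜 ![((0 : 𝕜), ((x : W) : H)), ((0 : 𝕜), ((y : W) : H))] := by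
    have h7 := hxy.map' (i ∘ₗ (LinearMap.ker φ).subtype)
      (LinearMap.ker_eq_bot.2 (hi.comp (Submodule.injective_subtype _)))
    have h8 : (i ∘ₗ (LinearMap.ker φ).subtype) ∘ ![x, y]
        = ![((0 : 𝕜), ((x : W) : H)), ((0 : 𝕜), ((y : W) : H))] := by
      ext1 k
      fin_cases k <;> rfl
    rw [h8] at h7
    exact h7
  have hle : Submodule.span 𝕜 {((0 : 𝕜), ((x : W) : H)), ((0 : 𝕜), ((y : W) : H))} ≤ N := by
    rw [Submodule.span_le]
    rintro z (rfl | rfl)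
    · exact hker x x.2
    · exact hker y y.2
  have hspan : Module.finrank 𝕜
      (Submodule.span 𝕜 {((0 : 𝕜), ((x : W) : H)), ((0 : 𝕜), ((y : W) : H))}) = 2 := by
    have := finrank_span_eq_card hind
    rw [Matrix.range_cons, Matrix.range_cons, Matrix.range_empty, union_empty] at this
    exact this
  have heq := Submodule.eq_of_le_of_finrank_le hle (by rw [hspan]; exact h2)
  refine ⟨x, y, p, fun v => ?_, hind, (hW p).1 p.2, hp⟩
  rw [heq]
  exact LinearMap.mem_ker.symm

/-- Nonvanishing of the differential of the top power is used twice: corank three or more would kill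
all its first variations, and vanishing of the normal derivative on the kernel would kill the normal
one. -/
lemma exists_isFold (hr : r = ∞ ∨ r = ω) {η : E → E [⋀^Fin 2]→L[𝕜] 𝕜} {Θ : 𝕜 × H → E} {k : ℕ}
    {a : Fin (2 * k) → E} (hη : GermAt 𝕜 r η 0) (hd : ∀ᶠ x in 𝓝 0, extDeriv η x = 0)
    (hΘ : GermAt 𝕜 r Θ 0) (h0 : Θ 0 = 0) (e : (𝕜 × H) ≃L[𝕜] E)
    (he : (e : (𝕜 × H) →L[𝕜] E) = fderiv 𝕜 Θ 0) (hk : Module.finrank 𝕜 E = 2 * k)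
    (hpow : wedgePow (η 0).toAlternatingMap k = 0)
    (hf : fderiv 𝕜 (fun x => wedgePow (η x).toAlternatingMap k a) 0 ≠ 0)
    (hf0 : ∀ᶠ q in 𝓝 (0 : H), wedgePow (η (Θ (0, q))).toAlternatingMap k a = 0)
    (hS : ∀ᶠ x in 𝓝 (0 : 𝕜 × H), wedgePow (η (Θ x)).toAlternatingMap k = 0 → x.1 = 0)
    (σ₀ : H [⋀^Fin 2]→ₗ[𝕜] 𝕜)
    (hσ : ∀ v w : H, η 0 ![fderiv 𝕜 Θ 0 (0, v), fderiv 𝕜 Θ 0 (0, w)] = σ₀ ![v, w])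
    (h3 : Module.finrank 𝕜 (formKernel σ₀) = 3) :
    ∃ k₁ k₂ p, IsFold r (pullbackBilin Θ fun x => bilOf (η x)) k₁ k₂ p := by
  have hcl := (isClosedTwoForm_bilOf hr hη hd)
  have hclp := hcl.pullback hr hΘ h0
  have hη0 : DifferentiableAt 𝕜 η 0 := (hη.differentiableAt hr).self_of_nhds
  have hΘd : DifferentiableAt 𝕜 Θ 0 := (hΘ.differentiableAt hr).self_of_nhds
  set b := pullbackBilin Θ fun x => bilOf (η x) with hb
  have hbv : ∀ v w, b 0 v w = η 0 ![e v, e w] := by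
    intro v w
    rw [hb, pullbackBilin_apply, bilOf_apply, ← he, h0]; rfl
  have hb0 : ∀ v, b 0 v = 0 ↔ e v ∈ formKernel (η 0).toAlternatingMap := by
    intro v
    rw [mem_formKernel_two]
    constructor
    · intro h w
      have := hbv v (e.symm w)
      rw [h, e.apply_symm_apply] at this
      exact this.symm
    · exact fun h => ContinuousLinearMap.ext fun w => (hbv v w).trans (h _)
  have hchain : ∀ u, fderiv 𝕜 (fun x => wedgePow (η x).toAlternatingMap k a) 0 u
      = fderiv 𝕜 (fun ζ : E [⋀^Fin 2]→L[𝕜] 𝕜 => wedgePow ζ.toAlternatingMap k a) (η 0)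
        (fderiv 𝕜 η 0 u) := by
    intro u
    have := HasFDerivAt.comp (0 : E) (f := η)
      (g := fun ζ : E [⋀^Fin 2]→L[𝕜] 𝕜 => wedgePow ζ.toAlternatingMap k a)
      (differentiableAt_wedgePow k a (η 0)).hasFDerivAt hη0.hasFDerivAt
    change HasFDerivAt (fun x => wedgePow (η x).toAlternatingMap k a) _ 0 at this
    rw [this.fderiv]; rfl
  have hN : Module.finrank 𝕜 (LinearMap.ker (b 0 : (𝕜 × H) →ₗ[𝕜] (𝕜 × H) →L[𝕜] 𝕜)) ≤ 2 := by
    have h5 : Module.finrank 𝕜 (formKernel (η 0).toAlternatingMap) ≤ 2 := by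
      by_contra! h
      refine hf (ContinuousLinearMap.ext fun u => ?_)
      rw [hchain, fderiv_wedgePow_of_corank hk h]; rfl
    refine le_trans ?_ h5
    let j : LinearMap.ker (b 0 : (𝕜 × H) →ₗ[𝕜] (𝕜 × H) →L[𝕜] 𝕜) →ₗ[𝕜]
        formKernel (η 0).toAlternatingMap :=
      ((e : (𝕜 × H) →ₗ[𝕜] E).domRestrict _).codRestrict _ fun v => (hb0 v).1 v.2
    exact LinearMap.finrank_le_finrank_of_injective (f := j) fun x y hxy =>
      Subtype.ext (e.injective (congrArg Subtype.val hxy))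
  have hev : ∀ v w : H, b 0 (0, v) (0, w) = σ₀ ![v, w] := by
    intro v w
    rw [hbv, ← hσ, ← he]; rfl
  obtain ⟨k₁, k₂, p, hker, hind, hp, hp'⟩ := exists_kernel_frame (β := b 0)
    (hclp.alt.self_of_nhds) (formKernel σ₀)
    (fun v => by rw [mem_formKernel_two]; simp only [hev]) h3 hN
  refine ⟨k₁, k₂, p, hclp, hker, hind, hp, hp', ?_, ?_⟩
  · by_contra! hcon
    apply hf
    have hdf : DifferentiableAt 𝕜 (fun x => wedgePow (η x).toAlternatingMap k a) 0 :=
      DifferentiableAt.comp (0 : E) (f := η)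
        (g := fun ζ : E [⋀^Fin 2]→L[𝕜] 𝕜 => wedgePow ζ.toAlternatingMap k a)
        (differentiableAt_wedgePow k a (η 0)) hη0
    -- The top power vanishes on the hypersurface, so its differential kills tangent vectors; only
    -- the normal direction remains to be excluded.
    have ht : ∀ q : H, fderiv 𝕜 (fun x => wedgePow (η x).toAlternatingMap k a) 0 (e (0, q)) = 0 := by
      intro q
      have h1 : HasFDerivAt (fun q : H => Θ (0, q))
          ((fderiv 𝕜 Θ 0).comp (ContinuousLinearMap.inr 𝕜 𝕜 H)) 0 :=
        HasFDerivAt.comp (g := Θ) (0 : H) hΘd.hasFDerivAt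
          (ContinuousLinearMap.inr 𝕜 𝕜 H).hasFDerivAt
      have h2 := HasFDerivAt.comp (0 : H) (f := fun q : H => Θ (0, q))
        (g := fun x => wedgePow (η x).toAlternatingMap k a)
        (g' := fderiv 𝕜 (fun x => wedgePow (η x).toAlternatingMap k a) 0)
        (by
          have : Θ (0, (0 : H)) = 0 := h0
          simpa only [this] using hdf.hasFDerivAt) h1
      have h3 := h2.unique ((hasFDerivAt_const (0 : 𝕜) (0 : H)).congr_of_eventuallyEq hf0)
      have h4 := congrArg (fun A : H →L[𝕜] 𝕜 => A q) h3
      rw [← he] at h4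
      exact h4
    have hn : fderiv 𝕜 (fun x => wedgePow (η x).toAlternatingMap k a) 0 (e (1, 0)) = 0 := by
      rw [hchain]
      refine fderiv_wedgePow_of_vanish_on_ker hpow fun v hv w hw => ?_
      have hv' : b 0 (e.symm v) = 0 := (hb0 _).2 (by rwa [e.apply_symm_apply])
      have hw' : b 0 (e.symm w) = 0 := (hb0 _).2 (by rwa [e.apply_symm_apply])
      have h1 := hcon _ _ hv' hw'
      rw [hb, fderiv_pullbackBilin (by rw [h0]; exact (hcl.germ.differentiableAt hr).self_of_nhds)
        hΘd ((hΘ.fderiv_right hr).differentiableAt hr).self_of_nhds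
        (hclp.germ.differentiableAt hr).self_of_nhds, h0, ← he] at h1
      -- The second derivatives of `Θ` enter the pullback formula paired with kernel vectors, so
      -- they do not contribute.
      have e1 : ∀ x, bilOf (η 0) x (e (e.symm w)) = 0 := by
        intro x
        have h5 := hbv (e.symm w) (e.symm x)
        rw [hw', ← bilOf_apply, e.apply_symm_apply x] at h5
        rw [bilin_swap hcl.alt.self_of_nhds, ← h5]
        simp
      have e2 : ∀ x, bilOf (η 0) (e (e.symm v)) x = 0 := by
        intro x
        have h5 := hbv (e.symm v) (e.symm x)
        rw [hv', ← bilOf_apply, e.apply_symm_apply x] at h5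
        exact h5.symm
      change _ + bilOf (η 0) _ (e (e.symm w)) + bilOf (η 0) (e (e.symm v)) _ = 0 at h1
      rw [e1, e2, fderiv_bilOf hη0] at h1
      change fderiv 𝕜 η 0 (e (1, 0)) ![e (e.symm v), e (e.symm w)] + 0 + 0 = 0 at h1
      rw [e.apply_symm_apply, e.apply_symm_apply] at h1
      simpa using h1
    refine ContinuousLinearMap.ext fun u => ?_
    have hu : u = (e.symm u).1 • e (1, 0) + e (0, (e.symm u).2) := by
      rw [← map_smul, ← map_add, ← e.symm_apply_eq]
      ext <;> simp
    rw [hu, map_add, map_smul, ht, hn]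
    simp
  · have hc : Tendsto (fderiv 𝕜 Θ) (𝓝 0) (𝓝 (e : (𝕜 × H) →L[𝕜] E)) := by
      rw [he]
      exact (hΘ.fderiv_right hr).self_of_nhds.continuousAt
    have : CompleteSpace H := FiniteDimensional.complete 𝕜 H
    filter_upwards [hc.eventually e.nhds, hS] with x ⟨e', he'⟩ hx v hv hbx
    apply hx
    apply wedgePow_eq_zero
    have hmem : e' v ∈ formKernel (η (Θ x)).toAlternatingMap := by
      rw [mem_formKernel_two]
      intro w
      have h1 : b x v (e'.symm w) = η (Θ x) ![e' v, e' (e'.symm w)] := by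
        rw [hb, pullbackBilin_apply, bilOf_apply, ← he']; rfl
      rw [hbx, e'.apply_symm_apply] at h1
      exact h1.symm
    have : 0 < Module.finrank 𝕜 (formKernel (η (Θ x)).toAlternatingMap) := by
      rw [Module.finrank_pos_iff_exists_ne_zero]
      exact ⟨⟨e' v, hmem⟩, fun h => hv (by
        have := congrArg Subtype.val h
        simpa using this)⟩
    omega

end ExistsFold

/-! ### The rank and jet conditions, and a chart adapted to the hypersurface. -/

section Coordinates

variable {𝕜 : Type} [RCLike 𝕜] {r : WithTop ℕ∞}

lemma finrank_formKernel {m : ℕ} (η : Space 𝕜 m [⋀^Fin 2]→L[𝕜] 𝕜) :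
    formRank η + Module.finrank 𝕜 (formKernel η.toAlternatingMap) = m := by
  have h1 := η.curryLeft.toLinearMap.finrank_range_add_finrank_ker
  have h2 : LinearMap.ker η.curryLeft.toLinearMap = formKernel η.toAlternatingMap := by
    ext v
    rw [mem_formKernel_two, LinearMap.mem_ker]
    constructor
    · intro h w
      exact congrArg (fun A : Space 𝕜 m [⋀^Fin 1]→L[𝕜] 𝕜 => A ![w]) h
    · intro h
      refine ContinuousAlternatingMap.ext fun w => ?_
      have h3 : w = ![w 0] := by ext1 i; fin_cases i; rfl
      rw [h3]
      exact h (w 0)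
  rw [h2, Module.finrank_fin_fun] at h1
  exact h1

lemma exists_smul_eq_of_ker_le {m : ℕ} {A ℓ : Space 𝕜 m →L[𝕜] 𝕜} (h : ∀ x, ℓ x = 0 → A x = 0) :
    ∃ c : 𝕜, A = c • ℓ := by
  by_cases hℓ : ∀ x, ℓ x = 0
  · exact ⟨0, ContinuousLinearMap.ext fun x => by rw [h x (hℓ x)]; simp⟩
  · push Not at hℓ
    obtain ⟨u, hu⟩ := hℓ
    refine ⟨A u / ℓ u, ContinuousLinearMap.ext fun x => ?_⟩
    have h1 := h (x - (ℓ x / ℓ u) • u) (by simp [hu])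
    rw [map_sub, map_smul, sub_eq_zero, smul_eq_mul] at h1
    rw [h1, smul_apply, smul_eq_mul]
    ring

/-- If the jets of the coefficients of `σ^{n-1}` span a plane then the first order variations of
`σ` on the kernel of `σ 0` are not multiples of a single covector. -/
lemma exists_fderiv_ne_zero_of_jetSpan {n : ℕ} {σ : Form 𝕜 (2 * n - 1) 2}
    (hσ : DifferentiableAt 𝕜 σ 0) (hrank : formRank (σ 0) + 4 = 2 * n)
    (hjet : Module.finrank 𝕜 (jetSpan σ) = 2) (ℓ : Space 𝕜 (2 * n - 1) →L[𝕜] 𝕜) :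
    ∃ x, ℓ x = 0 ∧ ∃ v ∈ formKernel (σ 0).toAlternatingMap,
      ∃ w ∈ formKernel (σ 0).toAlternatingMap, fderiv 𝕜 σ 0 x ![v, w] ≠ 0 := by
  by_contra! hcon
  have h1 := finrank_formKernel (σ 0)
  -- The kernel of σ(0) has dimension three and 2n - 1 < 2(n - 1) + 3.
  have hpow : wedgePow (σ 0).toAlternatingMap (n - 1) = 0 :=
    wedgePow_eq_zero _ _ (by rw [Module.finrank_fin_fun]; omega)
  -- The coefficients vanish at 0 and their differentials see only the variation of σ on its kernel.
  -- If that variation vanished on the kernel of `ℓ`, all jets would be multiples of `(0, ℓ)`.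
  have hle : jetSpan σ ≤ Submodule.span 𝕜 {((0 : 𝕜), ℓ)} := by
    refine Submodule.span_le.2 ?_
    rintro _ ⟨s, rfl⟩
    set a : Fin (2 * (n - 1)) → Space 𝕜 (2 * n - 1) := fun j => Pi.single (s j) 1
    have h2 : ∀ x, fderiv 𝕜 (powCoeff σ s) 0 x
        = fderiv 𝕜 (fun η : Space 𝕜 (2 * n - 1) [⋀^Fin 2]→L[𝕜] 𝕜 =>
          wedgePow η.toAlternatingMap (n - 1) a) (σ 0) (fderiv 𝕜 σ 0 x) := by
      intro x
      have h3 : HasFDerivAt (powCoeff σ s) _ 0 := HasFDerivAt.comp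
        (0 : Space 𝕜 (2 * n - 1)) (f := σ)
        (g := fun η : Space 𝕜 (2 * n - 1) [⋀^Fin 2]→L[𝕜] 𝕜 =>
          wedgePow η.toAlternatingMap (n - 1) a)
        (differentiableAt_wedgePow _ a (σ 0)).hasFDerivAt hσ.hasFDerivAt
      rw [h3.fderiv]; rfl
    obtain ⟨c, hc⟩ := exists_smul_eq_of_ker_le (A := fderiv 𝕜 (powCoeff σ s) 0) (ℓ := ℓ)
      fun x hx => by
        rw [h2]
        exact fderiv_wedgePow_of_vanish_on_ker hpow (hcon x hx)
    have h4 : powCoeff σ s 0 = 0 := congrArg (fun A => A a) hpow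
    refine Submodule.mem_span_singleton.2 ⟨c, ?_⟩
    change c • _ = (powCoeff σ s 0, fderiv 𝕜 (powCoeff σ s) 0)
    rw [h4, hc, Prod.smul_mk, smul_zero]
  have h5 := LinearMap.finrank_le_finrank_of_injective (Submodule.inclusion_injective hle)
  have h6 := finrank_span_le_card (R := 𝕜) ({((0 : 𝕜), ℓ)} : Set _)
  rw [toFinset_singleton, Finset.card_singleton] at h6
  omega

lemma hasRankTwo_of_restrict {H : Type} [NormedAddCommGroup H] [NormedSpace 𝕜 H]
    {b : 𝕜 × H → (𝕜 × H) →L[𝕜] (𝕜 × H) →L[𝕜] 𝕜} {σ : H → H [⋀^Fin 2]→L[𝕜] 𝕜}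
    (hb : DifferentiableAt 𝕜 b 0) (hσ : DifferentiableAt 𝕜 σ 0)
    (hres : ∀ᶠ q in 𝓝 (0 : H), ∀ v w : H, b (0, q) (0, v) (0, w) = σ q ![v, w])
    (h : ∀ ℓ : H →L[𝕜] 𝕜, ∃ x, ℓ x = 0 ∧ ∃ v ∈ formKernel (σ 0).toAlternatingMap,
      ∃ w ∈ formKernel (σ 0).toAlternatingMap, fderiv 𝕜 σ 0 x ![v, w] ≠ 0) : HasRankTwo b := by
  intro ℓ
  obtain ⟨x, hx, v, hv, w, hw, hne⟩ := h ℓ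
  have h0 := hres.self_of_nhds
  refine ⟨x, hx, v, w, fun z => (h0 v z).trans (mem_formKernel_two.1 hv z),
    fun z => (h0 w z).trans (mem_formKernel_two.1 hw z), ?_⟩
  obtain ⟨h1, h2⟩ := fderiv_bilin_dir hb ((0 : 𝕜), v) ((0 : 𝕜), w)
  have h3 : HasFDerivAt (fun q : H => b (0, q) (0, v) (0, w)) _ 0 :=
    HasFDerivAt.comp (0 : H) (f := fun q : H => ((0 : 𝕜), q))
      (g := fun x => b x (0, v) (0, w)) h1 (ContinuousLinearMap.inr 𝕜 𝕜 H).hasFDerivAt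
  have h4 := (fderiv_bilin_dir
    (hasFDerivAt_clm_comp (G := H →L[𝕜] H →L[𝕜] 𝕜) (bilOf (𝕜 := 𝕜) (E := H)) hσ).differentiableAt
    v w)
  have h5 : (fun q : H => b (0, q) (0, v) (0, w)) =ᶠ[𝓝 0] fun q => bilOf (σ q) v w := by
    filter_upwards [hres] with q hq
    rw [hq, bilOf_apply]
  have h6 := congrArg (fun A : H →L[𝕜] 𝕜 => A x)
    (h3.unique (h4.1.congr_of_eventuallyEq h5))
  change fderiv 𝕜 (fun x => b x (0, v) (0, w)) 0 (0, x) = _ at h6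
  rw [← h2, h6, h4.2, fderiv_bilOf hσ]
  exact hne

/-- An inclusion of a hypersurface extends to a chart of the ambient space. -/
lemma IsInclusion.exists_chart {n : ℕ} (hn : 0 < n) (hr : r = ∞ ∨ r = ω)
    {ι : Space 𝕜 (2 * n - 1) → Space 𝕜 (2 * n)} {S : Set (Space 𝕜 (2 * n))}
    (h : IsInclusion r ι S) : ∃ Θ : 𝕜 × Space 𝕜 (2 * n - 1) → Space 𝕜 (2 * n), GermAt 𝕜 r Θ 0 ∧
      Θ 0 = 0 ∧ (∀ q, Θ (0, q) = ι q) ∧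
      (∀ᶠ q in 𝓝 0, ∀ v, fderiv 𝕜 Θ (0, q) (0, v) = fderiv 𝕜 ι q v) ∧
      (∀ᶠ x in 𝓝 0, Θ x ∈ S → x.1 = 0) ∧
      ∃ e : (𝕜 × Space 𝕜 (2 * n - 1)) ≃L[𝕜] Space 𝕜 (2 * n),
        (e : (𝕜 × Space 𝕜 (2 * n - 1)) →L[𝕜] Space 𝕜 (2 * n)) = fderiv 𝕜 Θ 0 := by
  have hι : GermAt 𝕜 r ι 0 := h.regular
  set D := fderiv 𝕜 ι 0 with hD
  obtain ⟨c, hc⟩ : ∃ c, c ∉ LinearMap.range (D : Space 𝕜 (2 * n - 1) →ₗ[𝕜] Space 𝕜 (2 * n)) := by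
    by_contra! hall
    have h1 := LinearMap.finrank_le_finrank_of_surjective
      (f := (D : Space 𝕜 (2 * n - 1) →ₗ[𝕜] Space 𝕜 (2 * n))) fun y => hall y
    rw [Module.finrank_fin_fun, Module.finrank_fin_fun] at h1
    omega
  -- A direction `c` outside the tangent space of the hypersurface is added to the parametrisation.
  set Θ : 𝕜 × Space 𝕜 (2 * n - 1) → Space 𝕜 (2 * n) := fun x => ι x.2 + x.1 • c with hΘ
  have hsnd : Tendsto (fun x : 𝕜 × Space 𝕜 (2 * n - 1) => x.2) (𝓝 0) (𝓝 0) :=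
    Continuous.tendsto' continuous_snd _ _ rfl
  have hg : GermAt 𝕜 r Θ 0 := by
    filter_upwards [hsnd.eventually hι] with x hx
    exact (ContDiffAt.comp x (g := ι) hx contDiffAt_snd).add (contDiffAt_fst.smul contDiffAt_const)
  have h0 : Θ 0 = 0 := by simp [hΘ, h.map_zero]
  have hΘ0 : ∀ q, Θ (0, q) = ι q := fun q => by simp [hΘ]
  have hfd : ∀ q, DifferentiableAt 𝕜 ι q → ∀ t v,
      fderiv 𝕜 Θ (0, q) (t, v) = fderiv 𝕜 ι q v + t • c := by
    intro q hq t v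
    have h1 : HasFDerivAt (fun x : 𝕜 × Space 𝕜 (2 * n - 1) => ι x.2) _ (0, q) :=
      HasFDerivAt.comp ((0 : 𝕜), q) (g := ι) (f := Prod.snd) hq.hasFDerivAt hasFDerivAt_snd
    have h2 : HasFDerivAt (fun x : 𝕜 × Space 𝕜 (2 * n - 1) => x.1 • c) _ (0, q) :=
      (ContinuousLinearMap.fst 𝕜 𝕜 (Space 𝕜 (2 * n - 1))).hasFDerivAt.smul_const c
    have h3 : HasFDerivAt Θ _ (0, q) := h1.add h2
    rw [h3.fderiv]
    rfl
  have hι0 : DifferentiableAt 𝕜 ι 0 := (hι.differentiableAt hr).self_of_nhds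
  have hinj : Function.Injective
      (fderiv 𝕜 Θ 0 : (𝕜 × Space 𝕜 (2 * n - 1)) →ₗ[𝕜] Space 𝕜 (2 * n)) := by
    rw [injective_iff_map_eq_zero]
    rintro ⟨t, v⟩ hv
    have h1 : D v + t • c = 0 := (hfd 0 hι0 t v).symm.trans hv
    have ht : t = 0 := by
      by_contra ht
      refine hc ⟨-(t⁻¹ • v), ?_⟩
      change D _ = c
      rw [map_neg, map_smul, ← smul_right_injective _ ht |>.eq_iff]
      change t • -(t⁻¹ • D v) = t • c
      rw [smul_neg, smul_inv_smul₀ ht]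
      exact neg_eq_of_add_eq_zero_right h1
    rw [ht, zero_smul, add_zero] at h1
    rw [ht, h.immersion (h1.trans (_root_.map_zero D).symm)]
    rfl
  let e : (𝕜 × Space 𝕜 (2 * n - 1)) ≃L[𝕜] Space 𝕜 (2 * n) :=
    (LinearMap.linearEquivOfInjective _ hinj (by
      rw [Module.finrank_prod, Module.finrank_self, Module.finrank_fin_fun,
        Module.finrank_fin_fun]
      omega)).toContinuousLinearEquiv
  have he : (e : (𝕜 × Space 𝕜 (2 * n - 1)) →L[𝕜] Space 𝕜 (2 * n)) = fderiv 𝕜 Θ 0 :=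
    ContinuousLinearMap.ext fun x => rfl
  refine ⟨Θ, hg, h0, hΘ0, ?_, ?_, e, he⟩
  · filter_upwards [hι.differentiableAt hr] with q hq v
    rw [hfd q hq, zero_smul, add_zero]
  · have hΘd : HasFDerivAt Θ (e : (𝕜 × Space 𝕜 (2 * n - 1)) →L[𝕜] Space 𝕜 (2 * n)) 0 := by
      rw [he]; exact (hg.differentiableAt hr).self_of_nhds.hasFDerivAt
    obtain ⟨Φ, hs, hΦ, -, -⟩ := hg.exists_openPartialHomeomorph hr e hΘd
    have hU : ∀ᶠ q in 𝓝 (0 : Space 𝕜 (2 * n - 1)), ((0 : 𝕜), q) ∈ Φ.source :=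
      tendsto_zero_pair.eventually (Φ.open_source.mem_nhds hs)
    -- Nearby points of `S` are values of `ι`, that is of `Θ` at t = 0; local injectivity of `Θ`
    -- then excludes other preimages.
    have himg : ι '' {q | ((0 : 𝕜), q) ∈ Φ.source} ∈ 𝓝[S] (0 : Space 𝕜 (2 * n)) := by
      rw [← h.image]; exact image_mem_map hU
    have ht : Tendsto Θ (𝓝 0) (𝓝 0) := by
      have := hg.self_of_nhds.continuousAt.tendsto
      rwa [h0] at this
    filter_upwards [ht.eventually (mem_nhdsWithin_iff_eventually.1 himg),
      Φ.open_source.mem_nhds hs] with x hx hxs hS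
    obtain ⟨q, hq, hqx⟩ := hx hS
    have : x = (0, q) := Φ.injOn hxs hq (by rw [hΦ, hΘ0, hqx])
    rw [this]

end Coordinates

/-! ### Return to differential forms on the coordinate space. -/

section Transfer

variable {𝕜 : Type} [RCLike 𝕜] {r : WithTop ℕ∞}

lemma areEquivalent_of_bilinEquivalent {m : ℕ} {η₀ η₁ : Form 𝕜 m 2}
    (h : BilinEquivalent r (fun x => bilOf (η₀ x)) (fun x => bilOf (η₁ x))) :
    AreEquivalent r η₀ η₁ := by
  obtain ⟨Ψ, hs, h0, h1, h2, he⟩ := h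
  refine ⟨Ψ, ⟨hs, h0, h1, h2⟩, ?_⟩
  filter_upwards [he] with x hx
  refine ContinuousAlternatingMap.ext fun v => ?_
  have h3 := hx (v 0) (v 1)
  rw [bilOf_apply, bilOf_apply] at h3
  rw [vec_two v, pullback, compContinuousLinearMap_pair]
  exact h3

/-- Regularity of σ is not assumed but inherited through this from the ambient form. -/
lemma differentiableAt_pullback (hr : r = ∞ ∨ r = ω) {m k p : ℕ} {φ : Space 𝕜 m → Space 𝕜 k}
    {η : Form 𝕜 k p} (hφ : GermAt 𝕜 r φ 0) (h0 : φ 0 = 0) (hη : GermAt 𝕜 r η 0) :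
    DifferentiableAt 𝕜 (pullback φ η) 0 := by
  have h1 : DifferentiableAt 𝕜 (fun x => η (φ x)) 0 :=
    DifferentiableAt.comp (0 : Space 𝕜 m) (g := η)
      (by rw [h0]; exact (hη.differentiableAt hr).self_of_nhds)
      (hφ.differentiableAt hr).self_of_nhds
  exact h1.continuousAlternatingMapCompContinuousLinearMap
    ((hφ.fderiv_right hr).differentiableAt hr).self_of_nhds

/-- Singular symplectic forms with the same restriction to the Martinet hypersurface, of
corank three at `0` and with two-dimensional span of the jets of the coefficients of `σ^{n-1}`. -/
theorem equivalent_of_pullback_eq (hr : r = ∞ ∨ r = ω) {n : ℕ} {η₀ η₁ : Form 𝕜 (2 * n) 2}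
    {ι : Space 𝕜 (2 * n - 1) → Space 𝕜 (2 * n)} {σ : Form 𝕜 (2 * n - 1) 2}
    (h₀ : IsSingularSymplectic r η₀) (h₁ : IsSingularSymplectic r η₁)
    (hs₀ : IsStructurallySmooth η₀) (hs₁ : IsStructurallySmooth η₁)
    (hS : martinetSet η₀ =ᶠ[𝓝 0] martinetSet η₁) (hι : IsInclusion r ι (martinetSet η₀))
    (hσ₀ : SingularSymplectic.pullback ι η₀ =ᶠ[𝓝 0] σ)
    (hσ₁ : SingularSymplectic.pullback ι η₁ =ᶠ[𝓝 0] σ)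
    (hrank : formRank (σ 0) + 4 = 2 * n) (hjet : Module.finrank 𝕜 (jetSpan σ) = 2) :
    formKernel (formPow η₀ (n - 1) 0) = formKernel (formPow η₁ (n - 1) 0) ∧
      AreEquivalent r η₀ η₁ := by
  obtain ⟨Θ, hΘ, h0, hΘι, hDΘ, hΘS, e, he⟩ := hι.exists_chart (by omega) hr
  have hιg : GermAt 𝕜 r ι 0 := hι.regular
  have hιt : Tendsto ι (𝓝 0) (𝓝 0) := by
    have := hιg.self_of_nhds.continuousAt.tendsto
    rwa [hι.map_zero] at this
  have hιS : ∀ᶠ q in 𝓝 (0 : Space 𝕜 (2 * n - 1)), ι q ∈ martinetSet η₀ := by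
    have h1 : martinetSet η₀ ∈ Filter.map ι (𝓝 0) := by
      rw [hι.image]; exact self_mem_nhdsWithin
    exact h1
  have hΘt : Tendsto Θ (𝓝 0) (𝓝 0) := by
    have := hΘ.self_of_nhds.continuousAt.tendsto
    rwa [h0] at this
  have hσd : DifferentiableAt 𝕜 σ 0 :=
    (differentiableAt_pullback hr hιg hι.map_zero h₀.regular).congr_of_eventuallyEq hσ₀.symm
  have hker := finrank_formKernel (σ 0)
  have hrestrict : ∀ η : Form 𝕜 (2 * n) 2, SingularSymplectic.pullback ι η =ᶠ[𝓝 0] σ →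
      ∀ᶠ q in 𝓝 (0 : Space 𝕜 (2 * n - 1)), ∀ v w : Space 𝕜 (2 * n - 1),
        η (Θ (0, q)) ![fderiv 𝕜 Θ (0, q) (0, v), fderiv 𝕜 Θ (0, q) (0, w)] = σ q ![v, w] := by
    intro η hη
    filter_upwards [hη, hDΘ] with q h1 h2 v w
    rw [h2, h2, ← h1, SingularSymplectic.pullback, compContinuousLinearMap_pair, hΘι]
  have hfold : ∀ η : Form 𝕜 (2 * n) 2, IsSingularSymplectic r η → IsStructurallySmooth η →
      martinetSet η₀ =ᶠ[𝓝 0] martinetSet η → SingularSymplectic.pullback ι η =ᶠ[𝓝 0] σ →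
      ∃ k₁ k₂ p, IsFold r (pullbackBilin Θ fun x => bilOf (η x)) k₁ k₂ p := by
    intro η h hs hSη hση
    have hmem : ∀ᶠ x in 𝓝 0, x ∈ martinetSet η₀ ↔ x ∈ martinetSet η :=
      hSη.mono fun x hx => iff_of_eq hx
    have hιη : ∀ᶠ q in 𝓝 (0 : Space 𝕜 (2 * n - 1)), ι q ∈ martinetSet η := by
      filter_upwards [hιS, hιt.eventually hmem] with q h1 h2 using h2.1 h1
    refine exists_isFold hr (a := fun i => Pi.single i 1) h.regular h.closed hΘ h0 e he
      (Module.finrank_fin_fun 𝕜) ?_ hs.2 ?_ ?_ (σ 0).toAlternatingMap ?_ (by omega)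
    · have := hιη.self_of_nhds
      rw [hι.map_zero] at this
      exact this
    · filter_upwards [hιη] with q hq
      rw [hΘι]
      exact congrArg (fun A => A (fun i => Pi.single i 1)) hq
    · filter_upwards [hΘS, hΘt.eventually hmem] with x h1 h2 h3 using h1 (h2.2 h3)
    · intro v w
      have := (hrestrict η hση).self_of_nhds v w
      have h4 : Θ (0, (0 : Space 𝕜 (2 * n - 1))) = 0 := h0
      rw [h4] at this
      exact this
  obtain ⟨k₁, k₂, p, hf₀⟩ := hfold η₀ h₀ hs₀ EventuallyEq.rfl hσ₀
  obtain ⟨k₁', k₂', p', hf₁⟩ := hfold η₁ h₁ hs₁ hS hσ₁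
  have hb : ∀ η : Form 𝕜 (2 * n) 2, SingularSymplectic.pullback ι η =ᶠ[𝓝 0] σ →
      ∀ᶠ q in 𝓝 (0 : Space 𝕜 (2 * n - 1)), ∀ v w : Space 𝕜 (2 * n - 1),
        pullbackBilin Θ (fun x => bilOf (η x)) (0, q) (0, v) (0, w) = σ q ![v, w] := by
    intro η hη
    filter_upwards [hrestrict η hη] with q hq v w
    rw [pullbackBilin_apply, bilOf_apply, hq]
  have hR : HasRankTwo (pullbackBilin Θ fun x => bilOf (η₀ x)) :=
    hasRankTwo_of_restrict (hf₀.closed.germ.differentiableAt hr).self_of_nhds hσd (hb η₀ hσ₀)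
      (exists_fderiv_ne_zero_of_jetSpan hσd hrank hjet)
  have hres : ∀ᶠ q in 𝓝 (0 : Space 𝕜 (2 * n - 1)), ∀ v w : Space 𝕜 (2 * n - 1),
      pullbackBilin Θ (fun x => bilOf (η₁ x)) (0, q) (0, v) (0, w)
        = pullbackBilin Θ (fun x => bilOf (η₀ x)) (0, q) (0, v) (0, w) := by
    filter_upwards [hb η₀ hσ₀, hb η₁ hσ₁] with q h2 h3 v w
    rw [h2, h3]
  obtain ⟨hequiv, A, hA, hAk⟩ := hf₀.equivalent hr hf₁ hres hR
  constructor
  · have hval : ∀ (η : Form 𝕜 (2 * n) 2) (v w : 𝕜 × Space 𝕜 (2 * n - 1)),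
        pullbackBilin Θ (fun x => bilOf (η x)) 0 v w = η 0 ![e v, e w] := by
      intro η v w
      rw [pullbackBilin_apply, bilOf_apply, ← he, h0]; rfl
    -- The shear, conjugated by the derivative of the chart, carries one form at 0 to the other and
    -- fixes the kernel pointwise.
    refine formKernel_wedgePow_eq _ _ ((e.symm.trans A).trans e).toLinearEquiv ?_ ?_ _
    · refine AlternatingMap.ext fun v => ?_
      rw [vec_two v]
      have h5 := hA (e.symm (v 0)) (e.symm (v 1))
      rw [hval, hval, e.apply_symm_apply, e.apply_symm_apply] at h5
      rw [← ContinuousAlternatingMap.coe_toAlternatingMap] at h5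
      rw [AlternatingMap.compLinearMap_apply]
      refine Eq.trans ?_ h5
      change (η₁ 0).toAlternatingMap _ = (η₁ 0).toAlternatingMap _
      congr 1
      ext1 i
      fin_cases i <;> rfl
    · intro v hv
      have h6 : pullbackBilin Θ (fun x => bilOf (η₀ x)) 0 (e.symm v) = 0 := by
        refine ContinuousLinearMap.ext fun w => ?_
        rw [hval, e.apply_symm_apply]
        exact mem_formKernel_two.1 hv _
      change e (A (e.symm v)) = v
      rw [hAk _ h6, e.apply_symm_apply]
  · refine areEquivalent_of_bilinEquivalent ?_
    have h7 := fun η : Form 𝕜 (2 * n) 2 =>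
      bilinEquivalent_pullback hr (fun x => bilOf (η x)) hΘ h0 e he
    exact ((h7 η₀).symm hr).trans hr (hequiv.trans hr (h7 η₁))

end Transfer

end SingularSymplectic

end

theorem mainTheorem5 :
    -- the smooth and the real-analytic categories
    (∀ (n : ℕ) (r : WithTop ℕ∞), r = ∞ ∨ r = ω →
      ∀ (ω₀ ω₁ : Form ℝ (2 * n) 2)
        (ι : Space ℝ (2 * n - 1) → Space ℝ (2 * n))
        (σ : Form ℝ (2 * n - 1) 2),
      IsSingularSymplectic r ω₀ →
      IsSingularSymplectic r ω₁ →
      IsStructurallySmooth ω₀ →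
      IsStructurallySmooth ω₁ →
      martinetSet ω₀ =ᶠ[𝓝 0] martinetSet ω₁ →
      IsInclusion r ι (martinetSet ω₀) →
      pullback ι ω₀ =ᶠ[𝓝 0] σ →
      pullback ι ω₁ =ᶠ[𝓝 0] σ →
      formRank (σ 0) + 4 = 2 * n →
      Module.finrank ℝ (jetSpan σ) = 2 →
      formKernel (formPow ω₀ (n - 1) 0) =
          formKernel (formPow ω₁ (n - 1) 0) ∧
        ((∃ o : Orientation ℝ (Space ℝ (2 * n - 1)) (Fin (2 * n - 1)),
            IsCanonicalOrientation r ω₀ ι o ∧ IsCanonicalOrientation r ω₁ ι o) →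
          AreEquivalent r ω₀ ω₁)) ∧
    -- the complex-analytic category
    (∀ (n : ℕ) (ω₀ ω₁ : Form ℂ (2 * n) 2)
        (ι : Space ℂ (2 * n - 1) → Space ℂ (2 * n))
        (σ : Form ℂ (2 * n - 1) 2),
      IsSingularSymplectic ω ω₀ →
      IsSingularSymplectic ω ω₁ →
      IsStructurallySmooth ω₀ →
      IsStructurallySmooth ω₁ →
      martinetSet ω₀ =ᶠ[𝓝 0] martinetSet ω₁ →
      IsInclusion ω ι (martinetSet ω₀) →
      pullback ι ω₀ =ᶠ[𝓝 0] σ →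
      pullback ι ω₁ =ᶠ[𝓝 0] σ →
      formRank (σ 0) + 4 = 2 * n →
      Module.finrank ℂ (jetSpan σ) = 2 →
      formKernel (formPow ω₀ (n - 1) 0) =
          formKernel (formPow ω₁ (n - 1) 0) ∧
        AreEquivalent ω ω₀ ω₁) := by
  refine ⟨fun n r hr ω₀ ω₁ ι σ h₀ h₁ hs₀ hs₁ hS hι hσ₀ hσ₁ hrank hjet => ?_,
    fun n ω₀ ω₁ ι σ h₀ h₁ hs₀ hs₁ hS hι hσ₀ hσ₁ hrank hjet => ?_⟩
  · have h := equivalent_of_pullback_eq hr h₀ h₁ hs₀ hs₁ hS hι hσ₀ hσ₁ hrank hjet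
    exact ⟨h.1, fun _ => h.2⟩
  · exact equivalent_of_pullback_eq (Or.inr rfl) h₀ h₁ hs₀ hs₁ hS hι hσ₀ hσ₁ hrank hjet
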